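/- A multigraph (loops and multiple edges allowed; vertices labelled, edges unlabelled) is series-parallel (SP) if it has no $K_4$ minor, and cubic if every vertex has degree $3$, where a loop contributes $2$ to the degree. Its excess is its number of edges minus its number of vertices; a cubic multigraph of excess $k$ has exactly $2k$ vertices. The weight of a cubic multigraph with $l_1$ loops, $l_2$ double edges and $l_3$ triple edges is $2^{-l_1-l_2}6^{-l_3}$. For $k\ge 1$ let $$g_k=\frac{1}{(2k)!}\sum_{M} \mathrm{weight}(M),$$ where $M$ runs over all connected cubic SP multigraphs of excess $k$ with vertex set labelled by $\{1,\dots,2k\}$; that is, $g_k=[u^k]G(u)$, where $G(u)$ is the generating function of connected weighted cubic SP multigraphs, exponential in the labelled vertices and with $u$ marking the excess. Then there is a constant $c$ such that, as $k\to\infty$, $$g_k = c\,k^{-5/2}\,\gamma^{-k}\,(1+o(1)),\qquad \gamma=\frac{4}{27}\sqrt{6\sqrt3-9}.$$ Numerically, $\gamma\approx 0.17481$ and $c\approx 0.06034$, each with error less than $5\cdot10^{-6}$. -/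

import Mathlib

open Filter Asymptotics

/-- `H` is a minor of `G`: there are pairwise disjoint vertex sets of `G` (the branch sets), one for
each vertex of `H`, each inducing a (nonempty) connected subgraph, such that the branch sets of
adjacent vertices of `H` are joined by an edge of `G`. -/
def SimpleGraph.HasMinor {V W : Type*} (G : SimpleGraph V) (H : SimpleGraph W) : Prop :=
  ∃ B : W → Set V, (∀ a, (G.induce (B a)).Connected) ∧
    (∀ a b, a ≠ b → Disjoint (B a) (B b)) ∧
    ∀ a b, H.Adj a b → ∃ x ∈ B a, ∃ y ∈ B b, G.Adj x y

/-- A multigraph with (labelled) vertex set `V` and unlabelled edges, loops allowed: the number of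
edges with end-vertices `v` and `w` is the multiplicity of the unordered pair `s(v, w)`. -/
abbrev VMultigraph (V : Type*) : Type _ := Sym2 V → ℕ

namespace VMultigraph

variable {V : Type*}

/-- The underlying simple graph: forget loops and multiplicities. -/
def toSimple (G : VMultigraph V) : SimpleGraph V where
  Adj v w := v ≠ w ∧ 0 < G s(v, w)
  symm := ⟨fun v w h => ⟨h.1.symm, by rw [Sym2.eq_swap]; exact h.2⟩⟩
  loopless := ⟨fun _ h => h.1 rfl⟩

/-- Connected (and nonempty). -/
def IsConnected (G : VMultigraph V) : Prop := G.toSimple.Connected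

/-- Series-parallel: no `K₄` minor. Loops and multiplicities of edges play no role for
minors isomorphic to the simple graph `K₄`. -/
def IsSeriesParallel (G : VMultigraph V) : Prop :=
  ¬ G.toSimple.HasMinor (⊤ : SimpleGraph (Fin 4))

section Fintype

variable [Fintype V]

/-- The degree of a vertex: the number of incident edges, where loops count twice. -/
def degree (G : VMultigraph V) (v : V) : ℕ := ∑ w, G s(v, w) + G s(v, v)

/-- Cubic: all vertices have degree three. -/
def IsCubic (G : VMultigraph V) : Prop := ∀ v, G.degree v = 3

variable [DecidableEq V]

/-- The number of edges. -/
def numEdges (G : VMultigraph V) : ℕ := ∑ e, G e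

/-- The excess: number of edges minus number of vertices. -/
def excess (G : VMultigraph V) : ℤ := (G.numEdges : ℤ) - Fintype.card V

/-- The number of loops. -/
def numLoops (G : VMultigraph V) : ℕ := ∑ v, G s(v, v)

/-- The number of pairs of distinct vertices joined by exactly `m` edges
(double edges for `m = 2`, triple edges for `m = 3`). -/
def numMultiple (G : VMultigraph V) (m : ℕ) : ℕ :=
  (Finset.univ.filter fun e : Sym2 V => ¬ e.IsDiag ∧ G e = m).card

/-- The weight `2 ^ (-l₁ - l₂) * 6 ^ (-l₃)` of a cubic multigraph with `l₁` loops, `l₂` double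
edges and `l₃` triple edges. -/
noncomputable def weight (G : VMultigraph V) : ℝ :=
  ((2 : ℝ) ^ (G.numLoops + G.numMultiple 2) * 6 ^ G.numMultiple 3)⁻¹

/-- Handshake lemma. -/
theorem sum_degree (G : VMultigraph V) : ∑ v, G.degree v = 2 * G.numEdges := by
  have key : ∀ e : Sym2 V,
      (Finset.univ.filter fun p : V × V => s(p.1, p.2) = e).card +
        (Finset.univ.filter fun v : V => s(v, v) = e).card = 2 := by
    intro e
    induction e using Sym2.ind with
    | _ a b =>
      by_cases h : a = b
      · subst h
        have h1 : (Finset.univ.filter fun p : V × V => s(p.1, p.2) = s(a, a)) = {(a, a)} := by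
          ext ⟨x, y⟩; simp
        have h2 : (Finset.univ.filter fun v : V => s(v, v) = s(a, a)) = {a} := by
          ext x; simp
        rw [h1, h2]; simp
      · have h1 : (Finset.univ.filter fun p : V × V => s(p.1, p.2) = s(a, b)) =
            {(a, b), (b, a)} := by
          ext ⟨x, y⟩; simp
        have h2 : (Finset.univ.filter fun v : V => s(v, v) = s(a, b)) = ∅ := by
          ext x; simp; grind
        rw [h1, h2, Finset.card_pair (by grind)]; simp
  have h1 : ∑ v, ∑ w, G s(v, w) =
      ∑ e, (Finset.univ.filter fun p : V × V => s(p.1, p.2) = e).card * G e := by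
    rw [← Fintype.sum_prod_type' (f := fun v w => G s(v, w)),
      ← Finset.sum_fiberwise (s := Finset.univ) (g := fun p : V × V => s(p.1, p.2))]
    refine Finset.sum_congr rfl fun e _ => ?_
    rw [← smul_eq_mul, ← Finset.sum_const]
    refine Finset.sum_congr rfl fun p hp => ?_
    rw [(Finset.mem_filter.1 hp).2]
  have h2 : ∑ v, G s(v, v) =
      ∑ e, (Finset.univ.filter fun v : V => s(v, v) = e).card * G e := by
    rw [← Finset.sum_fiberwise (s := Finset.univ) (g := fun v : V => s(v, v))]
    refine Finset.sum_congr rfl fun e _ => ?_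
    rw [← smul_eq_mul, ← Finset.sum_const]
    refine Finset.sum_congr rfl fun p hp => ?_
    rw [(Finset.mem_filter.1 hp).2]
  simp only [degree, numEdges, Finset.sum_add_distrib]
  rw [h1, h2, ← Finset.sum_add_distrib, Finset.mul_sum]
  refine Finset.sum_congr rfl fun e _ => ?_
  rw [← add_mul, key]

/-- A cubic multigraph has excess `k` if and only if it has `2 * k` vertices. -/
theorem IsCubic.excess_eq_iff {G : VMultigraph V} (hG : G.IsCubic) (k : ℕ) :
    G.excess = k ↔ Fintype.card V = 2 * k := by
  have h := G.sum_degree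
  rw [Finset.sum_congr rfl fun v _ => hG v] at h
  simp only [Finset.sum_const, Finset.card_univ, smul_eq_mul] at h
  unfold excess
  omega

end Fintype

/-- The connected cubic series-parallel multigraphs of excess `k` on `n` labelled vertices. -/
def cubicSP (n k : ℕ) : Set (VMultigraph (Fin n)) :=
  {G | G.IsConnected ∧ G.IsCubic ∧ G.IsSeriesParallel ∧ G.excess = k}

theorem cubicSP_finite (n k : ℕ) : (cubicSP n k).Finite := by
  refine (Set.Finite.pi' fun _ : Sym2 (Fin n) => Set.finite_Iic 3).subset ?_
  rintro G ⟨-, hG, -⟩ e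
  induction e using Sym2.ind with
  | _ a b =>
    have h : G s(a, b) ≤ ∑ w, G s(a, w) := Finset.single_le_sum (f := fun w => G s(a, w)) (fun _ _ => Nat.zero_le _)
      (Finset.mem_univ b)
    have h3 := hG a
    simp only [degree] at h3
    simp only [Set.mem_Iic]
    omega

theorem cubicSP_eq_empty {n k : ℕ} (h : n ≠ 2 * k) : cubicSP n k = ∅ := by
  refine Set.eq_empty_of_forall_notMem fun G hG => h ?_
  simpa using (hG.2.1.excess_eq_iff k).1 hG.2.2.2

/-- The weighted number `g k` of connected cubic series-parallel multigraphs of excess `k`, that is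
the coefficient of `u ^ k` in their generating function, exponential in the labelled vertices:
the sum of the weights of those on `n` labelled vertices, divided by `n!`. Only `n = 2 * k`
contributes, by `cubicSP_eq_empty`. -/
noncomputable def g (k : ℕ) : ℝ :=
  (∑ G ∈ (cubicSP_finite (2 * k) k).toFinset, G.weight) / (Nat.factorial (2 * k) : ℝ)

end VMultigraph

/-- The constant `γ = (4 / 27) * √(6 √3 - 9)`. -/
noncomputable def gammaSP : ℝ := 4 / 27 * Real.sqrt (6 * Real.sqrt 3 - 9)

/-! Cut every edge into two half-edges and number the three half-edges at each vertex: a cubic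
multigraph on `V` becomes a fixed-point-free involution of `V × Fin 3`. Double counting with
numberings of the parallel edges shows that a cubic multigraph `G` comes from exactly `6 ^ |V| *
weight G` involutions (`VMultigraph.IsCubic.card_isMatchingOf`). The weighted sum is therefore a
plain count of matchings whose graph is connected without `K₄` minor.

These matchings are counted by cutting them into networks. A network has a vertex set `S` and some
legs, which are half-edges outside `S`; it is series-parallel if merging everything outside `S` into
one node `none` creates no `K₄` minor. Let `T`, `K`, `J` be the series, with `x` marking vertices,
of the connected series-parallel networks with one, two and three legs. For at most two legs,
deleting the vertex next to a leg preserves the series-parallel property (`SP_erase`), as does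
splitting into components (`SP_union`). This gives `2T = x(K + T²)` and `2K = 2 + x(2TK + J)`. The
absence of `K₄` is used essentially for three legs: some vertex separates them, since otherwise the
outside, a set grown from one leg, and the surroundings of the other two legs form a `K₄`
(`exists_separating`). That vertex is unique, and the network is a parallel composition of three
networks with two legs (`SP_parallel`), so `J = xK³`. Removing one vertex of a closed connected
graph leaves a network with three legs whose components all meet a leg; these have series `J + 3TK +
T³` (`Counted.card_closed`).

With `u = x²` and `W = xT` the system becomes `2W = W² + uK`, `2K = 2 + 2KW + uK³`. This curve is
rational: `u = r / φ(r)` with `φ = (3 - r²)³ / (4 (1 - r)² (3 - r)²)`, and `W = 2r(1 - r) / (3 -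
r²)`. Lagrange inversion yields `g k = [r ^ k] (W'(r) φ(r) ^ (k + 1)) / (3k(k + 1))` (`g_eq_coeff`).

The coefficient is a Fourier integral over the circle of radius `τ`, where `τ φ'(τ) = φ(τ)`, that is
`τ = 3 + √3 - √(9 + 6√3)`. Laplace's method (`tendsto_sqrt_mul_integral_pow`) applies because the
normalised integrand is dominated by a Gaussian on the whole circle (`norm_chi_le`). It contributes
`k ^ (-1/2) * (φ(τ) / τ) ^ k`; together with `1 / (3k(k + 1))` this gives the exponent `-5/2` and `γ
= τ / φ(τ)`. -/

namespace SimpleGraph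

/-! ### Connected vertex sets and transport of minors. -/

variable {V W U : Type*}

/-- Closed-set description of connectedness of an induced subgraph. -/
def ConnOn (G : SimpleGraph V) (A : Set V) : Prop :=
  A.Nonempty ∧ ∀ X : Set V, (∀ a ∈ A, ∀ b ∈ A, G.Adj a b → a ∈ X → b ∈ X) →
    ∀ a ∈ A, ∀ b ∈ A, a ∈ X → b ∈ X

theorem induce_connected_iff_connOn {G : SimpleGraph V} {A : Set V} :
    (G.induce A).Connected ↔ G.ConnOn A := by
  constructor
  · intro h
    refine ⟨?_, fun X hX a ha b hb haX => ?_⟩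
    · obtain ⟨x⟩ := h.nonempty
      exact ⟨x, x.2⟩
    · have hr : (G.induce A).Reachable ⟨a, ha⟩ ⟨b, hb⟩ := h.preconnected _ _
      obtain ⟨w⟩ := hr
      have key : ∀ (x y : A), (G.induce A).Walk x y → (x : V) ∈ X → (y : V) ∈ X := by
        intro x y w
        induction w with
        | nil => exact id
        | cons hadj _ ih => exact fun hx => ih (hX _ (Subtype.prop _) _ (Subtype.prop _) hadj hx)
      exact key _ _ w haX
  · rintro ⟨⟨x, hx⟩, h⟩
    have : Nonempty A := ⟨⟨x, hx⟩⟩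
    refine Connected.mk fun a b => ?_
    have := h {y | ∃ hy : y ∈ A, (G.induce A).Reachable a ⟨y, hy⟩} ?_ a a.2 b b.2
      ⟨a.2, Reachable.refl _⟩
    · exact this.2
    · rintro u hu v hv huv ⟨hy, hr⟩
      exact ⟨hv, hr.trans (Adj.reachable (G := G.induce A) (u := ⟨u, hu⟩) (v := ⟨v, hv⟩) huv)⟩

theorem hasMinor_iff_connOn {G : SimpleGraph V} {H : SimpleGraph W} :
    G.HasMinor H ↔ ∃ B : W → Set V, (∀ a, G.ConnOn (B a)) ∧
      (∀ a b, a ≠ b → Disjoint (B a) (B b)) ∧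
      ∀ a b, H.Adj a b → ∃ x ∈ B a, ∃ y ∈ B b, G.Adj x y := by
  simp only [HasMinor, induce_connected_iff_connOn]

theorem ConnOn.singleton (G : SimpleGraph V) (a : V) : G.ConnOn {a} :=
  ⟨⟨a, rfl⟩, fun X _ x hx y hy h => by rw [Set.mem_singleton_iff] at hx hy; subst hx hy; exact h⟩

/-- A map preserving adjacency up to equality carries connected sets to connected sets. -/
theorem ConnOn.image {G : SimpleGraph V} {G' : SimpleGraph W} {f : V → W} {A : Set V}
    (hA : G.ConnOn A)
    (hf : ∀ a ∈ A, ∀ b ∈ A, G.Adj a b → f a = f b ∨ G'.Adj (f a) (f b)) :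
    G'.ConnOn (f '' A) := by
  refine ⟨hA.1.image f, ?_⟩
  rintro X hX _ ⟨a, ha, rfl⟩ _ ⟨b, hb, rfl⟩ h
  refine hA.2 (f ⁻¹' X) (fun a ha b hb hab haX => ?_) a ha b hb h
  rcases hf a ha b hb hab with h | h
  · simpa [← h] using haX
  · exact hX _ ⟨a, ha, rfl⟩ _ ⟨b, hb, rfl⟩ h haX

/-- Connected sets that meet both a set and its complement contain an edge between the two. -/
theorem ConnOn.exists_adj {G : SimpleGraph V} {A : Set V} (hA : G.ConnOn A) {X : Set V} {a b : V}
    (ha : a ∈ A) (haX : a ∈ X) (hb : b ∈ A) (hbX : b ∉ X) :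
    ∃ x ∈ A, ∃ y ∈ A, x ∈ X ∧ y ∉ X ∧ G.Adj x y := by
  by_contra! hcon
  exact hbX (hA.2 X (fun x hx y hy hxy hxX => by
    by_contra hyX
    exact hcon x hx y hy hxX hyX hxy) a ha b hb haX)

theorem ConnOn.union {G : SimpleGraph V} {A B : Set V} (hA : G.ConnOn A) (hB : G.ConnOn B)
    (h : ∃ a ∈ A, ∃ b ∈ B, a = b ∨ G.Adj a b) : G.ConnOn (A ∪ B) := by
  obtain ⟨a, ha, b, hb, hab⟩ := h
  refine ⟨hA.1.mono Set.subset_union_left, fun X hX => ?_⟩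
  have hXA := hA.2 X fun x hx y hy => hX x (Or.inl hx) y (Or.inl hy)
  have hXB := hB.2 X fun x hx y hy => hX x (Or.inr hx) y (Or.inr hy)
  have h1 : a ∈ X ↔ b ∈ X := by
    rcases hab with rfl | hab
    · rfl
    · exact ⟨hX a (Or.inl ha) b (Or.inr hb) hab, hX b (Or.inr hb) a (Or.inl ha) hab.symm⟩
  have hall : ∀ x ∈ A ∪ B, (x ∈ X ↔ a ∈ X) := by
    rintro x (hx | hx)
    · exact ⟨hXA x hx a ha, hXA a ha x hx⟩
    · rw [h1]; exact ⟨hXB x hx b hb, hXB b hb x hx⟩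
  intro x hx y hy hxX
  exact (hall y hy).2 ((hall x hx).1 hxX)

theorem ConnOn.biUnion {G : SimpleGraph V} {G' : SimpleGraph W} {B : W → Set V} {A : Set W}
    (hA : G'.ConnOn A) (hB : ∀ w ∈ A, G.ConnOn (B w))
    (hadj : ∀ a ∈ A, ∀ b ∈ A, G'.Adj a b → ∃ x ∈ B a, ∃ y ∈ B b, G.Adj x y) :
    G.ConnOn (⋃ w ∈ A, B w) := by
  obtain ⟨w, hw⟩ := hA.1
  refine ⟨?_, ?_⟩
  · obtain ⟨x, hx⟩ := (hB w hw).1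
    exact ⟨x, Set.mem_biUnion hw hx⟩
  · intro X hX
    have hXB : ∀ w ∈ A, ∀ x ∈ B w, ∀ y ∈ B w, x ∈ X → y ∈ X := fun w hw =>
      (hB w hw).2 X fun x hx y hy => hX x (Set.mem_biUnion hw hx) y (Set.mem_biUnion hw hy)
    have key := hA.2 {w | ∃ x ∈ B w, x ∈ X} (by
      rintro a ha b hb hab ⟨x, hx, hxX⟩
      obtain ⟨x', hx', y', hy', h⟩ := hadj a ha b hb hab
      exact ⟨y', hy', hX x' (Set.mem_biUnion ha hx') y' (Set.mem_biUnion hb hy') h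
        (hXB a ha x hx x' hx' hxX)⟩)
    intro x hx y hy hxX
    simp only [Set.mem_iUnion] at hx hy
    obtain ⟨a, ha, hx⟩ := hx
    obtain ⟨b, hb, hy⟩ := hy
    obtain ⟨y', hy', hyX⟩ := key a ha b hb ⟨x, hx, hxX⟩
    exact hXB b hb y' hy' y hy hyX

/-- A model of a minor. -/
structure Model (G : SimpleGraph V) (H : SimpleGraph W) (B : W → Set V) : Prop where
  conn : ∀ a, G.ConnOn (B a)
  disj : ∀ a b, a ≠ b → Disjoint (B a) (B b)
  adj : ∀ a b, H.Adj a b → ∃ x ∈ B a, ∃ y ∈ B b, G.Adj x y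

theorem hasMinor_iff_model {G : SimpleGraph V} {H : SimpleGraph W} :
    G.HasMinor H ↔ ∃ B, G.Model H B := by
  rw [hasMinor_iff_connOn]
  exact ⟨fun ⟨B, h⟩ => ⟨B, h.1, h.2.1, h.2.2⟩, fun ⟨B, h⟩ => ⟨B, h.1, h.2, h.3⟩⟩

/-- Contractions are harmless for a model as long as they only identify vertices that do not belong
to two different branch sets. -/
theorem Model.push {G : SimpleGraph V} {G' : SimpleGraph U} {H : SimpleGraph W} {B : W → Set V}
    (hB : G.Model H B) (f : V → U) (hf : ∀ a b, G.Adj a b → f a = f b ∨ G'.Adj (f a) (f b))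
    (hd : ∀ a b, a ≠ b → ∀ x ∈ B a, ∀ y ∈ B b, f x ≠ f y) : G'.HasMinor H := by
  refine hasMinor_iff_model.2 ⟨fun a => f '' B a, fun a => (hB.conn a).image fun a _ b _ => hf a b,
    fun a b hab => ?_, fun a b hab => ?_⟩
  · rw [Set.disjoint_left]
    rintro _ ⟨x, hx, rfl⟩ ⟨y, hy, hxy⟩
    exact hd a b hab x hx y hy hxy.symm
  · obtain ⟨x, hx, y, hy, h⟩ := hB.adj a b hab
    exact ⟨f x, ⟨x, hx, rfl⟩, f y, ⟨y, hy, rfl⟩,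
      (hf x y h).resolve_left (hd a b hab.ne x hx y hy)⟩

theorem Model.eq_of_mem {G : SimpleGraph V} {H : SimpleGraph W} {B : W → Set V}
    (hB : G.Model H B) {a b : W} {x : V} (ha : x ∈ B a) (hb : x ∈ B b) : a = b := by
  by_contra h
  exact Set.disjoint_left.1 (hB.disj a b h) ha hb

/-- A minor of a minor is a minor: each `w` is expanded into the connected set `B w`. The set `T`
allows nodes that no branch set uses to be ignored. -/
theorem Model.pull {G : SimpleGraph V} {G' : SimpleGraph W} {H : SimpleGraph U} {B' : U → Set W}
    (h' : G'.Model H B') (B : W → Set V) (T : Set W) (hT : ∀ c, B' c ⊆ T)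
    (hc : ∀ w ∈ T, G.ConnOn (B w)) (hd : ∀ a ∈ T, ∀ b ∈ T, a ≠ b → Disjoint (B a) (B b))
    (ha : ∀ a ∈ T, ∀ b ∈ T, G'.Adj a b → ∃ x ∈ B a, ∃ y ∈ B b, G.Adj x y) : G.HasMinor H := by
  refine hasMinor_iff_model.2 ⟨fun c => ⋃ w ∈ B' c, B w,
    fun c => (h'.conn c).biUnion (fun w hw => hc w (hT c hw))
      fun a h1 b h2 => ha a (hT c h1) b (hT c h2), fun a b hab => ?_, fun a b hab => ?_⟩
  · rw [Set.disjoint_left]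
    intro x hx hx'
    simp only [Set.mem_iUnion] at hx hx'
    obtain ⟨w, hw, hx⟩ := hx
    obtain ⟨w', hw', hx'⟩ := hx'
    refine Set.disjoint_left.1 (hd w (hT _ hw) w' (hT _ hw') ?_) hx hx'
    rintro rfl
    exact Set.disjoint_left.1 (h'.disj a b hab) hw hw'
  · obtain ⟨x, hx, y, hy, hxy⟩ := h'.adj a b hab
    obtain ⟨x', hx', y', hy', h⟩ := ha x (hT _ hx) y (hT _ hy) hxy
    exact ⟨x', Set.mem_biUnion hx hx', y', Set.mem_biUnion hy hy', h⟩

/-- No vertex of a branch set of a complete minor with at least two vertices is isolated. -/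
theorem Model.exists_adj {G : SimpleGraph V} [Nontrivial W] {B : W → Set V}
    (hB : G.Model (⊤ : SimpleGraph W) B) {a : W} {x : V} (hx : x ∈ B a) : ∃ y, G.Adj x y := by
  obtain ⟨b, hb⟩ := exists_ne a
  obtain ⟨u, hu, y, -, huy⟩ := hB.adj a b hb.symm
  by_cases h : u = x
  · exact ⟨y, h ▸ huy⟩
  · obtain ⟨x', -, z, -, hx', -, hz⟩ := (hB.conn a).exists_adj (X := {x}) hx rfl hu h
    exact ⟨z, by rwa [Set.mem_singleton_iff.1 hx'] at hz⟩

end SimpleGraph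

/-! ### Networks of half-edges, reachability, and the closure of a network. -/

namespace HalfEdge

variable {V : Type*}

/-- `σ` is a perfect matching of the half-edges in `D`, extended by the identity. -/
def IsMatching (D : Finset (V × Fin 3)) (σ : V × Fin 3 → V × Fin 3) : Prop :=
  (∀ h ∈ D, σ h ∈ D ∧ σ (σ h) = h ∧ σ h ≠ h) ∧ ∀ h ∉ D, σ h = h

theorem IsMatching.involutive {D : Finset (V × Fin 3)} {σ : V × Fin 3 → V × Fin 3}
    (h : IsMatching D σ) : Function.Involutive σ := fun x => by
  by_cases hx : x ∈ D
  · exact (h.1 x hx).2.1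
  · rw [h.2 x hx, h.2 x hx]

/-- Two half-edges are linked if they form an edge or are at a common vertex in `S`. -/
def Link (S : Finset V) (σ : V × Fin 3 → V × Fin 3) (h h' : V × Fin 3) : Prop :=
  σ h = h' ∨ (h.1 ∈ S ∧ h'.1 = h.1)

/-- Reachability in the network with vertex set `S`. -/
def Reach (S : Finset V) (σ : V × Fin 3 → V × Fin 3) : V × Fin 3 → V × Fin 3 → Prop :=
  Relation.EqvGen (Link S σ)

variable {S A B : Finset V} {σ σ' : V × Fin 3 → V × Fin 3} {h h' h'' : V × Fin 3}

theorem Reach.refl (h : V × Fin 3) : Reach S σ h h := Relation.EqvGen.refl h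

theorem Reach.symm (r : Reach S σ h h') : Reach S σ h' h := Relation.EqvGen.symm _ _ r

theorem Reach.trans (r : Reach S σ h h') (r' : Reach S σ h' h'') : Reach S σ h h'' :=
  Relation.EqvGen.trans _ _ _ r r'

theorem Reach.partner (S : Finset V) (σ : V × Fin 3 → V × Fin 3) (h : V × Fin 3) :
    Reach S σ h (σ h) :=
  Relation.EqvGen.rel _ _ (Or.inl rfl)

theorem Reach.sibling (hS : h.1 ∈ S) (e : h'.1 = h.1) : Reach S σ h h' :=
  Relation.EqvGen.rel _ _ (Or.inr ⟨hS, e⟩)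

/-- The invariant principle behind all reachability arguments: closure in one direction suffices
because both kinds of link are symmetric. -/
theorem Reach.mem_iff (hσ : Function.Involutive σ) {X : Set (V × Fin 3)} (h1 : ∀ h ∈ X, σ h ∈ X)
    (h2 : ∀ h ∈ X, h.1 ∈ S → ∀ h' : V × Fin 3, h'.1 = h.1 → h' ∈ X) (r : Reach S σ h h') :
    h ∈ X ↔ h' ∈ X := by
  induction r with
  | rel x y hxy =>
    rcases hxy with rfl | ⟨hS, e⟩
    · exact ⟨h1 x, fun h => hσ x ▸ h1 _ h⟩
    · exact ⟨fun h => h2 x h hS y e, fun h => h2 y h (e ▸ hS) x e.symm⟩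
  | refl => rfl
  | symm _ _ _ ih => exact ih.symm
  | trans _ _ _ _ _ ih ih' => exact ih.trans ih'

theorem Reach.mono (hAS : A ⊆ S) (r : Reach A σ h h') : Reach S σ h h' :=
  Relation.EqvGen.mono (fun _ _ h => h.imp_right fun h => ⟨hAS h.1, h.2⟩) _ _ r

/-- Reachability inside a closed set of half-edges depends only on the network inside it. -/
theorem Reach.transfer (hσ' : Function.Involutive σ') {X : Set (V × Fin 3)}
    (h1 : ∀ h ∈ X, σ' h ∈ X) (h2 : ∀ h ∈ X, h.1 ∈ A → ∀ h' : V × Fin 3, h'.1 = h.1 → h' ∈ X)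
    (h3 : ∀ h ∈ X, σ' h = σ h) (h4 : ∀ h ∈ X, h.1 ∈ A → h.1 ∈ S) (hX : h ∈ X)
    (r : Reach A σ' h h') : h' ∈ X ∧ Reach S σ h h' := by
  refine (r.mem_iff (X := {x | x ∈ X ∧ Reach S σ h x}) hσ' ?_ ?_).1 ⟨hX, Reach.refl _⟩
  · rintro x ⟨hx, hr⟩
    refine ⟨h1 x hx, hr.trans ?_⟩
    rw [h3 x hx]
    exact Reach.partner S σ x
  · rintro x ⟨hx, hr⟩ hA y hy
    exact ⟨h2 x hx hA y hy, hr.trans (Reach.sibling (h4 x hx hA) hy)⟩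

variable [DecidableEq V]

/-- The node of a half-edge in the closure of a network with vertex set `S`. -/
def node (S : Finset V) (h : V × Fin 3) : Option V := if h.1 ∈ S then some h.1 else none

theorem node_of_mem (hS : h.1 ∈ S) : node S h = some h.1 := if_pos hS

theorem node_of_notMem (hS : h.1 ∉ S) : node S h = none := if_neg hS

theorem node_eq_some {v : V} : node S h = some v ↔ h.1 = v ∧ v ∈ S := by
  unfold node; grind

theorem node_eq_none : node S h = none ↔ h.1 ∉ S := by
  unfold node; grind

/-- The closure of a network: the outer ends of all legs are joined in the node `none`. -/
def closureGraph (S : Finset V) (σ : V × Fin 3 → V × Fin 3) : SimpleGraph (Option V) :=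
  SimpleGraph.fromRel fun a b => ∃ h, node S h = a ∧ node S (σ h) = b

theorem closureGraph_adj (hσ : Function.Involutive σ) {a b : Option V} :
    (closureGraph S σ).Adj a b ↔ a ≠ b ∧ ∃ h, node S h = a ∧ node S (σ h) = b := by
  rw [closureGraph, SimpleGraph.fromRel_adj]
  refine and_congr_right fun _ => ⟨?_, Or.inl⟩
  rintro (h | ⟨h, h1, h2⟩)
  · exact h
  · exact ⟨σ h, h2, by rwa [hσ h]⟩

/-- A network is series-parallel if its closure has no `K₄` minor. -/
def SP (S : Finset V) (σ : V × Fin 3 → V × Fin 3) : Prop :=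
  ¬ (closureGraph S σ).HasMinor (⊤ : SimpleGraph (Fin 4))

/-- An edge with no end in `S` is a loop at `none` and is invisible. Hence the closure of a part
does not depend on the rest of the matching. -/
theorem closureGraph_congr (hσ : Function.Involutive σ) (hσ' : Function.Involutive σ')
    (h : ∀ h : V × Fin 3, h.1 ∈ S → σ h = σ' h) : closureGraph S σ = closureGraph S σ' := by
  have key : ∀ {σ σ' : V × Fin 3 → V × Fin 3} (_ : Function.Involutive σ)
      (_ : Function.Involutive σ') (_ : ∀ h : V × Fin 3, h.1 ∈ S → σ h = σ' h) (a b : Option V),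
      (closureGraph S σ).Adj a b → (closureGraph S σ').Adj a b := by
    intro σ σ' hσ hσ' h a b
    rw [closureGraph_adj hσ, closureGraph_adj hσ']
    rintro ⟨hab, x, rfl, rfl⟩
    refine ⟨hab, ?_⟩
    by_cases h1 : x.1 ∈ S
    · exact ⟨x, rfl, by rw [h x h1]⟩
    · by_cases h2 : (σ x).1 ∈ S
      · refine ⟨σ' (σ x), ?_, ?_⟩
        · rw [← h _ h2, hσ]
        · rw [hσ']
      · exact absurd (by rw [node_of_notMem h1, node_of_notMem h2]) hab
  ext a b
  exact ⟨key hσ hσ' h a b, key hσ' hσ (fun x hx => (h x hx).symm) a b⟩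

theorem SP_congr (hσ : Function.Involutive σ) (hσ' : Function.Involutive σ')
    (h : ∀ h : V × Fin 3, h.1 ∈ S → σ h = σ' h) : SP S σ ↔ SP S σ' := by
  rw [SP, SP, closureGraph_congr hσ hσ' h]

/-- Nodes outside `A` are contracted to `none`. -/
def proj (A : Finset V) : Option V → Option V
  | none => none
  | some v => if v ∈ A then some v else none

theorem proj_node (hAS : A ⊆ S) : proj A (node S h) = node A h := by
  unfold node proj
  have := @hAS h.1
  split_ifs <;> simp_all

theorem proj_adj (hσ : Function.Involutive σ) (hAS : A ⊆ S) {a b : Option V}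
    (hab : (closureGraph S σ).Adj a b) :
    proj A a = proj A b ∨ (closureGraph A σ).Adj (proj A a) (proj A b) := by
  rw [closureGraph_adj hσ] at *
  obtain ⟨-, h, rfl, rfl⟩ := hab
  rw [proj_node hAS, proj_node hAS]
  by_cases hn : node A h = node A (σ h)
  · exact Or.inl hn
  · exact Or.inr ⟨hn, h, rfl, rfl⟩

theorem proj_eq_some {a : Option V} {v : V} : proj A a = some v ↔ a = some v ∧ v ∈ A := by
  cases a <;> grind [proj]

theorem proj_eq_none {a : Option V} : proj A a = none ↔ ∀ v ∈ A, a ≠ some v := by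
  cases a <;> grind [proj]

/-- Reachable sets of half-edges span connected sets of nodes. -/
theorem connOn_node_image (hσ : Function.Involutive σ) {D : Set (V × Fin 3)}
    (h1 : ∀ h ∈ D, σ h ∈ D) (h2 : ∀ h ∈ D, h.1 ∈ A → ∀ h' : V × Fin 3, h'.1 = h.1 → h' ∈ D)
    {h₀ : V × Fin 3} (h₀D : h₀ ∈ D) (hr : ∀ h ∈ D, Reach A σ h₀ h) :
    (closureGraph S σ).ConnOn (node S '' D) := by
  refine ⟨⟨_, h₀, h₀D, rfl⟩, fun X hX => ?_⟩
  have key : ∀ h ∈ D, (node S h ∈ X ↔ node S h₀ ∈ X) := by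
    intro h hh
    have := (hr h hh).mem_iff (X := {h | h ∈ D ∧ node S h ∈ X}) hσ ?_ ?_
    · simpa [hh, h₀D] using this.symm
    · rintro x ⟨hx, hxX⟩
      refine ⟨h1 x hx, ?_⟩
      by_cases hn : node S x = node S (σ x)
      · exact hn ▸ hxX
      · exact hX _ ⟨x, hx, rfl⟩ _ ⟨_, h1 x hx, rfl⟩
          ((closureGraph_adj hσ).2 ⟨hn, x, rfl, rfl⟩) hxX
    · rintro x ⟨hx, hxX⟩ hxA y hy
      refine ⟨h2 x hx hxA y hy, ?_⟩
      have : node S y = node S x := by simp [node, hy]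
      exact this ▸ hxX
  rintro _ ⟨x, hx, rfl⟩ _ ⟨y, hy, rfl⟩ h
  exact (key y hy).2 ((key x hx).1 h)

end HalfEdge

/-! ### The series-parallel property under one-sums and under deletion of a vertex next to a leg. -/

namespace HalfEdge

/-- At most one branch set contains a given vertex. -/
theorem exists_forall_notMem {V : Type*} {G : SimpleGraph V}
    {U : Fin 4 → Set V}
    (hU : G.Model (⊤ : SimpleGraph (Fin 4)) U) (x : V) : ∃ i, ∀ j, j ≠ i → x ∉ U j := by
  by_cases h : ∃ i, x ∈ U i
  · obtain ⟨i, hi⟩ := h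
    exact ⟨i, fun j hj hx => hj (hU.eq_of_mem hx hi)⟩
  · push Not at h
    exact ⟨0, fun j _ => h j⟩

variable {V : Type*} [DecidableEq V] {S A B : Finset V} {σ : V × Fin 3 → V × Fin 3}

theorem closureGraph_le (hσ : Function.Involutive σ) (hAS : A ⊆ S)
    (hA : ∀ h : V × Fin 3, h.1 ∈ A → (σ h).1 ∈ A ∨ (σ h).1 ∉ S) :
    closureGraph A σ ≤ closureGraph S σ := by
  have key : ∀ h : V × Fin 3, h.1 ∈ A → node S h = node A h ∧ node S (σ h) = node A (σ h) := by
    intro h hh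
    refine ⟨by rw [node_of_mem hh, node_of_mem (hAS hh)], ?_⟩
    rcases hA h hh with h1 | h1
    · rw [node_of_mem h1, node_of_mem (hAS h1)]
    · rw [node_of_notMem h1, node_of_notMem fun h2 => h1 (hAS h2)]
  intro a b
  rw [closureGraph_adj hσ, closureGraph_adj hσ]
  rintro ⟨hab, h, rfl, rfl⟩
  refine ⟨hab, h, ?_⟩
  by_cases h1 : h.1 ∈ A
  · exact key h h1
  · by_cases h2 : (σ h).1 ∈ A
    · have := key (σ h) h2
      rw [hσ h] at this
      exact this.symm
    · exact absurd (by rw [node_of_notMem h1, node_of_notMem h2]) hab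

/-- In a one-sum at `none`, a model of `K₄` all of whose branch sets but one are in one part
projects to that part. -/
theorem not_SP_of_model_subset (hσ : Function.Involutive σ) (hAS : A ⊆ S)
    {U : Fin 4 → Set (Option V)} (hU : (closureGraph S σ).Model ⊤ U) (i : Fin 4)
    (hi : ∀ j, j ≠ i → ∀ x ∈ U j, ∃ v ∈ A, x = some v) : ¬ SP A σ := by
  rw [SP, not_not]
  refine hU.push (proj A) (fun a b => proj_adj hσ hAS) fun a b hab x hx y hy hxy => ?_
  wlog ha : a ≠ i generalizing a b x y
  · rw [not_not] at ha
    exact this b a hab.symm y hy x hx hxy.symm fun hb => hab (ha.trans hb.symm)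
  obtain ⟨v, hv, rfl⟩ := hi a ha x hx
  have h1 : proj A (some v) = some v := proj_eq_some.2 ⟨rfl, hv⟩
  rw [h1, eq_comm, proj_eq_some] at hxy
  exact hab (hU.eq_of_mem hx (hxy.1 ▸ hy))

theorem exists_closureGraph_adj {a b : Option V} (hσ : Function.Involutive σ)
    (h : (closureGraph S σ).Adj a b) : ∃ h, node S h = a ∧ node S (σ h) = b :=
  ((closureGraph_adj hσ).1 h).2

/-- Vertices outside `S` remain as isolated vertices of the closure, and branch sets of `K₄` contain
no isolated vertex. -/
theorem mem_of_model {U : Fin 4 → Set (Option V)} (hσ : Function.Involutive σ)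
    (hU : (closureGraph S σ).Model ⊤ U) {a : Fin 4} {v : V} (hv : some v ∈ U a) : v ∈ S := by
  obtain ⟨y, hy⟩ := hU.exists_adj hv
  obtain ⟨h, h1, -⟩ := exists_closureGraph_adj hσ hy
  exact (node_eq_some.1 h1).2

/-- A one-sum is series-parallel if and only if both parts are. -/
theorem SP_union (hσ : Function.Involutive σ)
    (hA : ∀ h : V × Fin 3, h.1 ∈ A → (σ h).1 ∉ B) :
    SP (A ∪ B) σ ↔ SP A σ ∧ SP B σ := by
  have hB : ∀ h : V × Fin 3, h.1 ∈ B → (σ h).1 ∉ A := fun h hh h2 => hA _ h2 (by rwa [hσ h])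
  constructor
  · refine fun h => ⟨fun h' => h ?_, fun h' => h ?_⟩
    · obtain ⟨U, hU⟩ := SimpleGraph.hasMinor_iff_model.1 h'
      have hle := closureGraph_le hσ (A := A) (S := A ∪ B) Finset.subset_union_left fun h hh => by
        by_cases h1 : (σ h).1 ∈ A
        · exact Or.inl h1
        · exact Or.inr fun h2 => (Finset.mem_union.1 h2).elim h1 (hA h hh)
      exact hU.pull (fun a => {a}) Set.univ (fun _ => Set.subset_univ _)
        (fun a _ => SimpleGraph.ConnOn.singleton _ a) (fun a _ b _ hab => by simpa using hab)
        fun a _ b _ hab => ⟨a, rfl, b, rfl, hle hab⟩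
    · obtain ⟨U, hU⟩ := SimpleGraph.hasMinor_iff_model.1 h'
      have hle := closureGraph_le hσ (A := B) (S := A ∪ B) Finset.subset_union_right fun h hh => by
        by_cases h1 : (σ h).1 ∈ B
        · exact Or.inl h1
        · exact Or.inr fun h2 => (Finset.mem_union.1 h2).elim (hB h hh) h1
      exact hU.pull (fun a => {a}) Set.univ (fun _ => Set.subset_univ _)
        (fun a _ => SimpleGraph.ConnOn.singleton _ a) (fun a _ b _ hab => by simpa using hab)
        fun a _ b _ hab => ⟨a, rfl, b, rfl, hle hab⟩
  · rintro ⟨h1, h2⟩ h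
    obtain ⟨U, hU⟩ := SimpleGraph.hasMinor_iff_model.1 h
    obtain ⟨i, hi⟩ := exists_forall_notMem hU none
    -- The two sides touch only in `none`, so the branch sets avoiding `none`, being connected and
    -- pairwise adjacent, all lie on one side.
    have hcross : ∀ a b : V, (closureGraph (A ∪ B) σ).Adj (some a) (some b) → a ∈ A → b ∈ A := by
      intro a b hab ha
      obtain ⟨h, h3, h4⟩ := exists_closureGraph_adj hσ hab
      rw [node_eq_some] at h3 h4
      have := hA h (h3.1 ▸ ha)
      rw [h4.1] at this
      exact (Finset.mem_union.1 h4.2).resolve_right this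
    have hside : ∀ j, j ≠ i → ∀ x ∈ U j, ∀ y ∈ U j, (∃ v ∈ A, x = some v) →
        ∃ v ∈ A, y = some v := by
      intro j hj
      refine (hU.conn j).2 {x | ∃ v ∈ A, x = some v} ?_
      rintro x hx y hy hxy ⟨v, hv, rfl⟩
      cases y with
      | none => exact absurd hy (hi j hj)
      | some w => exact ⟨w, hcross v w hxy hv, rfl⟩
    have hother : ∀ j k, j ≠ i → k ≠ i → ∀ x ∈ U j, ∀ y ∈ U k, (∃ v ∈ A, x = some v) →
        ∃ v ∈ A, y = some v := by
      intro j k hj hk x hx y hy hxA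
      by_cases hjk : j = k
      · subst hjk
        exact hside j hj x hx y hy hxA
      · obtain ⟨x', hx', y', hy', h⟩ := hU.adj j k hjk
        refine hside k hk y' hy' y hy ?_
        obtain ⟨v, hv, rfl⟩ := hside j hj x hx x' hx' hxA
        cases y' with
        | none => exact absurd hy' (hi k hk)
        | some w => exact ⟨w, hcross v w h hv, rfl⟩
    obtain ⟨j, hj⟩ := exists_ne i
    obtain ⟨x, hx⟩ := (hU.conn j).1
    by_cases hxA : ∃ v ∈ A, x = some v
    · exact not_SP_of_model_subset hσ Finset.subset_union_left hU i
        (fun k hk y hy => hother j k hj hk x hx y hy hxA) h1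
    · refine not_SP_of_model_subset hσ Finset.subset_union_right hU i (fun k hk y hy => ?_) h2
      cases y with
      | none => exact absurd hy (hi k hk)
      | some w =>
        refine ⟨w, (Finset.mem_union.1 (mem_of_model hσ hU hy)).resolve_left fun hw => ?_, rfl⟩
        exact hxA (hother k j hk hj _ hy x hx ⟨w, hw, rfl⟩)

theorem node_erase (v : V) (h : V × Fin 3) :
    node (S.erase v) h = if node S h = some v then none else node S h := by
  unfold node; grind

/-- Deleting a vertex next to a leg of a network with at most two legs. -/
theorem SP_erase (hσ : Function.Involutive σ) {v : V} (hv : v ∈ S) {l m : V × Fin 3}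
    (hl : (σ l).1 = v) (hlS : l.1 ∉ S)
    (hlegs : ∀ h : V × Fin 3, h.1 ∉ S → (σ h).1 ∈ S → h = l ∨ h = m) :
    SP S σ ↔ SP (S.erase v) σ := by
  have hvnone : (closureGraph S σ).Adj none (some v) :=
    (closureGraph_adj hσ).2 ⟨by simp, l, node_of_notMem hlS, by rw [node_of_mem (hl ▸ hv), hl]⟩
  have hhom : ∀ a b, (closureGraph S σ).Adj a b →
      (if a = some v then none else a) = (if b = some v then none else b) ∨
        (closureGraph (S.erase v) σ).Adj (if a = some v then none else a)
          (if b = some v then none else b) := by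
    intro a b hab
    obtain ⟨h, rfl, rfl⟩ := exists_closureGraph_adj hσ hab
    rw [← node_erase, ← node_erase, closureGraph_adj hσ]
    by_cases hn : node (S.erase v) h = node (S.erase v) (σ h)
    · exact Or.inl hn
    · exact Or.inr ⟨hn, h, rfl, rfl⟩
  rw [SP, SP, not_iff_not]
  constructor
  · intro h
    obtain ⟨U, hU⟩ := SimpleGraph.hasMinor_iff_model.1 h
    by_cases hsep : ∃ a b, a ≠ b ∧ none ∈ U a ∧ some v ∈ U b
    -- The delicate case: contracting the edge from `none` to `v` would merge two branch sets. Apart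
    -- from `v`, the node `none` has at most the neighbour `(σ m).1`, while its branch set must
    -- touch two further ones. So that branch set contains `(σ m).1`, into which `none` can be
    -- absorbed, and `v` takes over the role of `none`.
    · obtain ⟨a, b, hab, ha, hb⟩ := hsep
      have hnbr : ∀ x, (closureGraph S σ).Adj none x →
          x = some v ∨ (x = some (σ m).1 ∧ (σ m).1 ∈ S ∧ m.1 ∉ S) := by
        intro x hx
        obtain ⟨h, h1, rfl⟩ := exists_closureGraph_adj hσ hx
        rw [node_eq_none] at h1
        have h2 : (σ h).1 ∈ S := by
          by_contra h2
          exact hx.ne (node_of_notMem h2).symm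
        rcases hlegs h h1 h2 with rfl | rfl
        · left; rw [node_of_mem h2, hl]
        · right; exact ⟨node_of_mem h2, h2, h1⟩
      have hw : some (σ m).1 ∈ U a ∧ (σ m).1 ∈ S ∧ m.1 ∉ S := by
        have hadj : ∀ c, c ≠ a → c ≠ b → (some (σ m).1 ∈ U c) ∨ ∃ x ∈ U a, x ≠ none := by
          intro c hca hcb
          obtain ⟨x, hx, y, hy, hxy⟩ := hU.adj a c hca.symm
          by_cases hx0 : x = none
          · subst hx0
            rcases hnbr y hxy with rfl | ⟨rfl, -⟩
            · exact absurd (hU.eq_of_mem hy hb) hcb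
            · exact Or.inl hy
          · exact Or.inr ⟨x, hx, hx0⟩
        obtain ⟨c, d, hca, hcb, hda, hdb, hcd⟩ : ∃ c d : Fin 4, c ≠ a ∧ c ≠ b ∧ d ≠ a ∧ d ≠ b ∧
            c ≠ d := by
          have key : ∀ a b : Fin 4, ∃ c d, c ≠ a ∧ c ≠ b ∧ d ≠ a ∧ d ≠ b ∧ c ≠ d := by decide
          exact key a b
        have hex : ∃ x ∈ U a, x ≠ none := by
          rcases hadj c hca hcb with hc | hc
          · rcases hadj d hda hdb with hd | hd
            · exact absurd (hU.eq_of_mem hc hd) hcd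
            · exact hd
          · exact hc
        obtain ⟨x, hx, hx0⟩ := hex
        obtain ⟨x', -, y, hy, hx', hy', hxy⟩ := (hU.conn a).exists_adj (X := {none}) ha rfl hx hx0
        rw [Set.mem_singleton_iff] at hx'
        subst hx'
        rcases hnbr y hxy with rfl | ⟨rfl, h3⟩
        · exact absurd (hU.eq_of_mem hy hb) hab
        · exact ⟨hy, h3⟩
      obtain ⟨hwa, hwS, hmS⟩ := hw
      have hwv : (σ m).1 ≠ v := fun h => hab (hU.eq_of_mem (h ▸ hwa) hb)
      have hadjw : (closureGraph (S.erase v) σ).Adj (some (σ m).1) none := by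
        refine (closureGraph_adj hσ).2 ⟨by simp, σ m, ?_, ?_⟩
        · exact node_of_mem (Finset.mem_erase.2 ⟨hwv, hwS⟩)
        · rw [hσ m]; exact node_of_notMem fun h => hmS (Finset.mem_of_mem_erase h)
      let f : Option V → Option V := fun x =>
        if x = none then some (σ m).1 else if x = some v then none else x
      have hf : ∀ b, (closureGraph S σ).Adj none b →
          f none = f b ∨ (closureGraph (S.erase v) σ).Adj (f none) (f b) := by
        intro b hb
        rcases hnbr b hb with rfl | ⟨rfl, -⟩
        · right; simpa [f] using hadjw
        · left; simp [f, hwv]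
      refine hU.push f (fun x y hxy => ?_) fun c d hcd x hx y hy hxy => ?_
      · by_cases hx : x = none
        · subst hx; exact hf y hxy
        by_cases hy : y = none
        · subst hy; exact (hf x hxy.symm).imp Eq.symm SimpleGraph.Adj.symm
        simpa [f, hx, hy] using hhom x y hxy
      · have hne : x ≠ y := fun h => hcd (hU.eq_of_mem hx (h ▸ hy))
        have h1 : (x = none ∧ y = some (σ m).1) ∨ (y = none ∧ x = some (σ m).1) := by
          simp only [f] at hxy
          split_ifs at hxy <;> grind
        rcases h1 with ⟨rfl, rfl⟩ | ⟨rfl, rfl⟩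
        · exact hcd ((hU.eq_of_mem hx ha).trans (hU.eq_of_mem hy hwa).symm)
        · exact hcd ((hU.eq_of_mem hx hwa).trans (hU.eq_of_mem hy ha).symm)
    -- Now contracting `none` and `v` merges no two branch sets.
    · push Not at hsep
      refine hU.push _ hhom fun c d hcd x hx y hy hxy => ?_
      have hne : x ≠ y := fun h => hcd (hU.eq_of_mem hx (h ▸ hy))
      have h1 : (x = none ∧ y = some v) ∨ (y = none ∧ x = some v) := by
        split_ifs at hxy <;> grind
      rcases h1 with ⟨rfl, rfl⟩ | ⟨rfl, rfl⟩
      · exact hsep c d hcd hx hy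
      · exact hsep d c hcd.symm hy hx
  · intro h
    obtain ⟨U, hU⟩ := SimpleGraph.hasMinor_iff_model.1 h
    -- The closure without `v` is the contraction of the edge from `none` to `v`, so the contracted
    -- node is expanded into both ends.
    refine hU.pull (fun x => if x = none then {none} ∪ {some v} else {x}) {some v}ᶜ ?_ ?_ ?_ ?_
    · intro c x hx hxv
      rw [Set.mem_singleton_iff] at hxv
      subst hxv
      exact Finset.notMem_erase v S (mem_of_model hσ hU hx)
    · intro x _
      split_ifs
      · exact (SimpleGraph.ConnOn.singleton _ _).union (SimpleGraph.ConnOn.singleton _ _)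
          ⟨none, rfl, some v, rfl, Or.inr hvnone⟩
      · exact SimpleGraph.ConnOn.singleton _ _
    · intro x hx y hy hxy
      rw [Set.disjoint_left]
      intro z hz hz'
      simp only [Set.mem_compl_iff, Set.mem_singleton_iff] at hx hy
      split_ifs at hz hz' <;>
        simp only [Set.mem_union, Set.mem_singleton_iff] at hz hz' <;> grind
    · intro x _ y _ hxy
      obtain ⟨h, h1, h2⟩ := exists_closureGraph_adj hσ hxy
      have hmem : ∀ h : V × Fin 3, node S h ∈ (if node (S.erase v) h = none then
          ({none} ∪ {some v} : Set (Option V)) else {node (S.erase v) h}) := by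
        intro h
        rw [node_erase]
        split_ifs <;> simp_all
      refine ⟨node S h, h1 ▸ hmem h, node S (σ h), h2 ▸ hmem (σ h), ?_⟩
      refine (closureGraph_adj hσ).2 ⟨fun he => hxy.ne ?_, h, rfl, rfl⟩
      rw [← h1, ← h2, node_erase, node_erase, he]

end HalfEdge

/-! ### Parts cut off by two edges, and parallel composition. -/

namespace HalfEdge

variable {V : Type*} [DecidableEq V] {S A B : Finset V} {σ : V × Fin 3 → V × Fin 3}

theorem crossing (hσ : Function.Involutive σ) (hAS : A ⊆ S) {e e' : V × Fin 3}
    (hcut : ∀ h : V × Fin 3, h.1 ∈ A → (σ h).1 ∈ A ∨ σ h = e ∨ σ h = e') {x y : Option V}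
    (hxy : (closureGraph S σ).Adj x y) (hx : ∃ v ∈ A, x = some v) (hy : ¬ ∃ v ∈ A, y = some v) :
    ((σ e).1 ∈ A ∧ x = some (σ e).1 ∧ y = node S e) ∨
      ((σ e').1 ∈ A ∧ x = some (σ e').1 ∧ y = node S e') := by
  obtain ⟨v, hv, rfl⟩ := hx
  obtain ⟨h, h1, rfl⟩ := exists_closureGraph_adj hσ hxy
  rw [node_eq_some] at h1
  obtain ⟨rfl, hS⟩ := h1
  rcases hcut h hv with h2 | rfl | rfl
  · exact absurd ⟨_, h2, node_of_mem (hAS h2)⟩ hy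
  · exact Or.inl ⟨by rwa [hσ h], by rw [hσ h], rfl⟩
  · exact Or.inr ⟨by rwa [hσ h], by rw [hσ h], rfl⟩

/-- Two branch sets leave `A`, one through each cut edge. The outside portion of `U d` is contracted
along `e'` onto the inner end of `e'`, and everything else outside goes to `none`. The cut edge `e'`
itself then provides the adjacency between these two images. -/
theorem not_SP_of_two_cut_aux (hσ : Function.Involutive σ) (hAS : A ⊆ S) {e e' : V × Fin 3}
    (hcut : ∀ h : V × Fin 3, h.1 ∈ A → (σ h).1 ∈ A ∨ σ h = e ∨ σ h = e')
    (he' : e'.1 ∉ A) {U : Fin 4 → Set (Option V)}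
    (hU : (closureGraph S σ).Model ⊤ U) {c d : Fin 4}
    (hsub : ∀ i, i ≠ c → i ≠ d → ∀ x ∈ U i, ∃ v ∈ A, x = some v)
    (h1 : node S e ∉ U d) (h2 : node S e' ∈ U d) (hA : (σ e').1 ∈ A) (h3 : some (σ e').1 ∈ U d) :
    ¬ SP A σ := by
  classical
  rw [SP, not_not]
  have hadj : (closureGraph A σ).Adj (some (σ e').1) none :=
    (closureGraph_adj hσ).2 ⟨by simp, σ e', node_of_mem hA, by rw [hσ, node_of_notMem he']⟩
  let f : Option V → Option V := fun x =>
    if ∃ v ∈ A, x = some v then x else if x ∈ U d then some (σ e').1 else none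
  have hfin : ∀ x, (∃ v ∈ A, x = some v) → f x = x := fun x hx => if_pos hx
  have hfout : ∀ x, (¬ ∃ v ∈ A, x = some v) → f x = if x ∈ U d then some (σ e').1 else none :=
    fun x hx => if_neg hx
  have hproj : ∀ x, (∃ v ∈ A, x = some v) → proj A x = x := by
    rintro x ⟨v, hv, rfl⟩; exact proj_eq_some.2 ⟨rfl, hv⟩
  have hcr : ∀ x y, (closureGraph S σ).Adj x y → (∃ v ∈ A, x = some v) →
      (¬ ∃ v ∈ A, y = some v) → f x = f y ∨ (closureGraph A σ).Adj (f x) (f y) := by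
    intro x y hxy hx hy
    rw [hfin x hx, hfout y hy]
    rcases crossing hσ hAS hcut hxy hx hy with ⟨-, h4, h5⟩ | ⟨-, h4, h5⟩
    · rw [if_neg (h5 ▸ h1)]
      have := proj_adj hσ hAS hxy
      rw [hproj x hx, proj_eq_none.2 fun v hv h => hy ⟨v, hv, h⟩] at this
      exact this
    · rw [if_pos (h5 ▸ h2)]
      exact Or.inl h4
  refine hU.push f (fun x y hxy => ?_) fun i j hij x hx y hy hxy => ?_
  · by_cases hx : ∃ v ∈ A, x = some v
    · by_cases hy : ∃ v ∈ A, y = some v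
      · rw [hfin x hx, hfin y hy]
        have := proj_adj hσ hAS hxy
        rwa [hproj x hx, hproj y hy] at this
      · exact hcr x y hxy hx hy
    · by_cases hy : ∃ v ∈ A, y = some v
      · exact (hcr y x hxy.symm hy hx).imp Eq.symm SimpleGraph.Adj.symm
      · rw [hfout x hx, hfout y hy]
        split_ifs
        · exact Or.inl rfl
        · exact Or.inr hadj
        · exact Or.inr hadj.symm
        · exact Or.inl rfl
  · have key : ∀ i j, i ≠ j → ∀ x ∈ U i, ∀ y ∈ U j, f x = f y → (∃ v ∈ A, x = some v) → False := by
      intro i j hij x hx y hy hxy hxA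
      by_cases hyA : ∃ v ∈ A, y = some v
      · rw [hfin x hxA, hfin y hyA] at hxy
        exact hij (hU.eq_of_mem hx (hxy ▸ hy))
      · rw [hfin x hxA, hfout y hyA] at hxy
        split_ifs at hxy with hyd
        · subst hxy
          exact hij ((hU.eq_of_mem hx h3).trans (hU.eq_of_mem hyd hy))
        · subst hxy
          simp at hxA
    by_cases hxA : ∃ v ∈ A, x = some v
    · exact key i j hij x hx y hy hxy hxA
    by_cases hyA : ∃ v ∈ A, y = some v
    · exact key j i hij.symm y hy x hx hxy.symm hyA
    rw [hfout x hxA, hfout y hyA] at hxy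
    have hi : i = c ∨ i = d := by
      by_contra! h; exact hxA (hsub i h.1 h.2 x hx)
    have hj : j = c ∨ j = d := by
      by_contra! h; exact hyA (hsub j h.1 h.2 y hy)
    have hd : ∀ i x, x ∈ U i → (x ∈ U d ↔ i = d) := fun i x hx =>
      ⟨fun h => hU.eq_of_mem hx h, fun h => h ▸ hx⟩
    rw [hd i x hx, hd j y hy] at hxy
    split_ifs at hxy <;> simp_all

/-- A part cut off by two edges that contains two branch sets of a model of `K₄` has a `K₄` minor
itself. -/
theorem not_SP_of_two_cut (hσ : Function.Involutive σ) (hAS : A ⊆ S) {e e' : V × Fin 3}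
    (hcut : ∀ h : V × Fin 3, h.1 ∈ A → (σ h).1 ∈ A ∨ σ h = e ∨ σ h = e')
    (he : e.1 ∉ A) (he' : e'.1 ∉ A) {U : Fin 4 → Set (Option V)}
    (hU : (closureGraph S σ).Model ⊤ U) {a b : Fin 4} (hab : a ≠ b)
    (ha : ∀ x ∈ U a, ∃ v ∈ A, x = some v) (hb : ∀ x ∈ U b, ∃ v ∈ A, x = some v) : ¬ SP A σ := by
  have hcd : ∀ a b : Fin 4, a ≠ b → ∃ c d, c ≠ a ∧ c ≠ b ∧ d ≠ a ∧ d ≠ b ∧ c ≠ d ∧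
      ∀ i, i ≠ c → i ≠ d → i = a ∨ i = b := by decide
  obtain ⟨c, d, hca, hcb, hda, hdb, hcd, hi⟩ := hcd a b hab
  have hsub : ∀ i, i ≠ c → i ≠ d → ∀ x ∈ U i, ∃ v ∈ A, x = some v := by
    intro i h1 h2
    rcases hi i h1 h2 with rfl | rfl
    · exact ha
    · exact hb
  by_cases hout : (∃ x ∈ U c, ¬ ∃ v ∈ A, x = some v) ∧ (∃ x ∈ U d, ¬ ∃ v ∈ A, x = some v)
  -- A branch set that leaves `A` either contains both ends of a cut edge, or lies entirely outside;
  -- in the latter case it meets the two branch sets inside `A` through different cut edges and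
  -- holds the outer ends of both. As `U c` and `U d` are disjoint, one of them contains both ends
  -- of one cut edge and the other one the outer end of the other cut edge.
  · have key : ∀ c, c ≠ a → c ≠ b → (∃ x ∈ U c, ¬ ∃ v ∈ A, x = some v) →
        (node S e ∈ U c ∧ (σ e).1 ∈ A ∧ some (σ e).1 ∈ U c) ∨
        (node S e' ∈ U c ∧ (σ e').1 ∈ A ∧ some (σ e').1 ∈ U c) ∨
        (node S e ∈ U c ∧ node S e' ∈ U c) := by
      rintro c hca hcb ⟨y, hy, hyA⟩
      by_cases hin : ∃ x ∈ U c, ∃ v ∈ A, x = some v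
      · obtain ⟨x, hx, hxA⟩ := hin
        obtain ⟨x', hx', y', hy', hxA', hyA', h⟩ :=
          (hU.conn c).exists_adj (X := {x | ∃ v ∈ A, x = some v}) hx hxA hy hyA
        rcases crossing hσ hAS hcut h hxA' hyA' with ⟨h1, rfl, rfl⟩ | ⟨h1, rfl, rfl⟩
        · exact Or.inl ⟨hy', h1, hx'⟩
        · exact Or.inr (Or.inl ⟨hy', h1, hx'⟩)
      · push Not at hin
        obtain ⟨x1, hx1, y1, hy1, hxy1⟩ := hU.adj a c hca.symm
        obtain ⟨x2, hx2, y2, hy2, hxy2⟩ := hU.adj b c hcb.symm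
        have g1 := crossing hσ hAS hcut hxy1 (ha x1 hx1) fun ⟨v, hv, h⟩ => hin y1 hy1 v hv h
        have g2 := crossing hσ hAS hcut hxy2 (hb x2 hx2) fun ⟨v, hv, h⟩ => hin y2 hy2 v hv h
        have hne : x1 ≠ x2 := fun h => hab (hU.eq_of_mem hx1 (h ▸ hx2))
        right; right
        rcases g1 with ⟨-, rfl, rfl⟩ | ⟨-, rfl, rfl⟩ <;> rcases g2 with ⟨-, rfl, rfl⟩ | ⟨-, rfl, rfl⟩
        · exact absurd rfl hne
        · exact ⟨hy1, hy2⟩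
        · exact ⟨hy2, hy1⟩
        · exact absurd rfl hne
    have g1 := key c hca hcb hout.1
    have g2 := key d hda hdb hout.2
    have hx : ∀ x, x ∈ U c → x ∉ U d := fun x h1 h2 => hcd (hU.eq_of_mem h1 h2)
    have hcut' : ∀ h : V × Fin 3, h.1 ∈ A → (σ h).1 ∈ A ∨ σ h = e' ∨ σ h = e :=
      fun h hh => (hcut h hh).imp_right Or.symm
    have h5 : (node S e ∈ U c ∧ node S e' ∈ U d ∧ (σ e').1 ∈ A ∧ some (σ e').1 ∈ U d) ∨
        (node S e' ∈ U c ∧ node S e ∈ U d ∧ (σ e).1 ∈ A ∧ some (σ e).1 ∈ U d) := by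
      have := hx (node S e)
      have := hx (node S e')
      tauto
    rcases h5 with ⟨h1, h2, h3, h4⟩ | ⟨h1, h2, h3, h4⟩
    · exact not_SP_of_two_cut_aux hσ hAS hcut he' hU hsub (hx _ h1) h2 h3 h4
    · exact not_SP_of_two_cut_aux hσ hAS hcut' he hU hsub (hx _ h1) h2 h3 h4
  · by_cases hc : ∃ x ∈ U c, ¬ ∃ v ∈ A, x = some v
    · refine not_SP_of_model_subset hσ hAS hU c fun j hj x hx => ?_
      by_cases hjd : j = d
      · by_contra hxA
        exact hout ⟨hc, x, hjd ▸ hx, hxA⟩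
      · exact hsub j hj hjd x hx
    · refine not_SP_of_model_subset hσ hAS hU d fun j hj x hx => ?_
      by_cases hjc : j = c
      · by_contra hxA
        exact hc ⟨x, hjc ▸ hx, hxA⟩
      · exact hsub j hjc hj x hx

/-- A parallel composition of networks between `none` and the vertex `t` is series-parallel if
and only if all its parts are. -/
theorem SP_parallel (hσ : Function.Involutive σ) {t : V} (ht : t ∈ S) {ι : Type*} [Nontrivial ι]
    {P : ι → Finset V}
    {e e' : ι → V × Fin 3} (hP : ∀ k, P k ⊆ S) (htP : ∀ k, t ∉ P k)
    (hdisj : ∀ j k, j ≠ k → Disjoint (P j) (P k))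
    (hcov : ∀ v ∈ S, v = t ∨ ∃ k, v ∈ P k)
    (hcut : ∀ k, ∀ h : V × Fin 3, h.1 ∈ P k → (σ h).1 ∈ P k ∨ σ h = e k ∨ σ h = e' k)
    (he : ∀ k, (e k).1 ∉ S) (he' : ∀ k, (e' k).1 = t)
    (heP : ∀ k, (σ (e k)).1 ∈ P k ∨ σ (e k) = e' k)
    (heP' : ∀ k, (σ (e' k)).1 ∈ P k ∨ σ (e' k) = e k)
    (hconn : ∀ k, ∀ h : V × Fin 3, h.1 ∈ P k ∨ h = e k ∨ h = e' k → Reach (P k) σ (e k) h) :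
    SP S σ ↔ ∀ k, SP (P k) σ := by
  have hePk : ∀ k, (e k).1 ∉ P k := fun k h => he k (hP k h)
  have hePk' : ∀ k, (e' k).1 ∉ P k := fun k => (he' k).symm ▸ htP k
  have hne : ∀ k, node S (e k) = none := fun k => node_of_notMem (he k)
  have hne' : ∀ k, node S (e' k) = some t := fun k => by
    rw [node_of_mem ((he' k).symm ▸ ht), he' k]
  constructor
  · intro h k h'
    refine h ?_
    obtain ⟨U, hU⟩ := SimpleGraph.hasMinor_iff_model.1 h'
    -- Another part `j` joins `none` to `t`; contracting it turns the cut edges of part `k` into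
    -- edges to a single outer node, which is the closure of `P k`.
    obtain ⟨j, hj⟩ := exists_ne k
    let D : Set (V × Fin 3) := {h | h.1 ∈ P j ∨ h = e j ∨ h = e' j}
    have hD : (closureGraph S σ).ConnOn (node S '' D) := by
      refine connOn_node_image (A := P j) hσ ?_ ?_ (h₀ := e j) (Or.inr (Or.inl rfl)) (hconn j)
      · rintro x (hx | rfl | rfl)
        · exact (hcut j x hx).imp_right id
        · exact (heP j).imp_right Or.inr
        · exact (heP' j).imp_right Or.inl
      · rintro x - hx y hy
        exact Or.inl (hy ▸ hx)
    have hDP : ∀ v ∈ P k, some v ∉ node S '' D := by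
      rintro v hv ⟨x, hx, hxv⟩
      rw [node_eq_some] at hxv
      obtain ⟨rfl, -⟩ := hxv
      rcases hx with hx | rfl | rfl
      · exact Finset.disjoint_left.1 (hdisj j k hj) hx hv
      · exact he j (hP k hv)
      · exact htP k (he' j ▸ hv)
    have hDnone : none ∈ node S '' D := ⟨e j, Or.inr (Or.inl rfl), hne j⟩
    have hDt : some t ∈ node S '' D := ⟨e' j, Or.inr (Or.inr rfl), hne' j⟩
    refine hU.pull (fun x => if x = none then node S '' D else {x})
      {x | ∀ v, x = some v → v ∈ P k} ?_ ?_ ?_ ?_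
    · rintro c x hx v rfl
      exact mem_of_model hσ hU hx
    · intro x _
      split_ifs
      · exact hD
      · exact SimpleGraph.ConnOn.singleton _ _
    · intro x hx y hy hxy
      rw [Set.disjoint_left]
      intro z hz hz'
      rw [Set.mem_ofPred_eq] at hx hy
      split_ifs at hz hz' with h1 h2 h2
      · exact hxy (h1.trans h2.symm)
      · rw [Set.mem_singleton_iff] at hz'
        subst hz'
        obtain ⟨v, rfl⟩ := Option.ne_none_iff_exists'.1 h2
        exact hDP v (hy v rfl) hz
      · rw [Set.mem_singleton_iff] at hz
        subst hz
        obtain ⟨v, rfl⟩ := Option.ne_none_iff_exists'.1 h1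
        exact hDP v (hx v rfl) hz'
      · exact hxy (hz.symm.trans hz')
    · have hmem : ∀ h : V × Fin 3, (σ h).1 ∈ P k ∨ h.1 ∈ P k → node S h ∈ (if node (P k) h = none
          then node S '' D else ({node (P k) h} : Set (Option V))) := by
        intro h hh
        by_cases h1 : h.1 ∈ P k
        · rw [node_of_mem h1, node_of_mem (hP k h1)]; simp
        · rw [node_of_notMem h1, if_pos rfl]
          have h2 := hcut k (σ h) (hh.resolve_right h1)
          rw [hσ h] at h2
          rcases h2 with h2 | rfl | rfl
          · exact absurd h2 h1
          · rw [hne]; exact hDnone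
          · rw [hne']; exact hDt
      intro x _ y _ hxy
      obtain ⟨h, rfl, rfl⟩ := exists_closureGraph_adj hσ hxy
      have hor : (σ h).1 ∈ P k ∨ h.1 ∈ P k := by
        by_contra! h1
        exact hxy.ne (by rw [node_of_notMem h1.1, node_of_notMem h1.2])
      have m1 := hmem h hor
      have m2 := hmem (σ h) (by rw [hσ h]; exact hor.symm)
      refine ⟨_, m1, _, m2, (closureGraph_adj hσ).2 ⟨fun hn => ?_, h, rfl, rfl⟩⟩
      have := congrArg (proj (P k)) hn
      rw [proj_node (hP k), proj_node (hP k)] at this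
      exact hxy.ne this
  · intro hk h
    obtain ⟨U, hU⟩ := SimpleGraph.hasMinor_iff_model.1 h
    -- At most two branch sets contain `none` or `t`. The two remaining ones are adjacent and cannot
    -- leave a part, so both lie in the same `P k`, which is cut off by two edges.
    obtain ⟨i, hi⟩ := exists_forall_notMem hU none
    obtain ⟨j, hj⟩ := exists_forall_notMem hU (some t)
    obtain ⟨a, b, hab, hai, haj, hbi, hbj⟩ : ∃ a b : Fin 4, a ≠ b ∧ a ≠ i ∧ a ≠ j ∧ b ≠ i ∧ b ≠ j := by
      have : ∀ i j : Fin 4, ∃ a b : Fin 4, a ≠ b ∧ a ≠ i ∧ a ≠ j ∧ b ≠ i ∧ b ≠ j := by decide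
      exact this i j
    have hcr : ∀ k x y, (closureGraph S σ).Adj x y → (∃ v ∈ P k, x = some v) → y ≠ none →
        y ≠ some t → ∃ v ∈ P k, y = some v := by
      intro k x y hxy hx h1 h2
      by_contra hy
      rcases crossing hσ (hP k) (hcut k) hxy hx hy with ⟨-, -, rfl⟩ | ⟨-, -, rfl⟩
      · exact h1 (hne k)
      · exact h2 (hne' k)
    have hside : ∀ k c, c ≠ i → c ≠ j → ∀ x ∈ U c, ∀ y ∈ U c, (∃ v ∈ P k, x = some v) →
        ∃ v ∈ P k, y = some v := by
      intro k c hci hcj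
      refine (hU.conn c).2 {x | ∃ v ∈ P k, x = some v} ?_
      intro x hx y hy hxy hxP
      exact hcr k x y hxy hxP (fun h => hi c hci (h ▸ hy)) fun h => hj c hcj (h ▸ hy)
    obtain ⟨x, hx, y, hy, hxy⟩ := hU.adj a b hab
    have hxP : ∃ k, ∃ v ∈ P k, x = some v := by
      cases x with
      | none => exact absurd hx (hi a hai)
      | some v =>
        rcases hcov v (mem_of_model hσ hU hx) with rfl | ⟨k, hv⟩
        · exact absurd hx (hj a haj)
        · exact ⟨k, v, hv, rfl⟩
    obtain ⟨k, hxk⟩ := hxP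
    have hyk := hcr k x y hxy hxk (fun h => hi b hbi (h ▸ hy)) fun h => hj b hbj (h ▸ hy)
    exact not_SP_of_two_cut hσ (hP k) (hcut k) (hePk k) (hePk' k) hU hab
      (fun z hz => hside k a hai haj x hx z hz hxk) (fun z hz => hside k b hbi hbj y hy z hz hyk)
      (hk k)

end HalfEdge

/-! ### The vertex that separates three legs. -/

namespace HalfEdge

variable {V : Type*} [DecidableEq V] {S A B T : Finset V} {σ : V × Fin 3 → V × Fin 3}

theorem Reach.eq_or_eq (hσ : Function.Involutive σ) {h h' : V × Fin 3} (h1 : h.1 ∉ T)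
    (h2 : (σ h).1 ∉ T) (r : Reach T σ h h') : h' = h ∨ h' = σ h := by
  refine (r.mem_iff (X := {x | x = h ∨ x = σ h}) hσ ?_ ?_).1 (Or.inl rfl)
  · rintro x (rfl | rfl)
    · exact Or.inr rfl
    · exact Or.inl (hσ h)
  · rintro x (rfl | rfl) hx
    · exact absurd hx h1
    · exact absurd hx h2

theorem connOn_some (hσ : Function.Involutive σ) {Q : Finset V} (hQS : Q ⊆ S) (hQ : Q.Nonempty)
    {h₀ : V × Fin 3} (hr : ∀ x ∈ Q, Reach Q σ h₀ (x, 0)) :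
    (closureGraph S σ).ConnOn {a | ∃ v ∈ Q, a = some v} := by
  obtain ⟨v, hv⟩ := hQ
  refine ⟨⟨some v, v, hv, rfl⟩, fun X hX => ?_⟩
  rintro _ ⟨x, hx, rfl⟩ _ ⟨y, hy, rfl⟩ hxX
  have hadj : ∀ h : V × Fin 3, h.1 ∈ Q → some h.1 ∈ X → (σ h).1 ∈ Q → some (σ h).1 ∈ X := by
    intro h h1 h2 h3
    by_cases he : h.1 = (σ h).1
    · exact he ▸ h2
    · exact hX _ ⟨_, h1, rfl⟩ _ ⟨_, h3, rfl⟩ ((closureGraph_adj hσ).2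
        ⟨by simpa using he, h, node_of_mem (hQS h1), node_of_mem (hQS h3)⟩) h2
  have := (((hr x hx).symm.trans (hr y hy)).mem_iff
    (X := {h | (h.1 ∈ Q → some h.1 ∈ X) ∧ ((σ h).1 ∈ Q → some (σ h).1 ∈ X)}) hσ ?_ ?_).1
    ⟨fun _ => hxX, hadj (x, 0) hx hxX⟩
  · exact this.1 hy
  · rintro h ⟨h1, h2⟩
    exact ⟨h2, by rwa [hσ h]⟩
  · rintro h ⟨h1, h2⟩ hQ h' he
    exact ⟨fun _ => he ▸ h1 hQ, hadj h' (he ▸ hQ) (he ▸ h1 hQ)⟩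

theorem Reach.filter (hσ : Function.Involutive σ) {r h : V × Fin 3} (hr : Reach T σ r h) [DecidablePred fun v => Reach T σ r (v, 0)] :
    Reach (T.filter fun v => Reach T σ r (v, 0)) σ r h := by
  refine (hr.transfer (X := {h | Reach T σ r h}) hσ ?_ ?_ (fun _ _ => rfl) ?_ (Reach.refl r)).2
  · exact fun x hx => hx.trans (Reach.partner _ _ _)
  · exact fun x hx hA y hy => hx.trans (Reach.sibling hA hy)
  · exact fun x hx hA => Finset.mem_filter.2 ⟨hA, hx.trans (Reach.sibling hA rfl)⟩

/-- The four branch sets of `K₄` are `none`, the set `P` grown from the leg `p`, the component `Q`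
of `q` after removal of `P` and `x`, and `x` together with the component `R` of `r`. The legs join
`none` to the other three, `x` touches `P` and `Q`, and the hypothesis that `q` reaches `P` supplies
the sixth adjacency. -/
theorem not_SP_of_reach (hσ : Function.Involutive σ) {p q r x h0 h1 hq hr : V × Fin 3}
    {P : Finset V} (hPS : P ⊆ S) (hp : p.1 ∉ S) (hqS : q.1 ∉ S) (hrS : r.1 ∉ S)
    (hP : ∀ v ∈ P, Reach P σ p (v, 0)) (hx : x.1 ∈ S) (hxP : x.1 ∉ P)
    (hσq : (σ q).1 ∈ S \ P) (hσr : (σ r).1 ∈ S \ P)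
    (hqr : ¬ Reach ((S \ P).erase x.1) σ q r)
    (r0 : Reach P σ p h0) (e0 : h0.1 = x.1)
    (r1 : Reach ((S \ P).erase x.1) σ q h1) (e1 : h1.1 ∈ P)
    (rq : Reach ((S \ P).erase x.1) σ q hq) (eq : hq.1 = x.1)
    (rr : Reach ((S \ P).erase x.1) σ r hr) (er : hr.1 = x.1) : ¬ SP S σ := by
  classical
  rw [SP, not_not]
  set T := (S \ P).erase x.1 with hT
  have hTmem : ∀ v, v ∈ T ↔ v ≠ x.1 ∧ v ∈ S ∧ v ∉ P := fun v => by
    rw [hT, Finset.mem_erase, Finset.mem_sdiff]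
  rw [Finset.mem_sdiff] at hσq hσr
  have hσp : (σ p).1 ∈ P := by
    by_contra hc
    rcases (hP _ e1).eq_or_eq hσ (fun h => hp (hPS h)) hc with h | h
    · exact hp (h ▸ hPS e1)
    · exact hc (h ▸ e1)
  have hσqT : (σ q).1 ∈ T := by
    by_contra hc
    rcases r1.eq_or_eq hσ (fun h => hqS ((hTmem _).1 h).2.1) hc with h | h
    · exact hqS (h ▸ hPS e1)
    · exact hσq.2 (h ▸ e1)
  have hσ1 : (σ h1).1 ∈ T := by
    by_contra hc
    rcases r1.symm.eq_or_eq hσ (fun h => ((hTmem _).1 h).2.2 e1) hc with h | h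
    · exact hqS (h ▸ hPS e1)
    · rw [h, hσ] at hσq
      exact hσq.2 e1
  have hσ0 : (σ h0).1 ∈ P := by
    by_contra hc
    rcases r0.symm.eq_or_eq hσ (fun h => hxP (e0 ▸ h)) hc with h | h
    · exact hp (h ▸ e0 ▸ hx)
    · rw [h, hσ, e0] at hσp
      exact hxP hσp
  have hσhq : (σ hq).1 ∈ T := by
    by_contra hc
    rcases rq.symm.eq_or_eq hσ (fun h => ((hTmem _).1 h).1 eq) hc with h | h
    · exact hqS (h ▸ eq ▸ hx)
    · rw [h, hσ, eq] at hσqT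
      exact ((hTmem _).1 hσqT).1 rfl
  set Q := T.filter fun v => Reach T σ q (v, 0) with hQ
  set R := T.filter fun v => Reach T σ r (v, 0) with hR
  have hQS : Q ⊆ S := fun v hv => ((hTmem v).1 (Finset.mem_filter.1 hv).1).2.1
  have hRS : insert x.1 R ⊆ S := by
    intro v hv
    rcases Finset.mem_insert.1 hv with rfl | hv
    · exact hx
    · exact ((hTmem v).1 (Finset.mem_filter.1 hv).1).2.1
  have hQmem : ∀ h : V × Fin 3, h.1 ∈ T → Reach T σ q h → h.1 ∈ Q := fun h h1 h2 =>
    Finset.mem_filter.2 ⟨h1, h2.trans (Reach.sibling h1 rfl)⟩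
  have hRmem : ∀ h : V × Fin 3, h.1 ∈ T → Reach T σ r h → h.1 ∈ R := fun h h1 h2 =>
    Finset.mem_filter.2 ⟨h1, h2.trans (Reach.sibling h1 rfl)⟩
  let U : Fin 4 → Set (Option V) := ![{none}, {a | ∃ v ∈ P, a = some v}, {a | ∃ v ∈ Q, a = some v},
    {a | ∃ v ∈ insert x.1 R, a = some v}]
  have hsd : ∀ v, v ∈ P → v ∉ Q := fun v h1 h2 =>
    ((hTmem v).1 (Finset.mem_filter.1 h2).1).2.2 h1
  have hsd2 : ∀ v, v ∈ P → v ∉ insert x.1 R := by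
    intro v h1 h2
    rcases Finset.mem_insert.1 h2 with rfl | h2
    · exact hxP h1
    · exact ((hTmem v).1 (Finset.mem_filter.1 h2).1).2.2 h1
  have hsd3 : ∀ v, v ∈ Q → v ∉ insert x.1 R := by
    intro v h1 h2
    rcases Finset.mem_insert.1 h2 with rfl | h2
    · exact ((hTmem _).1 (Finset.mem_filter.1 h1).1).1 rfl
    · exact hqr ((Finset.mem_filter.1 h1).2.trans (Finset.mem_filter.1 h2).2.symm)
  have hconn : ∀ i, (closureGraph S σ).ConnOn (U i) := by
    intro i
    fin_cases i
    · exact SimpleGraph.ConnOn.singleton _ _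
    · exact connOn_some hσ hPS ⟨_, e1⟩ hP
    · refine connOn_some hσ hQS ⟨_, hQmem _ hσqT (Reach.partner _ _ _)⟩ (h₀ := q) fun v hv => ?_
      exact Reach.filter hσ (Finset.mem_filter.1 hv).2
    · refine connOn_some hσ hRS ⟨x.1, Finset.mem_insert_self _ _⟩ (h₀ := r) fun v hv => ?_
      rcases Finset.mem_insert.1 hv with rfl | hv
      · exact ((Reach.filter hσ rr).mono (Finset.subset_insert _ _)).trans
          (Reach.sibling (er ▸ Finset.mem_insert_self _ _) er.symm)
      · exact (Reach.filter hσ (Finset.mem_filter.1 hv).2).mono (Finset.subset_insert _ _)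
  have hdisj : ∀ i j, i < j → Disjoint (U i) (U j) := by
    intro i j hij
    rw [Set.disjoint_left]
    fin_cases i <;> fin_cases j <;> first | (exfalso; revert hij; decide) | skip
    · rintro _ rfl ⟨v, -, h⟩; cases h
    · rintro _ rfl ⟨v, -, h⟩; cases h
    · rintro _ rfl ⟨v, -, h⟩; cases h
    · rintro _ ⟨v, hv, rfl⟩ ⟨w, hw, h⟩; cases h; exact hsd _ hv hw
    · rintro _ ⟨v, hv, rfl⟩ ⟨w, hw, h⟩; cases h; exact hsd2 _ hv hw
    · rintro _ ⟨v, hv, rfl⟩ ⟨w, hw, h⟩; cases h; exact hsd3 _ hv hw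
  have hedge : ∀ (i j : Fin 4) (h : V × Fin 3), i ≠ j → node S h ∈ U i → node S (σ h) ∈ U j →
      ∃ a ∈ U i, ∃ b ∈ U j, (closureGraph S σ).Adj a b := by
    intro i j h hij h1 h2
    refine ⟨_, h1, _, h2, (closureGraph_adj hσ).2 ⟨fun he => ?_, h, rfl, rfl⟩⟩
    rcases lt_or_gt_of_ne hij with hlt | hlt
    · exact Set.disjoint_left.1 (hdisj i j hlt) h1 (he ▸ h2)
    · exact Set.disjoint_left.1 (hdisj j i hlt) (he ▸ h2) h1
  have hadj : ∀ i j, i < j → ∃ a ∈ U i, ∃ b ∈ U j, (closureGraph S σ).Adj a b := by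
    intro i j hij
    fin_cases i <;> fin_cases j <;> first | (exfalso; revert hij; decide) | skip
    · exact hedge 0 1 p (by decide) (node_of_notMem hp) ⟨_, hσp, node_of_mem (hPS hσp)⟩
    · have := hQmem _ hσqT (Reach.partner _ _ _)
      exact hedge 0 2 q (by decide) (node_of_notMem hqS) ⟨_, this, node_of_mem (hQS this)⟩
    · have : (σ r).1 ∈ insert x.1 R := by
        by_cases he : (σ r).1 = x.1
        · exact Finset.mem_insert.2 (Or.inl he)
        · exact Finset.mem_insert_of_mem
            (hRmem _ ((hTmem _).2 ⟨he, hσr⟩) (Reach.partner _ _ _))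
      exact hedge 0 3 r (by decide) (node_of_notMem hrS) ⟨_, this, node_of_mem (hRS this)⟩
    · have := hQmem _ hσ1 (r1.trans (Reach.partner _ _ _))
      exact hedge 1 2 h1 (by decide) ⟨_, e1, node_of_mem (hPS e1)⟩ ⟨_, this, node_of_mem (hQS this)⟩
    · refine hedge 1 3 (σ h0) (by decide) ⟨_, hσ0, node_of_mem (hPS hσ0)⟩ ?_
      rw [hσ h0]
      exact ⟨_, e0 ▸ Finset.mem_insert_self _ _, node_of_mem (e0 ▸ hx)⟩
    · have := hQmem _ hσhq (rq.trans (Reach.partner _ _ _))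
      refine hedge 2 3 (σ hq) (by decide) ⟨_, this, node_of_mem (hQS this)⟩ ?_
      rw [hσ hq]
      exact ⟨_, eq ▸ Finset.mem_insert_self _ _, node_of_mem (eq ▸ hx)⟩
  refine SimpleGraph.hasMinor_iff_model.2 ⟨U, hconn, fun i j hij => ?_, fun i j hij => ?_⟩
  · rcases lt_or_gt_of_ne hij with h | h
    · exact hdisj i j h
    · exact (hdisj j i h).symm
  · rcases lt_or_gt_of_ne hij.ne with h | h
    · exact hadj i j h
    · obtain ⟨a, ha, b, hb, hab⟩ := hadj j i h
      exact ⟨b, hb, a, ha, hab.symm⟩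

/-- A connected series-parallel network with three legs has a vertex that separates the legs. -/
theorem exists_separating (hσ : Function.Involutive σ) {p q r : V × Fin 3} (hp : p.1 ∉ S)
    (hq : q.1 ∉ S) (hr : r.1 ∉ S) (hpq : p ≠ q) (hpr : p ≠ r) (hqr : q ≠ r)
    (rq : Reach S σ p q) (rr : Reach S σ p r) (hSP : SP S σ) :
    ∃ t ∈ S, ¬ Reach (S.erase t) σ p q ∧ ¬ Reach (S.erase t) σ p r ∧ ¬ Reach (S.erase t) σ q r := by
  classical
  -- the other ends of the legs are in `S`
  have hleg : (σ p).1 ∈ S ∧ (σ q).1 ∈ S ∧ (σ r).1 ∈ S := by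
    have key : ∀ a b c : V × Fin 3, a.1 ∉ S → a ≠ b → a ≠ c → b ≠ c → Reach S σ a b →
        Reach S σ a c → (σ a).1 ∈ S := by
      intro a b c ha hab hac hbc h1 h2
      by_contra hc
      rcases h1.eq_or_eq hσ ha hc with h | h
      · exact hab h.symm
      · rcases h2.eq_or_eq hσ ha hc with h' | h'
        · exact hac h'.symm
        · exact hbc (h.trans h'.symm)
    exact ⟨key p q r hp hpq hpr hqr rq rr,
      key q p r hq hpq.symm hqr hpr rq.symm (rq.symm.trans rr),
      key r p q hr hpr.symm hqr.symm hpq rr.symm (rr.symm.trans rq)⟩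
  -- Grow a connected set from `p` as far as possible without disconnecting `q` from `r`. The next
  -- vertex `x` that it would absorb is the separating one.
  let good : Finset V → Prop := fun P => (∀ v ∈ P, Reach P σ p (v, 0)) ∧ Reach (S \ P) σ q r
  obtain ⟨P, hP, hmax⟩ := Finset.exists_max_image (S.powerset.filter good) Finset.card
    ⟨∅, by simp [good, rq.symm.trans rr]⟩
  rw [Finset.mem_filter, Finset.mem_powerset] at hP
  obtain ⟨hPS, hP, hPqr⟩ := hP
  have hleaf : ∀ a b : V × Fin 3, a.1 ∉ S → b.1 ∉ S → (σ a).1 ∈ S → a ≠ b → Reach (S \ P) σ a b →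
      (σ a).1 ∈ S \ P := by
    intro a b ha hb hσa hab h
    by_contra hc
    rcases h.eq_or_eq hσ (fun h => ha (Finset.mem_sdiff.1 h).1) hc with h | h
    · exact hab h.symm
    · exact hb (h ▸ hσa)
  have hσq := hleaf q r hq hr hleg.2.1 hqr hPqr
  have hσr := hleaf r q hr hq hleg.2.2 hqr.symm hPqr.symm
  obtain ⟨x, r0, hxS, hxP⟩ : ∃ x, Reach P σ p x ∧ x.1 ∈ S ∧ x.1 ∉ P := by
    by_contra! hc
    have h1 : Reach P σ p q := by
      refine (rq.mem_iff (X := {h | Reach P σ p h}) hσ ?_ ?_).1 (Reach.refl p)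
      · exact fun h hh => hh.trans (Reach.partner _ _ _)
      · exact fun h hh hS h' he => hh.trans (Reach.sibling (hc h hh hS) he)
    rcases h1.symm.eq_or_eq hσ (fun h => hq (hPS h)) (Finset.mem_sdiff.1 hσq).2 with h | h
    · exact hpq h
    · exact hp (h ▸ hleg.2.1)
  -- Otherwise `P` could be enlarged by `x`, against maximality.
  have hqr' : ¬ Reach ((S \ P).erase x.1) σ q r := by
    intro h
    have h1 := hmax (insert x.1 P) (by
      rw [Finset.mem_filter, Finset.mem_powerset]
      refine ⟨Finset.insert_subset hxS hPS, ?_, ?_⟩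
      · intro v hv
        rcases Finset.mem_insert.1 hv with rfl | hv
        · exact (r0.mono (Finset.subset_insert _ _)).trans
            (Reach.sibling (Finset.mem_insert_self _ _) rfl)
        · exact (hP v hv).mono (Finset.subset_insert _ _)
      · rwa [show S \ insert x.1 P = (S \ P).erase x.1 by ext; simp; tauto])
    rw [Finset.card_insert_of_notMem hxP] at h1
    omega
  have hto : ∀ a b, Reach (S \ P) σ a b → ¬ Reach ((S \ P).erase x.1) σ a b →
      ∃ h, Reach ((S \ P).erase x.1) σ a h ∧ h.1 = x.1 := by
    intro a b hab hn
    by_contra! hc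
    refine hn ((hab.mem_iff (X := {h | Reach ((S \ P).erase x.1) σ a h}) hσ ?_ ?_).1 (Reach.refl a))
    · exact fun h hh => hh.trans (Reach.partner _ _ _)
    · exact fun h hh hS h' he =>
        hh.trans (Reach.sibling (Finset.mem_erase.2 ⟨hc h hh, hS⟩) he)
  obtain ⟨xq, rxq, exq⟩ := hto q r hPqr hqr'
  obtain ⟨xr, rxr, exr⟩ := hto r q hPqr.symm fun h => hqr' h.symm
  -- Without `x`, neither `q` nor `r` reaches `P`, by the absence of `K₄`; so restoring `P` does not
  -- enlarge their components.
  have noq : ∀ h, Reach ((S \ P).erase x.1) σ q h → h.1 ∉ P := fun h h1 h2 =>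
    not_SP_of_reach hσ hPS hp hq hr hP hxS hxP hσq hσr hqr' r0 rfl h1 h2 rxq exq rxr exr hSP
  have nor : ∀ h, Reach ((S \ P).erase x.1) σ r h → h.1 ∉ P := fun h h1 h2 =>
    not_SP_of_reach hσ hPS hp hr hq hP hxS hxP hσr hσq (fun h => hqr' h.symm) r0 rfl h1 h2 rxr exr
      rxq exq hSP
  have hmono : ∀ a, (∀ h, Reach ((S \ P).erase x.1) σ a h → h.1 ∉ P) → ∀ b,
      Reach (S.erase x.1) σ a b → Reach ((S \ P).erase x.1) σ a b := by
    intro a ha b hab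
    refine (hab.mem_iff (X := {h | Reach ((S \ P).erase x.1) σ a h}) hσ ?_ ?_).1 (Reach.refl a)
    · exact fun h hh => hh.trans (Reach.partner _ _ _)
    · intro h hh hS h' he
      rw [Finset.mem_erase] at hS
      exact hh.trans (Reach.sibling
        (Finset.mem_erase.2 ⟨hS.1, Finset.mem_sdiff.2 ⟨hS.2, ha h hh⟩⟩) he)
  have hnop : ∀ a, a.1 ∉ S → a ≠ p → ¬ Reach ((S \ P).erase x.1) σ p a := by
    intro a ha hap h
    have h1 : (σ p).1 ∈ (S \ P).erase x.1 := by
      by_contra hc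
      rcases h.eq_or_eq hσ (fun h => hp (Finset.mem_sdiff.1 (Finset.mem_of_mem_erase h)).1) hc
        with h | h
      · exact hap h
      · exact ha (h ▸ hleg.1)
    rw [Finset.mem_erase, Finset.mem_sdiff] at h1
    rcases r0.eq_or_eq hσ (fun h => hp (hPS h)) h1.2.2 with h | h
    · exact hp (h ▸ hxS)
    · exact h1.1 (by rw [h])
  exact ⟨x.1, hxS, fun h => hnop q hq hpq.symm (hmono q noq p h.symm).symm,
    fun h => hnop r hr hpr.symm (hmono r nor p h.symm).symm, fun h => hqr' (hmono q noq r h)⟩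

/-- The vertex `t` separates the legs `P`. -/
def Separates (S : Finset V) (σ : V × Fin 3 → V × Fin 3) (P : Fin 3 → V × Fin 3) (t : V) : Prop :=
  ∀ j k, j ≠ k → ¬ Reach (S.erase t) σ (P j) (P k)

/-- Each leg must arrive at `t`, and two legs cannot arrive at the same half-edge of `t`. Since
there are three legs and three half-edges at `t`, the assignment is a permutation. -/
theorem Separates.exists_equiv (hσ : Function.Involutive σ) {P : Fin 3 → V × Fin 3} {t : V}
    (hsep : Separates S σ P t) (hr : ∀ k, Reach S σ (P 0) (P k)) :
    ∃ π : Equiv.Perm (Fin 3), (∀ k, Reach (S.erase t) σ (P k) (t, π k)) ∧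
      ∀ h, Reach S σ (P 0) h → ∃ k, Reach (S.erase t) σ (P k) h := by
  have h1 : ∀ k, ∃ i, Reach (S.erase t) σ (P k) (t, i) := by
    intro k
    by_contra! hc
    obtain ⟨j, hj⟩ := exists_ne k
    refine hsep k j hj.symm ?_
    refine (((hr k).symm.trans (hr j)).mem_iff (X := {h | Reach (S.erase t) σ (P k) h})
      hσ ?_ ?_).1 (Reach.refl _)
    · exact fun h hh => hh.trans (Reach.partner _ _ _)
    · intro h hh hS h' he
      refine hh.trans (Reach.sibling (Finset.mem_erase.2 ⟨fun ht => hc h.2 ?_, hS⟩) he)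
      have he : h = (t, h.2) := Prod.ext ht rfl
      exact he ▸ hh
  choose π hπ using h1
  have hinj : Function.Injective π := by
    intro j k hjk
    by_contra hne
    exact hsep j k hne ((hπ j).trans (hjk ▸ (hπ k).symm))
  refine ⟨Equiv.ofBijective π (Finite.injective_iff_bijective.1 hinj), hπ, fun h hh => ?_⟩
  refine (hh.mem_iff (X := {h | ∃ k, Reach (S.erase t) σ (P k) h}) hσ ?_ ?_).1 ⟨0, Reach.refl _⟩
  · rintro x ⟨k, hk⟩
    exact ⟨k, hk.trans (Reach.partner _ _ _)⟩
  · rintro x ⟨k, hk⟩ hS y hy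
    by_cases hx : x.1 = t
    · obtain ⟨j, hj⟩ := (Finite.injective_iff_bijective.1 hinj).2 y.2
      refine ⟨j, ?_⟩
      have : y = (t, π j) := Prod.ext (hy.trans hx) hj.symm
      rw [this]; exact hπ j
    · exact ⟨k, hk.trans (Reach.sibling (Finset.mem_erase.2 ⟨hx, hS⟩) hy)⟩

/-- A second candidate `t'` lies in the component of a single leg `k₀` after removal of `t`. The
other two legs still meet at `t` when `t'` is removed, so `t'` does not separate them. -/
theorem Separates.unique (hσ : Function.Involutive σ) {P : Fin 3 → V × Fin 3} {t t' : V}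
    (ht : t ∈ S)
    (hsep : Separates S σ P t) (hsep' : Separates S σ P t') (hr : ∀ k, Reach S σ (P 0) (P k))
    (hr' : Reach S σ (P 0) (t', 0)) : t = t' := by
  by_contra hne
  obtain ⟨π, hπ, hall⟩ := hsep.exists_equiv hσ hr
  obtain ⟨k₀, hk₀⟩ := hall _ hr'
  have key : ∀ k, k ≠ k₀ → Reach (S.erase t') σ (P k) (t, π k) := by
    intro k hk
    refine ((hπ k).transfer (X := {h | Reach (S.erase t) σ (P k) h}) hσ ?_ ?_ (fun _ _ => rfl) ?_
      (Reach.refl _)).2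
    · exact fun h hh => hh.trans (Reach.partner _ _ _)
    · exact fun h hh hS h' he => hh.trans (Reach.sibling hS he)
    · intro h hh hS
      refine Finset.mem_erase.2 ⟨fun he => hsep k k₀ hk ?_, (Finset.mem_erase.1 hS).2⟩
      exact (hh.trans (Reach.sibling hS (by simp [he]))).trans hk₀.symm
  obtain ⟨j, k, hj, hk, hjk⟩ : ∃ j k : Fin 3, j ≠ k₀ ∧ k ≠ k₀ ∧ j ≠ k := by
    have : ∀ i : Fin 3, ∃ j k : Fin 3, j ≠ i ∧ k ≠ i ∧ j ≠ k := by decide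
    exact this k₀
  have hs : Reach (S.erase t') σ (t, π j) (t, π k) :=
    Reach.sibling (Finset.mem_erase.2 ⟨hne, ht⟩) rfl
  exact hsep' j k hjk ((key j hj).trans (hs.trans (key k hk).symm))

end HalfEdge

/-! ### Counting networks by splitting off the component of a leg. -/

namespace HalfEdge

open scoped Classical in
theorem card_eq_sum_of_existsUnique {α ι : Type*} (X : Finset α) (I : Finset ι) (p : ι → α → Prop)
    (h : ∀ x ∈ X, ∃! i, i ∈ I ∧ p i x) : X.card = ∑ i ∈ I, (X.filter (p i)).card := by
  have : X = I.biUnion fun i => X.filter (p i) := by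
    ext x
    simp only [Finset.mem_biUnion, Finset.mem_filter]
    exact ⟨fun hx => by obtain ⟨i, hi, -⟩ := h x hx; exact ⟨i, hi.1, hx, hi.2⟩,
      fun ⟨_, _, hx, _⟩ => hx⟩
  conv_lhs => rw [this]
  refine Finset.card_biUnion fun i hi j hj hij => Finset.disjoint_left.2 fun x hx hx' => hij ?_
  rw [Finset.mem_filter] at hx hx'
  exact (h x hx.1).unique ⟨hi, hx.2⟩ ⟨hj, hx'.2⟩

variable {V : Type*} [DecidableEq V]

/-- The half-edges of a network with vertex set `S` and legs `L`. -/
def dom (S : Finset V) (L : Finset (V × Fin 3)) : Finset (V × Fin 3) := S ×ˢ Finset.univ ∪ L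

variable {S A B : Finset V} {L L₁ R D D₁ D₂ : Finset (V × Fin 3)}
  {σ σ₁ σ₂ : V × Fin 3 → V × Fin 3} {h : V × Fin 3}

theorem mem_dom : h ∈ dom S L ↔ h.1 ∈ S ∨ h ∈ L := by
  simp [dom]

def join (D : Finset (V × Fin 3)) (σ₁ σ₂ : V × Fin 3 → V × Fin 3) : V × Fin 3 → V × Fin 3 :=
  fun h => if h ∈ D then σ₁ h else σ₂ h

theorem join_of_mem (hh : h ∈ D) : join D σ₁ σ₂ h = σ₁ h := if_pos hh

theorem join_of_notMem (hh : h ∉ D) : join D σ₁ σ₂ h = σ₂ h := if_neg hh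

theorem isMatching_join (hD : Disjoint D₁ D₂) (h1 : IsMatching D₁ σ₁) (h2 : IsMatching D₂ σ₂) :
    IsMatching (D₁ ∪ D₂) (join D₁ σ₁ σ₂) := by
  have hD' : ∀ {x}, x ∈ D₂ → x ∉ D₁ := fun hx hx' => Finset.disjoint_left.1 hD hx' hx
  refine ⟨fun x hx => ?_, fun x hx => ?_⟩
  · by_cases hx1 : x ∈ D₁
    · have := h1.1 x hx1
      rw [join_of_mem hx1, join_of_mem this.1]
      exact ⟨Finset.mem_union_left _ this.1, this.2⟩
    · have hx2 := (Finset.mem_union.1 hx).resolve_left hx1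
      have := h2.1 x hx2
      rw [join_of_notMem hx1, join_of_notMem (hD' this.1)]
      exact ⟨Finset.mem_union_right _ this.1, this.2⟩
  · rw [Finset.mem_union, not_or] at hx
    rw [join_of_notMem hx.1, h2.2 x hx.2]

theorem IsMatching.restrict (h1 : IsMatching D σ) (hD : D₁ ⊆ D) (hinv : ∀ x ∈ D₁, σ x ∈ D₁) :
    IsMatching D₁ (join D₁ σ id) := by
  refine ⟨fun x hx => ?_, fun x hx => by rw [join_of_notMem hx]; rfl⟩
  rw [join_of_mem hx, join_of_mem (hinv x hx)]
  exact ⟨hinv x hx, (h1.1 x (hD hx)).2⟩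

-- A matching of a disjoint union that preserves one piece is a pair of matchings of the pieces;
-- this turns decompositions into products.
open scoped Classical in
theorem card_split [Fintype V] (hD : Disjoint D₁ D₂)
    {P P₁ P₂ : (V × Fin 3 → V × Fin 3) → Prop}
    (hP : ∀ σ₁ σ₂, IsMatching D₁ σ₁ → IsMatching D₂ σ₂ → (P (join D₁ σ₁ σ₂) ↔ P₁ σ₁ ∧ P₂ σ₂)) :
    (Finset.univ.filter fun σ => IsMatching (D₁ ∪ D₂) σ ∧ (∀ x ∈ D₁, σ x ∈ D₁) ∧ P σ).card =
      (Finset.univ.filter fun σ => IsMatching D₁ σ ∧ P₁ σ).card *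
        (Finset.univ.filter fun σ => IsMatching D₂ σ ∧ P₂ σ).card := by
  have hD' : ∀ {x}, x ∈ D₂ → x ∉ D₁ := fun hx hx' => Finset.disjoint_left.1 hD hx' hx
  rw [← Finset.card_product]
  symm
  refine Finset.card_nbij' (fun p => join D₁ p.1 p.2) (fun σ => (join D₁ σ id, join D₂ σ id))
    ?_ ?_ ?_ ?_
  · rintro ⟨σ₁, σ₂⟩ hp
    simp only [Finset.coe_product, Finset.coe_filter, Finset.mem_univ, true_and, Set.mem_prod,
      Set.mem_ofPred_eq] at hp ⊢
    refine ⟨isMatching_join hD hp.1.1 hp.2.1, fun x hx => ?_, (hP _ _ hp.1.1 hp.2.1).2 ⟨hp.1.2, hp.2.2⟩⟩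
    rw [join_of_mem hx]
    exact (hp.1.1.1 x hx).1
  · intro σ hσ
    simp only [Finset.coe_product, Finset.coe_filter, Finset.mem_univ, true_and, Set.mem_prod,
      Set.mem_ofPred_eq] at hσ ⊢
    obtain ⟨hm, hinv, hPσ⟩ := hσ
    have hinv2 : ∀ x ∈ D₂, σ x ∈ D₂ := by
      intro x hx
      have h1 := hm.1 x (Finset.mem_union_right _ hx)
      refine (Finset.mem_union.1 h1.1).resolve_left fun h2 => hD' hx ?_
      have := hinv _ h2
      rwa [h1.2.1] at this
    have h1 := hm.restrict Finset.subset_union_left hinv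
    have h2 := hm.restrict Finset.subset_union_right hinv2
    have he : join D₁ (join D₁ σ id) (join D₂ σ id) = σ := by
      funext x
      by_cases hx : x ∈ D₁
      · rw [join_of_mem hx, join_of_mem hx]
      · rw [join_of_notMem hx]
        by_cases hx2 : x ∈ D₂
        · rw [join_of_mem hx2]
        · rw [join_of_notMem hx2, hm.2 x (by simp [hx, hx2])]; rfl
    have := (hP _ _ h1 h2).1 (by rwa [he])
    exact ⟨⟨h1, this.1⟩, ⟨h2, this.2⟩⟩
  · rintro ⟨σ₁, σ₂⟩ hp
    simp only [Finset.coe_product, Finset.coe_filter, Finset.mem_univ, true_and, Set.mem_prod,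
      Set.mem_ofPred_eq] at hp
    refine Prod.ext (funext fun x => ?_) (funext fun x => ?_)
    · by_cases hx : x ∈ D₁
      · simp [join_of_mem hx]
      · simp [join_of_notMem hx, hp.1.1.2 x hx]
    · by_cases hx : x ∈ D₂
      · simp [join_of_mem hx, join_of_notMem (hD' hx)]
      · simp [join_of_notMem hx, hp.2.1.2 x hx]
  · intro σ hσ
    simp only [Finset.coe_filter, Finset.mem_univ, true_and, Set.mem_ofPred_eq] at hσ
    funext x
    by_cases hx : x ∈ D₁
    · simp [join_of_mem hx]
    · by_cases hx2 : x ∈ D₂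
      · simp [join_of_notMem hx, join_of_mem hx2]
      · simp [join_of_notMem hx, join_of_notMem hx2, hσ.1.2 x (by simp [hx, hx2])]

/-- Every half-edge of the network is reachable from a root in `R`. -/
def Rooted (S : Finset V) (L R : Finset (V × Fin 3)) (σ : V × Fin 3 → V × Fin 3) : Prop :=
  ∀ h ∈ dom S L, ∃ r ∈ R, Reach S σ r h

open scoped Classical in
/-- The series-parallel networks with vertex set `S` and legs `L` that are rooted in `R`. -/
noncomputable def networks [Fintype V] (S : Finset V) (L R : Finset (V × Fin 3)) :
    Finset (V × Fin 3 → V × Fin 3) :=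
  Finset.univ.filter fun σ => IsMatching (dom S L) σ ∧ Rooted S L R σ ∧ SP S σ

noncomputable def numNetworks [Fintype V] (S : Finset V) (L R : Finset (V × Fin 3)) : ℕ :=
  (networks S L R).card

theorem mem_networks [Fintype V] :
    σ ∈ networks S L R ↔ IsMatching (dom S L) σ ∧ Rooted S L R σ ∧ SP S σ := by
  simp [networks]

theorem Reach.mem_dom (hm : IsMatching (dom S L) σ) {x y : V × Fin 3} (hx : x ∈ dom S L)
    (r : Reach S σ x y) : y ∈ dom S L := by
  refine (r.mem_iff (X := {x | x ∈ dom S L}) hm.involutive ?_ ?_).1 hx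
  · exact fun h hh => (hm.1 h hh).1
  · exact fun h _ hS h' he => HalfEdge.mem_dom.2 (Or.inl (he ▸ hS))

/-- Transfer of reachability between a network and a part of it. -/
theorem reach_part_iff (hAS : A ⊆ S) (hL : ∀ x ∈ L₁, x.1 ∉ S) (hσ : Function.Involutive σ)
    (hm : IsMatching (dom A L₁) σ₁) (he : ∀ x ∈ dom A L₁, σ x = σ₁ x) {x y : V × Fin 3}
    (hx : x ∈ dom A L₁) : Reach S σ x y ↔ Reach A σ₁ x y := by
  constructor
  · intro r
    refine (r.transfer (X := {x | x ∈ dom A L₁}) hσ ?_ ?_ ?_ ?_ hx).2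
    · intro h hh
      rw [Set.mem_ofPred_eq] at hh ⊢
      rw [he h hh]
      exact (hm.1 h hh).1
    · intro h hh hS h' e
      rcases mem_dom.1 hh with h1 | h1
      · exact mem_dom.2 (Or.inl (e ▸ h1))
      · exact absurd hS (hL h h1)
    · exact he
    · intro h hh hS
      rcases mem_dom.1 hh with h1 | h1
      · exact h1
      · exact absurd hS (hL h h1)
  · intro r
    refine (r.transfer (X := {x | x ∈ dom A L₁}) hm.involutive ?_ ?_ ?_ ?_ hx).2
    · exact fun h hh => (hm.1 h hh).1
    · exact fun h _ hA h' e => mem_dom.2 (Or.inl (e ▸ hA))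
    · exact fun h hh => (he h hh).symm
    · exact fun h _ hA => hAS hA

/-- Decomposition of a network along the component of the leg `l`. -/
theorem numNetworks_split [Fintype V] (hL : ∀ x ∈ L, x.1 ∉ S) {l : V × Fin 3} (hl : l ∈ L)
    (hR : R ⊆ L) :
    numNetworks S L R = ∑ A ∈ S.powerset, ∑ L₁ ∈ L.powerset.filter
      (fun L₁ => l ∈ L₁ ∧ (L₁ ∩ R).Nonempty),
        numNetworks A L₁ {l} * numNetworks (S \ A) (L \ L₁) (R \ L₁) := by
  classical
  -- The index is the component of `l`: its vertices `A` and its legs `L₁`. It meets `R` because `l`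
  -- is reachable from some root.
  rw [numNetworks, card_eq_sum_of_existsUnique (networks S L R)
    (S.powerset ×ˢ L.powerset.filter fun L₁ => l ∈ L₁ ∧ (L₁ ∩ R).Nonempty)
    (fun i σ => ∀ h ∈ dom S L, Reach S σ l h ↔ h ∈ dom i.1 i.2) ?_, Finset.sum_product]
  · refine Finset.sum_congr rfl fun A hA => Finset.sum_congr rfl fun L₁ hL₁ => ?_
    rw [Finset.mem_powerset] at hA
    simp only [Finset.mem_filter, Finset.mem_powerset] at hL₁
    obtain ⟨hL₁, hl₁, r₀, hr₀⟩ := hL₁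
    rw [Finset.mem_inter] at hr₀
    have hL1S : ∀ x ∈ L₁, x.1 ∉ S := fun x hx => hL x (hL₁ hx)
    have hL2S : ∀ x ∈ L \ L₁, x.1 ∉ S := fun x hx => hL x (Finset.mem_sdiff.1 hx).1
    have hD : Disjoint (dom A L₁) (dom (S \ A) (L \ L₁)) := by
      rw [Finset.disjoint_left]
      intro x hx hx'
      rw [mem_dom, Finset.mem_sdiff, Finset.mem_sdiff] at hx'
      rw [mem_dom] at hx
      rcases hx with hx | hx
      · rcases hx' with hx' | hx'
        · exact hx'.2 hx
        · exact hL x hx'.1 (hA hx)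
      · rcases hx' with hx' | hx'
        · exact hL1S x hx hx'.1
        · exact hx'.2 hx
    have hU : dom A L₁ ∪ dom (S \ A) (L \ L₁) = dom S L := by
      ext x
      simp only [Finset.mem_union, mem_dom, Finset.mem_sdiff]
      have h1 : x.1 ∈ A → x.1 ∈ S := fun h => hA h
      have h2 : x ∈ L₁ → x ∈ L := fun h => hL₁ h
      tauto
    have hldom : l ∈ dom A L₁ := mem_dom.2 (Or.inr hl₁)
    have key := card_split (P := fun σ => (∀ h ∈ dom S L, Reach S σ l h ↔ h ∈ dom A L₁) ∧
        Rooted S L R σ ∧ SP S σ)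
      (P₁ := fun σ => Rooted A L₁ {l} σ ∧ SP A σ)
      (P₂ := fun σ => Rooted (S \ A) (L \ L₁) (R \ L₁) σ ∧ SP (S \ A) σ) hD ?_
    · refine Eq.trans (congrArg Finset.card ?_) (key.trans (congrArg₂ (· * ·)
        (congrArg Finset.card ?_) (congrArg Finset.card ?_)))
      rotate_left
      · ext σ; simp [mem_networks]
      · ext σ; simp [mem_networks]
      ext σ
      simp only [Finset.mem_filter, mem_networks, Finset.mem_univ, true_and, hU]
      constructor
      · rintro ⟨⟨hm, hr, hsp⟩, hc⟩
        refine ⟨hm, fun x hx => ?_, hc, hr, hsp⟩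
        have hxS : x ∈ dom S L := hU ▸ Finset.mem_union_left _ hx
        exact (hc _ (hm.1 x hxS).1).1 (((hc x hxS).2 hx).trans (Reach.partner _ _ _))
      · rintro ⟨hm, -, hc, hr, hsp⟩
        exact ⟨⟨hm, hr, hsp⟩, hc⟩
    · intro σ₁ σ₂ h1 h2
      set σ := join (dom A L₁) σ₁ σ₂ with hσdef
      have hm : IsMatching (dom S L) σ := hU ▸ isMatching_join hD h1 h2
      have hσ := hm.involutive
      have he1 : ∀ x ∈ dom A L₁, σ x = σ₁ x := fun x hx => join_of_mem hx
      have he2 : ∀ x ∈ dom (S \ A) (L \ L₁), σ x = σ₂ x := fun x hx =>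
        join_of_notMem fun hx' => Finset.disjoint_left.1 hD hx' hx
      have r1 := fun {x y} (hx : x ∈ dom A L₁) => reach_part_iff (y := y) hA hL1S hσ h1 he1 hx
      have r2 := fun {x y} (hx : x ∈ dom (S \ A) (L \ L₁)) =>
        reach_part_iff (y := y) Finset.sdiff_subset hL2S hσ h2 he2 hx
      have hsp : SP S σ ↔ SP A σ₁ ∧ SP (S \ A) σ₂ := by
        rw [← SP_congr (S := A) hσ h1.involutive fun x hx => he1 x (mem_dom.2 (Or.inl hx)),
          ← SP_congr (S := S \ A) hσ h2.involutive fun x hx => he2 x (mem_dom.2 (Or.inl hx)),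
          ← SP_union hσ, Finset.union_sdiff_of_subset hA]
        intro x hx hx'
        have h3 : x ∈ dom A L₁ := mem_dom.2 (Or.inl hx)
        have h4 := (h1.1 x h3).1
        rw [← he1 x h3] at h4
        exact Finset.disjoint_left.1 hD h4 (mem_dom.2 (Or.inl hx'))
      rw [hsp]
      have hlR : ∀ x ∈ R, x ∈ L₁ ∨ x ∈ R \ L₁ := fun x hx => by
        rw [Finset.mem_sdiff]; tauto
      constructor
      · rintro ⟨hc, hr, hs1, hs2⟩
        refine ⟨⟨fun x hx => ⟨l, by simp, ?_⟩, hs1⟩, fun x hx => ?_, hs2⟩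
        · exact (r1 hldom).1 ((hc x (hU ▸ Finset.mem_union_left _ hx)).2 hx)
        · obtain ⟨r, hrR, hrx⟩ := hr x (hU ▸ Finset.mem_union_right _ hx)
          have hrx' := (r2 hx).1 hrx.symm
          have hrd := hrx'.mem_dom h2 hx
          refine ⟨r, (hlR r hrR).resolve_left fun h => ?_, hrx'.symm⟩
          exact Finset.disjoint_left.1 hD (mem_dom.2 (Or.inr h)) hrd
      · rintro ⟨⟨hr1, hs1⟩, hr2, hs2⟩
        have hr1' : ∀ x ∈ dom A L₁, Reach S σ l x := by
          intro x hx
          obtain ⟨r, hr, hrx⟩ := hr1 x hx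
          rw [Finset.mem_singleton] at hr
          subst hr
          exact (r1 hldom).2 hrx
        refine ⟨fun x hx => ⟨fun h => ((r1 hldom).1 h).mem_dom h1 hldom, hr1' x⟩, ?_, hs1, hs2⟩
        intro x hx
        rw [← hU, Finset.mem_union] at hx
        rcases hx with hx | hx
        · exact ⟨r₀, hr₀.2, (hr1' r₀ (mem_dom.2 (Or.inr hr₀.1))).symm.trans (hr1' x hx)⟩
        · obtain ⟨r, hr, hrx⟩ := hr2 x hx
          rw [Finset.mem_sdiff] at hr
          exact ⟨r, hr.1, (r2 (mem_dom.2 (Or.inr (Finset.mem_sdiff.2 ⟨hR hr.1, hr.2⟩)))).2 hrx⟩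
  · intro σ hσ
    obtain ⟨hm, hr, hsp⟩ := mem_networks.1 hσ
    refine ⟨(S.filter fun v => Reach S σ l (v, 0), L.filter fun m => Reach S σ l m), ⟨?_, ?_⟩, ?_⟩
    · simp only [Finset.mem_product, Finset.mem_powerset, Finset.mem_filter]
      obtain ⟨r, hrR, hrl⟩ := hr l (mem_dom.2 (Or.inr hl))
      exact ⟨Finset.filter_subset _ _, Finset.filter_subset _ _, ⟨hl, Reach.refl l⟩, r,
        Finset.mem_inter.2 ⟨Finset.mem_filter.2 ⟨hR hrR, hrl.symm⟩, hrR⟩⟩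
    · intro x hx
      simp only [mem_dom, Finset.mem_filter] at hx ⊢
      have h1 : x.1 ∈ S → (Reach S σ l x ↔ Reach S σ l (x.1, 0)) := fun hS =>
        ⟨fun h => h.trans (Reach.sibling hS rfl),
          fun h => h.trans (Reach.sibling (h := (x.1, 0)) hS rfl)⟩
      by_cases hS : x.1 ∈ S
      · rw [h1 hS]; have := hL x; tauto
      · tauto
    · rintro ⟨A, L₁⟩ ⟨hi, hc⟩
      simp only [Finset.mem_product, Finset.mem_powerset, Finset.mem_filter] at hi
      refine Prod.ext ?_ ?_
      · ext v
        simp only [Finset.mem_filter]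
        have h1 : ∀ hv : v ∈ S, _ := fun hv => hc (v, 0) (mem_dom.2 (Or.inl hv))
        rw [mem_dom] at h1
        have h2 : v ∈ A → v ∈ S := fun h => hi.1 h
        have h3 : v ∈ S → (v, 0) ∉ L₁ := fun h h' => hL _ (hi.2.1 h') h
        constructor
        · intro hv
          exact ⟨h2 hv, (h1 (h2 hv)).2 (Or.inl hv)⟩
        · rintro ⟨hv, hr⟩
          exact ((h1 hv).1 hr).resolve_right (h3 hv)
      · ext m
        simp only [Finset.mem_filter]
        have h1 : ∀ hm : m ∈ L, _ := fun hm => hc m (mem_dom.2 (Or.inr hm))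
        rw [mem_dom] at h1
        constructor
        · intro hm
          exact ⟨hi.2.1 hm, (h1 (hi.2.1 hm)).2 (Or.inr hm)⟩
        · rintro ⟨hm, hr⟩
          exact ((h1 hm).1 hr).resolve_left fun h => hL m hm (hi.1 h)

end HalfEdge

/-! ### Counting networks by deleting the vertex next to a leg. -/

namespace HalfEdge

variable {V : Type*} [DecidableEq V] {S A B : Finset V} {L L₁ R D D₁ D₂ : Finset (V × Fin 3)}
  {σ σ' σ₁ σ₂ : V × Fin 3 → V × Fin 3} {h : V × Fin 3}

/-- The other half-edges at the vertex of `h`. -/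
def siblings (h : V × Fin 3) : Finset (V × Fin 3) := ({h.1} ×ˢ Finset.univ).erase h

theorem mem_siblings {x : V × Fin 3} : x ∈ siblings h ↔ x ≠ h ∧ x.1 = h.1 := by
  rw [siblings, Finset.mem_erase, Finset.mem_product, Finset.mem_singleton]
  simp

theorem card_isMatching_pair {a b : V × Fin 3} (hab : a ≠ b)
    (X : Finset (V × Fin 3 → V × Fin 3)) (hX : ∀ σ, σ ∈ X ↔ IsMatching {a, b} σ) : X.card = 1 := by
  rw [Finset.card_eq_one]
  refine ⟨Equiv.swap a b, ?_⟩
  ext σ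
  rw [hX, Finset.mem_singleton]
  constructor
  · intro hm
    have ha := hm.1 a (by simp)
    have hb := hm.1 b (by simp)
    simp only [Finset.mem_insert, Finset.mem_singleton] at ha hb
    funext x
    by_cases hxa : x = a
    · subst hxa; rw [Equiv.swap_apply_left]; tauto
    by_cases hxb : x = b
    · subst hxb; rw [Equiv.swap_apply_right]; tauto
    rw [Equiv.swap_apply_of_ne_of_ne hxa hxb, hm.2 x (by simp [hxa, hxb])]
  · rintro rfl
    refine ⟨fun x hx => ?_, fun x hx => ?_⟩
    · simp only [Finset.mem_insert, Finset.mem_singleton] at hx ⊢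
      rcases hx with rfl | rfl <;> simp [hab, hab.symm]
    · simp only [Finset.mem_insert, Finset.mem_singleton, not_or] at hx
      exact Equiv.swap_apply_of_ne_of_ne hx.1 hx.2

/-- Deletion of the vertex next to the leg `l` of a network with at most two legs. -/
theorem numNetworks_erase [Fintype V] (hL : ∀ x ∈ L, x.1 ∉ S) {l m : V × Fin 3} (hl : l ∈ L)
    (hlm : ∀ x ∈ L, x = l ∨ x = m) (hS : S.Nonempty) :
    numNetworks S L {l} = ∑ h ∈ S ×ˢ Finset.univ,
      numNetworks (S.erase h.1) (L.erase l ∪ siblings h) (siblings h) := by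
  classical
  rw [numNetworks, card_eq_sum_of_existsUnique (networks S L {l}) (S ×ˢ Finset.univ)
    (fun h σ => σ l = h)]
  · refine Finset.sum_congr rfl fun h hh => ?_
    have hhS : h.1 ∈ S := (Finset.mem_product.1 hh).1
    have hlS : l.1 ∉ S := hL l hl
    have hlh : l ≠ h := by rintro rfl; exact hlS hhS
    set S' := S.erase h.1 with hS'
    set L' := L.erase l ∪ siblings h with hL'
    have hD : Disjoint {l, h} (dom S' L') := by
      rw [Finset.disjoint_left]
      intro x hx
      simp only [Finset.mem_insert, Finset.mem_singleton] at hx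
      rw [mem_dom, hS', hL', Finset.mem_erase, Finset.mem_union, Finset.mem_erase, mem_siblings]
      rcases hx with rfl | rfl
      · rintro (h1 | h1 | h1)
        · exact hlS h1.2
        · exact h1.1 rfl
        · exact hlS (h1.2 ▸ hhS)
      · rintro (h1 | h1 | h1)
        · exact h1.1 rfl
        · exact hL _ h1.2 hhS
        · exact h1.1 rfl
    have hU : {l, h} ∪ dom S' L' = dom S L := by
      ext x
      simp only [hS', hL', Finset.mem_union, mem_dom, Finset.mem_insert, Finset.mem_singleton,
        Finset.mem_erase, mem_siblings]
      constructor
      · rintro ((rfl | rfl) | h1 | h1 | h1)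
        · exact Or.inr hl
        · exact Or.inl hhS
        · exact Or.inl h1.2
        · exact Or.inr h1.2
        · exact Or.inl (h1.2 ▸ hhS)
      · rintro (h1 | h1)
        · by_cases h2 : x = h
          · exact Or.inl (Or.inr h2)
          · by_cases h3 : x.1 = h.1
            · exact Or.inr (Or.inr (Or.inr ⟨h2, h3⟩))
            · exact Or.inr (Or.inl ⟨h3, h1⟩)
        · by_cases h2 : x = l
          · exact Or.inl (Or.inl h2)
          · exact Or.inr (Or.inr (Or.inl ⟨h2, h1⟩))
    have key := card_split (P := fun σ => Rooted S L {l} σ ∧ SP S σ) (P₁ := fun _ => True)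
      (P₂ := fun σ => Rooted S' L' (siblings h) σ ∧ SP S' σ) hD ?_
    · rw [numNetworks]
      refine Eq.trans (congrArg Finset.card ?_) (key.trans ((congrArg (· * _)
        (card_isMatching_pair hlh _ fun σ => by simp)).trans ((one_mul _).trans (congrArg Finset.card ?_))))
      · ext σ
        simp only [Finset.mem_filter, mem_networks, Finset.mem_univ, true_and, hU,
          Finset.mem_insert, Finset.mem_singleton]
        constructor
        · rintro ⟨⟨hm, hr, hsp⟩, he⟩
          refine ⟨hm, ?_, hr, hsp⟩
          rintro x (rfl | rfl)
          · exact Or.inr he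
          · left; rw [← he, hm.involutive]
        · rintro ⟨hm, hinv, hr, hsp⟩
          refine ⟨⟨hm, hr, hsp⟩, ?_⟩
          exact (hinv l (Or.inl rfl)).resolve_left (hm.1 l (mem_dom.2 (Or.inr hl))).2.2
      · ext σ; simp [mem_networks]
    · intro σ₁ σ₂ h1 h2
      set σ := join {l, h} σ₁ σ₂ with hσdef
      have hm : IsMatching (dom S L) σ := hU ▸ isMatching_join hD h1 h2
      have hσ := hm.involutive
      have hσl : σ l = h := by
        rw [hσdef, join_of_mem (by simp)]
        have := h1.1 l (by simp)
        simp only [Finset.mem_insert, Finset.mem_singleton] at this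
        exact this.1.resolve_left this.2.2
      have hσh : σ h = l := by rw [← hσl, hσ]
      have he2 : ∀ x ∈ dom S' L', σ x = σ₂ x := fun x hx =>
        join_of_notMem fun hx' => Finset.disjoint_left.1 hD hx' hx
      have hsp : SP S σ ↔ SP S' σ₂ := by
        rw [SP_erase hσ hhS (l := l) (m := m) (by rw [hσl]) hlS,
          SP_congr hσ h2.involutive fun x hx => he2 x (mem_dom.2 (Or.inl hx))]
        intro x hx hx'
        refine hlm x ?_
        by_contra hxL
        rw [hm.2 x fun hd => (mem_dom.1 hd).elim hx hxL] at hx'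
        exact hx hx'
      rw [hsp, true_and]
      refine and_congr_left fun _ => ⟨fun hr x hx => ?_, fun hr x hx => ?_⟩
      · obtain ⟨l', hl', hlx⟩ := hr x (hU ▸ Finset.mem_union_right _ hx)
        rw [Finset.mem_singleton] at hl'
        subst hl'
        have hmem : ∀ {r y}, r ∈ siblings h → Reach S' σ₂ r y → y ∈ dom S' L' := fun hr hry =>
          hry.mem_dom h2 (mem_dom.2 (Or.inr (Finset.mem_union_right _ hr)))
        have := (hlx.mem_iff (X := {x | x = l' ∨ x = h ∨ ∃ r ∈ siblings h, Reach S' σ₂ r x})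
          hσ ?_ ?_).1 (Or.inl rfl)
        · rcases this with rfl | rfl | h3
          · exact absurd hx (Finset.disjoint_left.1 hD (by simp))
          · exact absurd hx (Finset.disjoint_left.1 hD (by simp))
          · exact h3
        · rintro y (rfl | rfl | ⟨r, hr, hry⟩)
          · exact Or.inr (Or.inl hσl)
          · exact Or.inl hσh
          · refine Or.inr (Or.inr ⟨r, hr, ?_⟩)
            rw [he2 y (hmem hr hry)]
            exact hry.trans (Reach.partner _ _ _)
        · have hsib : ∀ z : V × Fin 3, z.1 = h.1 →
              z = l' ∨ z = h ∨ ∃ r ∈ siblings h, Reach S' σ₂ r z := by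
            intro z hz
            by_cases hzh : z = h
            · exact Or.inr (Or.inl hzh)
            · exact Or.inr (Or.inr ⟨z, mem_siblings.2 ⟨hzh, hz⟩, Reach.refl z⟩)
          rintro y (rfl | rfl | ⟨r, hr, hry⟩) hyS z hz
          · exact absurd hyS hlS
          · exact hsib z hz
          · by_cases hyh : y.1 = h.1
            · exact hsib z (hz.trans hyh)
            · exact Or.inr (Or.inr ⟨r, hr, hry.trans
                (Reach.sibling (Finset.mem_erase.2 ⟨hyh, hyS⟩) hz)⟩)
      · refine ⟨l, by simp, ?_⟩
        have hlh' : Reach S σ l h := hσl ▸ Reach.partner S σ l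
        rw [← hU, Finset.mem_union, Finset.mem_insert, Finset.mem_singleton] at hx
        rcases hx with (rfl | rfl) | hx
        · exact Reach.refl _
        · exact hlh'
        · obtain ⟨r, hrs, hrx⟩ := hr x hx
          refine hlh'.trans ((Reach.sibling hhS (mem_siblings.1 hrs).2).trans ?_)
          refine (hrx.transfer (X := {x | x ∈ dom S' L'}) h2.involutive ?_ ?_ ?_ ?_
            (mem_dom.2 (Or.inr (Finset.mem_union_right _ hrs)))).2
          · exact fun h hh => (h2.1 h hh).1
          · exact fun h _ hA h' e => mem_dom.2 (Or.inl (e ▸ hA))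
          · exact fun h hh => (he2 h hh).symm
          · exact fun h _ hA => Finset.mem_of_mem_erase hA
  · intro σ hσ
    obtain ⟨hm, hr, hsp⟩ := mem_networks.1 hσ
    refine ⟨σ l, ⟨?_, rfl⟩, fun h hh => hh.2.symm⟩
    simp only [Finset.mem_product, Finset.mem_univ, and_true]
    -- If the partner of the leg were outside `S`, only these two half-edges would be reachable from
    -- the root, although `S` is nonempty.
    by_contra hc
    obtain ⟨v, hv⟩ := hS
    obtain ⟨r, hr1, hrv⟩ := hr (v, 0) (mem_dom.2 (Or.inl hv))
    rw [Finset.mem_singleton] at hr1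
    subst hr1
    rcases hrv.eq_or_eq hm.involutive (hL r hl) hc with h1 | h1
    · exact hL r hl (h1 ▸ hv)
    · exact hc (h1 ▸ hv)

/-- The part of `σ` on the network with vertex set `A` and legs `L` is series-parallel and
rooted. -/
theorem rooted_SP_congr (hσ : Function.Involutive σ) (hσ' : Function.Involutive σ')
    (hinv : ∀ x ∈ dom A L, σ' x ∈ dom A L) (he : ∀ x ∈ dom A L, σ x = σ' x) (hR : R ⊆ L) :
    (Rooted A L R σ ∧ SP A σ) ↔ (Rooted A L R σ' ∧ SP A σ') := by
  rw [SP_congr hσ hσ' fun x hx => he x (mem_dom.2 (Or.inl hx))]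
  refine and_congr_left fun _ => forall₂_congr fun x hx => exists_congr fun r =>
    and_congr_right fun hr => ?_
  have hr' : r ∈ dom A L := mem_dom.2 (Or.inr (hR hr))
  constructor
  · intro h
    refine (h.transfer (X := {x | x ∈ dom A L}) hσ ?_ ?_ ?_ (fun _ _ => id) hr').2
    · intro h hh
      rw [Set.mem_ofPred_eq, he h hh]
      exact hinv h hh
    · exact fun h _ hA h' e => mem_dom.2 (Or.inl (e ▸ hA))
    · exact he
  · intro h
    refine (h.transfer (X := {x | x ∈ dom A L}) hσ' hinv ?_ ?_ (fun _ _ => id) hr').2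
    · exact fun h _ hA h' e => mem_dom.2 (Or.inl (e ▸ hA))
    · exact fun h hh => (he h hh).symm

end HalfEdge

/-! ### Existence and uniqueness of the decomposition of a network with three legs. -/

namespace HalfEdge

variable {V : Type*} [DecidableEq V] {S A B : Finset V} {L L₁ R D D₁ D₂ : Finset (V × Fin 3)}
  {σ σ' σ₁ σ₂ : V × Fin 3 → V × Fin 3} {h : V × Fin 3}

/-- Each part is closed under `σ` and connected from its leg, hence equal to the component of that
leg after removal of `t`. So the parts and the permutation are determined by `t`. -/
theorem reach_erase_iff_mem_dom {P : Fin 3 → V × Fin 3} (hP : ∀ k, (P k).1 ∉ S)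
    {t : V} {π : Equiv.Perm (Fin 3)} {A : Fin 3 → Finset V} (hA : ∀ k, A k ⊆ S.erase t)
    (hσ : Function.Involutive σ)
    (hp : ∀ k, ∀ h ∈ dom (A k) {P k, (t, π k)},
      σ h ∈ dom (A k) {P k, (t, π k)} ∧ Reach (A k) σ (P k) h) (k : Fin 3) (h : V × Fin 3) :
    Reach (S.erase t) σ (P k) h ↔ h ∈ dom (A k) {P k, (t, π k)} := by
  constructor
  · intro hr
    refine (hr.mem_iff (X := {h | h ∈ dom (A k) {P k, (t, π k)}}) hσ ?_ ?_).1
      (mem_dom.2 (Or.inr (by simp)))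
    · exact fun x hx => (hp k x hx).1
    · intro x hx hS y hy
      rw [Set.mem_ofPred_eq, mem_dom, Finset.mem_insert, Finset.mem_singleton] at hx
      rcases hx with hx | rfl | rfl
      · exact mem_dom.2 (Or.inl (hy ▸ hx))
      · exact absurd (Finset.mem_of_mem_erase hS) (hP k)
      · exact absurd rfl (Finset.mem_erase.1 hS).1
  · exact fun hh => (hp k h hh).2.mono (hA k)

theorem exists_parts {P : Fin 3 → V × Fin 3} (hPi : Function.Injective P) (hP : ∀ k, (P k).1 ∉ S)
    (hm : IsMatching (dom S (Finset.univ.image P)) σ)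
    (hr : Rooted S (Finset.univ.image P) {P 0} σ) (hsp : SP S σ) :
    ∃ t ∈ S, ∃ π : Equiv.Perm (Fin 3), ∃ A : Fin 3 → Finset V, (∀ k, A k ⊆ S.erase t) ∧
      (∀ j k, j ≠ k → Disjoint (A j) (A k)) ∧ (∀ v ∈ S.erase t, ∃ k, v ∈ A k) ∧
      ∀ k, ∀ h ∈ dom (A k) {P k, (t, π k)},
        σ h ∈ dom (A k) {P k, (t, π k)} ∧ Reach (A k) σ (P k) h := by
  classical
  have hσ := hm.involutive
  have hrP : ∀ h ∈ dom S (Finset.univ.image P), Reach S σ (P 0) h := by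
    intro h hh
    obtain ⟨r, hr1, hr2⟩ := hr h hh
    rw [Finset.mem_singleton] at hr1
    exact hr1 ▸ hr2
  have hPdom : ∀ k, P k ∈ dom S (Finset.univ.image P) := fun k => mem_dom.2 (Or.inr (by simp))
  obtain ⟨t, ht, h01, h02, h12⟩ := exists_separating hσ (hP 0) (hP 1) (hP 2)
    (hPi.ne (by decide)) (hPi.ne (by decide)) (hPi.ne (by decide)) (hrP _ (hPdom 1))
    (hrP _ (hPdom 2)) hsp
  have hsep : Separates S σ P t := by
    intro j k hjk
    fin_cases j <;> fin_cases k <;> first | exact absurd rfl hjk | skip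
    · exact h01
    · exact h02
    · exact fun h => h01 h.symm
    · exact h12
    · exact fun h => h02 h.symm
    · exact fun h => h12 h.symm
  obtain ⟨π, hπ, hall⟩ := hsep.exists_equiv hσ fun k => hrP _ (hPdom k)
  let A : Fin 3 → Finset V := fun k => (S.erase t).filter fun v => Reach (S.erase t) σ (P k) (v, 0)
  have hchar : ∀ k, ∀ h ∈ dom S (Finset.univ.image P),
      Reach (S.erase t) σ (P k) h → h ∈ dom (A k) {P k, (t, π k)} := by
    intro k h hh hr
    rw [mem_dom, Finset.mem_insert, Finset.mem_singleton]
    rcases mem_dom.1 hh with hh | hh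
    · by_cases ht : h.1 = t
      · obtain ⟨j, hj⟩ := π.surjective h.2
        have he : h = (t, π j) := Prod.ext ht hj.symm
        have : k = j := by
          by_contra hkj
          exact hsep k j hkj (hr.trans (he ▸ (hπ j).symm))
        subst this
        exact Or.inr (Or.inr he)
      · have hS : h.1 ∈ S.erase t := Finset.mem_erase.2 ⟨ht, hh⟩
        exact Or.inl (Finset.mem_filter.2 ⟨hS, hr.trans (Reach.sibling hS rfl)⟩)
    · obtain ⟨j, -, rfl⟩ := Finset.mem_image.1 hh
      have : k = j := by
        by_contra hkj
        exact hsep k j hkj hr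
      subst this
      exact Or.inr (Or.inl rfl)
  have hback : ∀ k, ∀ h ∈ dom (A k) {P k, (t, π k)},
      Reach (S.erase t) σ (P k) h ∧ h ∈ dom S (Finset.univ.image P) := by
    intro k h hh
    rw [mem_dom, Finset.mem_insert, Finset.mem_singleton] at hh
    rcases hh with hh | rfl | rfl
    · obtain ⟨h1, h2⟩ := Finset.mem_filter.1 hh
      exact ⟨h2.trans (Reach.sibling (h := (h.1, 0)) h1 rfl),
        mem_dom.2 (Or.inl (Finset.mem_of_mem_erase h1))⟩
    · exact ⟨Reach.refl _, hPdom k⟩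
    · exact ⟨hπ k, mem_dom.2 (Or.inl ht)⟩
  refine ⟨t, ht, π, A, fun k => Finset.filter_subset _ _, fun j k hjk => ?_, fun v hv => ?_, ?_⟩
  · rw [Finset.disjoint_left]
    intro v hv hv'
    exact hsep j k hjk ((Finset.mem_filter.1 hv).2.trans (Finset.mem_filter.1 hv').2.symm)
  · obtain ⟨k, hk⟩ := hall (v, 0) (hrP _ (mem_dom.2 (Or.inl (Finset.mem_of_mem_erase hv))))
    exact ⟨k, Finset.mem_filter.2 ⟨hv, hk⟩⟩
  · intro k h hh
    obtain ⟨h1, h2⟩ := hback k h hh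
    exact ⟨hchar k _ (hm.1 h h2).1 (h1.trans (Reach.partner _ _ _)), Reach.filter hσ h1⟩

/-- Any such decomposition makes its centre a separating vertex, which is unique by
`Separates.unique`. -/
theorem parts_unique {P : Fin 3 → V × Fin 3} (hPi : Function.Injective P) (hP : ∀ k, (P k).1 ∉ S)
    (hm : IsMatching (dom S (Finset.univ.image P)) σ)
    (hr : Rooted S (Finset.univ.image P) {P 0} σ)
    {t t' : V} (ht : t ∈ S) (ht' : t' ∈ S) {π π' : Equiv.Perm (Fin 3)} {A A' : Fin 3 → Finset V}
    (hA : ∀ k, A k ⊆ S.erase t) (hA' : ∀ k, A' k ⊆ S.erase t')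
    (hp : ∀ k, ∀ h ∈ dom (A k) {P k, (t, π k)},
      σ h ∈ dom (A k) {P k, (t, π k)} ∧ Reach (A k) σ (P k) h)
    (hp' : ∀ k, ∀ h ∈ dom (A' k) {P k, (t', π' k)},
      σ h ∈ dom (A' k) {P k, (t', π' k)} ∧ Reach (A' k) σ (P k) h) :
    t = t' ∧ π = π' ∧ A = A' := by
  have hσ := hm.involutive
  have hrP : ∀ h ∈ dom S (Finset.univ.image P), Reach S σ (P 0) h := by
    intro h hh
    obtain ⟨r, hr1, hr2⟩ := hr h hh
    rw [Finset.mem_singleton] at hr1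
    exact hr1 ▸ hr2
  have hPdom : ∀ k, P k ∈ dom S (Finset.univ.image P) := fun k => mem_dom.2 (Or.inr (by simp))
  have key : ∀ {t : V} {π : Equiv.Perm (Fin 3)} {A : Fin 3 → Finset V}, t ∈ S →
      (∀ k, A k ⊆ S.erase t) →
      (∀ k, ∀ h ∈ dom (A k) {P k, (t, π k)},
        σ h ∈ dom (A k) {P k, (t, π k)} ∧ Reach (A k) σ (P k) h) → Separates S σ P t := by
    intro t π A ht hA hp j k hjk hr
    rw [reach_erase_iff_mem_dom hP hA hσ hp, mem_dom, Finset.mem_insert, Finset.mem_singleton] at hr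
    rcases hr with hr | hr | hr
    · exact hP k (Finset.mem_of_mem_erase (hA j hr))
    · exact hjk (hPi hr).symm
    · exact hP k (hr ▸ ht)
  obtain rfl : t = t' := (key ht hA hp).unique hσ ht (key ht' hA' hp') (fun k => hrP _ (hPdom k))
    (hrP _ (mem_dom.2 (Or.inl ht')))
  have hdom : ∀ k h, h ∈ dom (A k) {P k, (t, π k)} ↔ h ∈ dom (A' k) {P k, (t, π' k)} :=
    fun k h => by
      rw [← reach_erase_iff_mem_dom hP hA hσ hp, reach_erase_iff_mem_dom hP hA' hσ hp']
  refine ⟨rfl, ?_, ?_⟩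
  · ext k
    have := (hdom k (t, π k)).1 (mem_dom.2 (Or.inr (by simp)))
    rw [mem_dom, Finset.mem_insert, Finset.mem_singleton] at this
    rcases this with h | h | h
    · exact absurd rfl (Finset.mem_erase.1 (hA' k h)).1
    · exact absurd ht (by have := hP k; rwa [← h] at this)
    · rw [(Prod.mk.inj h).2]
  · have key2 : ∀ {A A' : Fin 3 → Finset V} {π π' : Equiv.Perm (Fin 3)}, (∀ k, A k ⊆ S.erase t) →
        (∀ k h, h ∈ dom (A k) {P k, (t, π k)} → h ∈ dom (A' k) {P k, (t, π' k)}) →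
        ∀ k, A k ⊆ A' k := by
      intro A A' π π' hA hdom k v hv
      have := hdom k (v, 0) (mem_dom.2 (Or.inl hv))
      rw [mem_dom, Finset.mem_insert, Finset.mem_singleton] at this
      have hvS := Finset.mem_erase.1 (hA k hv)
      rcases this with h | h | h
      · exact h
      · exact absurd hvS.2 (by have := hP k; rwa [← h] at this)
      · exact absurd (Prod.mk.inj h).1 hvS.1
    funext k
    exact Finset.Subset.antisymm (key2 hA (fun k h => (hdom k h).1) k)
      (key2 hA' (fun k h => (hdom k h).2) k)

end HalfEdge

/-! ### Counting networks with three legs. -/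

namespace HalfEdge

variable {V : Type*} [DecidableEq V] {S A B : Finset V} {L L₁ R D D₁ D₂ : Finset (V × Fin 3)}
  {σ σ' σ₁ σ₂ : V × Fin 3 → V × Fin 3} {h : V × Fin 3}

/-- The partition of `T` given by its first two parts. -/
def threeParts (T A B : Finset V) : Fin 3 → Finset V := ![A, B, (T \ A) \ B]

theorem threeParts_subset {T : Finset V} (hA : A ⊆ T) (hB : B ⊆ T \ A) (k : Fin 3) :
    threeParts T A B k ⊆ T := by
  fin_cases k
  · exact hA
  · exact hB.trans Finset.sdiff_subset
  · exact Finset.sdiff_subset.trans Finset.sdiff_subset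

theorem threeParts_disjoint {T : Finset V} (hB : B ⊆ T \ A) (j k : Fin 3) (hjk : j ≠ k) :
    Disjoint (threeParts T A B j) (threeParts T A B k) := by
  have h01 : Disjoint A B := (Finset.disjoint_of_subset_left hB Finset.sdiff_disjoint).symm
  have h02 : Disjoint A ((T \ A) \ B) :=
    (Finset.disjoint_of_subset_left Finset.sdiff_subset Finset.sdiff_disjoint).symm
  have h12 : Disjoint B ((T \ A) \ B) := Finset.sdiff_disjoint.symm
  fin_cases j <;> fin_cases k <;> first | exact absurd rfl hjk | skip
  · exact h01
  · exact h02
  · exact h01.symm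
  · exact h12
  · exact h02.symm
  · exact h12.symm

theorem exists_mem_threeParts {T : Finset V} {v : V} (hv : v ∈ T) :
    ∃ k, v ∈ threeParts T A B k := by
  by_cases h0 : v ∈ A
  · exact ⟨0, h0⟩
  by_cases h1 : v ∈ B
  · exact ⟨1, h1⟩
  exact ⟨2, Finset.mem_sdiff.2 ⟨Finset.mem_sdiff.2 ⟨hv, h0⟩, h1⟩⟩

theorem eq_threeParts {T : Finset V} {P : Fin 3 → Finset V} (hP : ∀ k, P k ⊆ T)
    (hd : ∀ j k, j ≠ k → Disjoint (P j) (P k)) (hc : ∀ v ∈ T, ∃ k, v ∈ P k) :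
    P 0 ⊆ T ∧ P 1 ⊆ T \ P 0 ∧ P = threeParts T (P 0) (P 1) := by
  refine ⟨hP 0, fun v hv => Finset.mem_sdiff.2 ⟨hP 1 hv, fun h =>
    Finset.disjoint_left.1 (hd 0 1 (by decide)) h hv⟩, ?_⟩
  funext k
  fin_cases k
  · rfl
  · rfl
  · ext v
    simp only [threeParts, Fin.reduceFinMk, Matrix.cons_val, Finset.mem_sdiff]
    constructor
    · exact fun hv => ⟨⟨hP 2 hv, fun h => Finset.disjoint_left.1 (hd 0 2 (by decide)) h hv⟩,
        fun h => Finset.disjoint_left.1 (hd 1 2 (by decide)) h hv⟩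
    · rintro ⟨⟨h1, h2⟩, h3⟩
      obtain ⟨k, hk⟩ := hc v h1
      fin_cases k
      · exact absurd hk h2
      · exact absurd hk h3
      · exact hk

theorem card_eq_mul_of_mem [Fintype V] (hD : Disjoint D₁ D₂)
    {P P₁ P₂ : (V × Fin 3 → V × Fin 3) → Prop}
    (hP : ∀ σ₁ σ₂, IsMatching D₁ σ₁ → IsMatching D₂ σ₂ → (P (join D₁ σ₁ σ₂) ↔ P₁ σ₁ ∧ P₂ σ₂))
    {X X₁ X₂ : Finset (V × Fin 3 → V × Fin 3)}
    (hX : ∀ σ, σ ∈ X ↔ IsMatching (D₁ ∪ D₂) σ ∧ (∀ x ∈ D₁, σ x ∈ D₁) ∧ P σ)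
    (hX₁ : ∀ σ, σ ∈ X₁ ↔ IsMatching D₁ σ ∧ P₁ σ) (hX₂ : ∀ σ, σ ∈ X₂ ↔ IsMatching D₂ σ ∧ P₂ σ) :
    X.card = X₁.card * X₂.card := by
  classical
  refine Eq.trans (congrArg Finset.card ?_) ((card_split hD hP).trans (congrArg₂ (· * ·)
    (congrArg Finset.card ?_) (congrArg Finset.card ?_)))
  · ext σ; simp only [hX, Finset.mem_filter, Finset.mem_univ, true_and]
  · ext σ; simp only [hX₁, Finset.mem_filter, Finset.mem_univ, true_and]
  · ext σ; simp only [hX₂, Finset.mem_filter, Finset.mem_univ, true_and]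

/-- The three parts can be chosen independently: they are connected to each other through `t`, and
seen in the closure they are parallel between `none` and `t`, so `SP_parallel` reduces the
series-parallel condition to the parts. -/
theorem card_parts [Fintype V] {P : Fin 3 → V × Fin 3} (hPi : Function.Injective P)
    (hP : ∀ k, (P k).1 ∉ S) {t : V} (ht : t ∈ S) (π : Equiv.Perm (Fin 3)) {A : Fin 3 → Finset V}
    (hA : ∀ k, A k ⊆ S.erase t) (hd : ∀ j k, j ≠ k → Disjoint (A j) (A k))
    (hc : ∀ v ∈ S.erase t, ∃ k, v ∈ A k) (X : Finset (V × Fin 3 → V × Fin 3))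
    (hX : ∀ σ, σ ∈ X ↔ σ ∈ networks S (Finset.univ.image P) {P 0} ∧
      ∀ k, ∀ h ∈ dom (A k) {P k, (t, π k)},
        σ h ∈ dom (A k) {P k, (t, π k)} ∧ Reach (A k) σ (P k) h) :
    X.card = numNetworks (A 0) {P 0, (t, π 0)} {P 0} * (numNetworks (A 1) {P 1, (t, π 1)} {P 1} *
      numNetworks (A 2) {P 2, (t, π 2)} {P 2}) := by
  classical
  let E : Fin 3 → Finset (V × Fin 3) := fun k => dom (A k) {P k, (t, π k)}
  have hE : ∀ k h, h ∈ E k ↔ h.1 ∈ A k ∨ h = P k ∨ h = (t, π k) := fun k h => by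
    rw [mem_dom, Finset.mem_insert, Finset.mem_singleton]
  have hAS : ∀ k v, v ∈ A k → v ≠ t ∧ v ∈ S := fun k v hv => Finset.mem_erase.1 (hA k hv)
  have hEd : ∀ j k, j ≠ k → Disjoint (E j) (E k) := by
    intro j k hjk
    rw [Finset.disjoint_left]
    intro h h1 h2
    rw [hE] at h1 h2
    rcases h1 with h1 | rfl | rfl
    · rcases h2 with h2 | rfl | rfl
      · exact Finset.disjoint_left.1 (hd j k hjk) h1 h2
      · exact hP k (hAS j _ h1).2
      · exact (hAS j _ h1).1 rfl
    · rcases h2 with h2 | h2 | h2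
      · exact hP j (hAS k _ h2).2
      · exact hjk (hPi h2)
      · exact hP j (h2 ▸ ht)
    · rcases h2 with h2 | h2 | h2
      · exact (hAS k _ h2).1 rfl
      · exact hP k (h2 ▸ ht)
      · exact hjk (π.injective (Prod.mk.inj h2).2)
  have hEU : E 0 ∪ (E 1 ∪ E 2) = dom S (Finset.univ.image P) := by
    have h1 : ∀ h, h ∈ E 0 ∪ (E 1 ∪ E 2) ↔ ∃ k, h ∈ E k := fun h => by
      simp [Fin.exists_fin_succ]
    ext h
    rw [h1, mem_dom]
    constructor
    · rintro ⟨k, hk⟩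
      rcases (hE k h).1 hk with h2 | rfl | rfl
      · exact Or.inl (hAS k _ h2).2
      · exact Or.inr (by simp)
      · exact Or.inl ht
    · rintro (h2 | h2)
      · by_cases h3 : h.1 = t
        · obtain ⟨k, hk⟩ := π.surjective h.2
          exact ⟨k, (hE k h).2 (Or.inr (Or.inr (Prod.ext h3 hk.symm)))⟩
        · obtain ⟨k, hk⟩ := hc h.1 (Finset.mem_erase.2 ⟨h3, h2⟩)
          exact ⟨k, (hE k h).2 (Or.inl hk)⟩
      · obtain ⟨k, -, rfl⟩ := Finset.mem_image.1 h2
        exact ⟨k, (hE k _).2 (Or.inr (Or.inl rfl))⟩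
  let Q : Fin 3 → (V × Fin 3 → V × Fin 3) → Prop := fun k σ =>
    Rooted (A k) {P k, (t, π k)} {P k} σ ∧ SP (A k) σ
  have hQ : ∀ k {σ σ'}, Function.Involutive σ → Function.Involutive σ' →
      (∀ x ∈ E k, σ' x ∈ E k) → (∀ x ∈ E k, σ x = σ' x) → (Q k σ ↔ Q k σ') := fun k σ σ' h1 h2 h3 h4 =>
    rooted_SP_congr h1 h2 h3 h4 (by simp)
  have hd12 := hEd 1 2 (by decide)
  have hd0 : Disjoint (E 0) (E 1 ∪ E 2) := by
    rw [Finset.disjoint_union_right]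
    exact ⟨hEd 0 1 (by decide), hEd 0 2 (by decide)⟩
  have hnet : ∀ k σ, σ ∈ networks (A k) {P k, (t, π k)} {P k} ↔ IsMatching (E k) σ ∧ Q k σ :=
    fun k σ => mem_networks
  rw [numNetworks, numNetworks, numNetworks, ← card_eq_mul_of_mem (P := fun σ => Q 1 σ ∧ Q 2 σ)
    (X := Finset.univ.filter fun σ => IsMatching (E 1 ∪ E 2) σ ∧ (∀ x ∈ E 1, σ x ∈ E 1) ∧
      Q 1 σ ∧ Q 2 σ) hd12 (hX := fun σ => by simp only [Finset.mem_filter, Finset.mem_univ, true_and])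
    (hX₁ := hnet 1) (hX₂ := hnet 2)]
  swap
  · intro σ₁ σ₂ h1 h2
    have hσ := (isMatching_join hd12 h1 h2).involutive
    rw [hQ 1 hσ h1.involutive (fun x hx => (h1.1 x hx).1) fun x hx => join_of_mem hx,
      hQ 2 hσ h2.involutive (fun x hx => (h2.1 x hx).1) fun x hx => join_of_notMem fun hx' =>
        Finset.disjoint_left.1 hd12 hx' hx]
  refine card_eq_mul_of_mem (P := fun σ => Q 0 σ ∧ (∀ x ∈ E 1, σ x ∈ E 1) ∧ Q 1 σ ∧ Q 2 σ)
    (P₂ := fun σ => (∀ x ∈ E 1, σ x ∈ E 1) ∧ Q 1 σ ∧ Q 2 σ) hd0 ?_ (fun σ => ?_) (hnet 0)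
    (fun σ => by simp only [Finset.mem_filter, Finset.mem_univ, true_and])
  · intro σ₁ σ₂ h1 h2
    have hσ := (isMatching_join hd0 h1 h2).involutive
    have he : ∀ x ∈ E 1 ∪ E 2, join (E 0) σ₁ σ₂ x = σ₂ x := fun x hx => join_of_notMem fun hx' =>
        Finset.disjoint_left.1 hd0 hx' hx
    rw [hQ 0 hσ h1.involutive (fun x hx => (h1.1 x hx).1) fun x hx => join_of_mem hx]
    have hinv : (∀ x ∈ E 1, join (E 0) σ₁ σ₂ x ∈ E 1) ↔ ∀ x ∈ E 1, σ₂ x ∈ E 1 :=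
      forall₂_congr fun x hx => by rw [he x (Finset.mem_union_left _ hx)]
    rw [hinv]
    refine and_congr_right fun _ => and_congr_right fun hi1 => ?_
    have hi2 : ∀ x ∈ E 2, σ₂ x ∈ E 2 := by
      intro x hx
      have h3 := h2.1 x (Finset.mem_union_right _ hx)
      refine (Finset.mem_union.1 h3.1).resolve_left fun h4 => ?_
      have := hi1 _ h4
      rw [h3.2.1] at this
      exact Finset.disjoint_left.1 hd12 this hx
    rw [hQ 1 hσ h2.involutive hi1 fun x hx => he x (Finset.mem_union_left _ hx),
      hQ 2 hσ h2.involutive hi2 fun x hx => he x (Finset.mem_union_right _ hx)]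
  rw [hX, hEU, mem_networks]
  have hpar : IsMatching (dom S (Finset.univ.image P)) σ → (∀ k, ∀ h ∈ E k,
      σ h ∈ E k ∧ Reach (A k) σ (P k) h) → (SP S σ ↔ ∀ k, SP (A k) σ) := by
    intro hm hp
    have hEk : ∀ k x, x ∈ E k → (σ x).1 ∈ A k ∨ σ x = P k ∨ σ x = (t, π k) := fun k x hx =>
      (hE k _).1 (hp k x hx).1
    have hne : ∀ x, x ∈ dom S (Finset.univ.image P) → σ x ≠ x := fun x hx => (hm.1 x hx).2.2
    refine SP_parallel hm.involutive ht (e := P) (e' := fun k => (t, π k))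
      (fun k v hv => (hAS k v hv).2) (fun k hv => (hAS k t hv).1 rfl) hd ?_ ?_ hP (fun _ => rfl)
      ?_ ?_ ?_
    · intro v hv
      by_cases h : v = t
      · exact Or.inl h
      · exact Or.inr (hc v (Finset.mem_erase.2 ⟨h, hv⟩))
    · exact fun k h hh => hEk k h ((hE k h).2 (Or.inl hh))
    · intro k
      rcases hEk k (P k) ((hE k _).2 (Or.inr (Or.inl rfl))) with h | h | h
      · exact Or.inl h
      · exact absurd h (hne _ (mem_dom.2 (Or.inr (by simp))))
      · exact Or.inr h
    · intro k
      rcases hEk k (t, π k) ((hE k _).2 (Or.inr (Or.inr rfl))) with h | h | h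
      · exact Or.inl h
      · exact Or.inr h
      · exact absurd h (hne _ (mem_dom.2 (Or.inl ht)))
    · exact fun k h hh => (hp k h ((hE k h).2 hh)).2
  have hroot : (∀ k, ∀ h ∈ E k, σ h ∈ E k ∧ Reach (A k) σ (P k) h) ↔
      (∀ k, ∀ h ∈ E k, σ h ∈ E k) ∧ ∀ k, Rooted (A k) {P k, (t, π k)} {P k} σ := by
    constructor
    · exact fun hp => ⟨fun k h hh => (hp k h hh).1, fun k h hh => ⟨P k, by simp, (hp k h hh).2⟩⟩
    · rintro ⟨h1, h2⟩ k h hh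
      refine ⟨h1 k h hh, ?_⟩
      obtain ⟨r, hr, hr'⟩ := h2 k h hh
      rw [Finset.mem_singleton] at hr
      exact hr ▸ hr'
  constructor
  · rintro ⟨⟨hm, hr, hsp⟩, hp⟩
    have h1 := (hpar hm hp).1 hsp
    have h2 := hroot.1 hp
    exact ⟨hm, h2.1 0, ⟨h2.2 0, h1 0⟩, h2.1 1, ⟨h2.2 1, h1 1⟩, h2.2 2, h1 2⟩
  · rintro ⟨hm, hi0, ⟨hr0, hs0⟩, hi1, ⟨hr1, hs1⟩, hr2, hs2⟩
    have hi2 : ∀ x ∈ E 2, σ x ∈ E 2 := by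
      intro x hx
      have h3 := hm.1 x (hEU ▸ Finset.mem_union_right _ (Finset.mem_union_right _ hx))
      rw [← hEU, Finset.mem_union, Finset.mem_union] at h3
      rcases h3.1 with h4 | h4 | h4
      · have := hi0 _ h4
        rw [h3.2.1] at this
        exact absurd hx (Finset.disjoint_left.1 (hEd 0 2 (by decide)) this)
      · have := hi1 _ h4
        rw [h3.2.1] at this
        exact absurd hx (Finset.disjoint_left.1 hd12 this)
      · exact h4
    have hp : ∀ k, ∀ h ∈ E k, σ h ∈ E k ∧ Reach (A k) σ (P k) h := by
      refine hroot.2 ⟨fun k => ?_, fun k => ?_⟩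
      · fin_cases k
        exacts [hi0, hi1, hi2]
      · fin_cases k
        exacts [hr0, hr1, hr2]
    refine ⟨⟨hm, ?_, (hpar hm hp).2 fun k => ?_⟩, hp⟩
    · have hAk : ∀ k, A k ⊆ S := fun k v hv => (hAS k v hv).2
      have ht' : ∀ k, Reach S σ (P k) (t, π k) := fun k =>
        (hp k _ ((hE k _).2 (Or.inr (Or.inr rfl)))).2.mono (hAk k)
      intro h hh
      refine ⟨P 0, by simp, ?_⟩
      have h1 : ∃ k, h ∈ E k := by
        rw [← hEU] at hh
        simpa [Fin.exists_fin_succ] using hh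
      obtain ⟨k, hk⟩ := h1
      have hs : Reach S σ (t, π 0) (t, π k) := Reach.sibling ht rfl
      exact (ht' 0).trans (hs.trans ((ht' k).symm.trans ((hp k h hk).2.mono (hAk k))))
    · fin_cases k
      exacts [hs0, hs1, hs2]

/-- Decomposition of connected networks with three legs at the vertex separating the legs. -/
theorem numNetworks_three [Fintype V] {P : Fin 3 → V × Fin 3} (hPi : Function.Injective P)
    (hP : ∀ k, (P k).1 ∉ S) :
    numNetworks S (Finset.univ.image P) {P 0} = ∑ t ∈ S, ∑ π : Equiv.Perm (Fin 3),
      ∑ A ∈ (S.erase t).powerset, ∑ B ∈ (S.erase t \ A).powerset,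
        numNetworks A {P 0, (t, π 0)} {P 0} * (numNetworks B {P 1, (t, π 1)} {P 1} *
          numNetworks ((S.erase t \ A) \ B) {P 2, (t, π 2)} {P 2}) := by
  classical
  rw [numNetworks, card_eq_sum_of_existsUnique (networks S (Finset.univ.image P) {P 0})
    (S.sigma fun t => (Finset.univ : Finset (Equiv.Perm (Fin 3))) ×ˢ
      ((S.erase t).powerset.sigma fun A => (S.erase t \ A).powerset))
    (fun i σ => ∀ k, ∀ h ∈ dom (threeParts (S.erase i.1) i.2.2.1 i.2.2.2 k) {P k, (i.1, i.2.1 k)},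
      σ h ∈ dom (threeParts (S.erase i.1) i.2.2.1 i.2.2.2 k) {P k, (i.1, i.2.1 k)} ∧
        Reach (threeParts (S.erase i.1) i.2.2.1 i.2.2.2 k) σ (P k) h) ?_, Finset.sum_sigma]
  · refine Finset.sum_congr rfl fun t ht => ?_
    rw [Finset.sum_product]
    refine Finset.sum_congr rfl fun π _ => ?_
    rw [Finset.sum_sigma]
    refine Finset.sum_congr rfl fun A hA => Finset.sum_congr rfl fun B hB => ?_
    rw [Finset.mem_powerset] at hA hB
    exact card_parts (A := threeParts (S.erase t) A B) hPi hP ht π (threeParts_subset hA hB)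
      (threeParts_disjoint hB) (fun v hv => exists_mem_threeParts hv) _ fun σ => by
        simp only [Finset.mem_filter]
  · intro σ hσ
    obtain ⟨hm, hr, hsp⟩ := mem_networks.1 hσ
    obtain ⟨t, ht, π, A, hA, hd, hc, hp⟩ := exists_parts hPi hP hm hr hsp
    obtain ⟨h1, h2, h3⟩ := eq_threeParts hA hd hc
    have hmem : ∀ i : (t : V) × (Equiv.Perm (Fin 3) × (_ : Finset V) × Finset V),
        i ∈ (S.sigma fun t => (Finset.univ : Finset (Equiv.Perm (Fin 3))) ×ˢ
          ((S.erase t).powerset.sigma fun A => (S.erase t \ A).powerset)) ↔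
        i.1 ∈ S ∧ i.2.2.1 ⊆ S.erase i.1 ∧ i.2.2.2 ⊆ S.erase i.1 \ i.2.2.1 := by
      intro i
      simp only [Finset.mem_sigma, Finset.mem_product, Finset.mem_univ, true_and,
        Finset.mem_powerset]
    refine ⟨⟨t, π, A 0, A 1⟩, ⟨(hmem _).2 ⟨ht, h1, h2⟩, ?_⟩, ?_⟩
    · dsimp only
      rw [← h3]
      exact hp
    · rintro ⟨t', π', A', B'⟩ ⟨hi, hp'⟩
      obtain ⟨g1, g2, g3⟩ := (hmem _).1 hi
      obtain ⟨rfl, rfl, h4⟩ := parts_unique hPi hP hm hr ht g1 hA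
        (threeParts_subset g2 g3) hp hp'
      subst h4
      rfl

end HalfEdge

/-! ### Generating functions of networks. -/

namespace HalfEdge

open PowerSeries

/-- The numbers with exponential generating function `F`, in the scale given by the number of
labellings of vertices and half-edges. -/
noncomputable def labelled (F : PowerSeries ℝ) (n : ℕ) : ℝ := n.factorial * 6 ^ n * coeff n F

theorem labelled_add (F G : PowerSeries ℝ) (n : ℕ) :
    labelled (F + G) n = labelled F n + labelled G n := by
  simp [labelled, mul_add]

theorem labelled_X_mul (F : PowerSeries ℝ) (n : ℕ) :
    labelled (X * F) (n + 1) = 6 * (n + 1) * labelled F n := by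
  simp only [labelled, coeff_succ_X_mul, Nat.factorial_succ, pow_succ]
  push_cast
  ring

/-- The binomial convolution of exponential series; the factor `6 ^ n` is multiplicative and does
not interfere. -/
theorem sum_powerset_labelled {V : Type*} [DecidableEq V] (F G : PowerSeries ℝ) (S : Finset V) :
    ∑ A ∈ S.powerset, labelled F A.card * labelled G (S \ A).card = labelled (F * G) S.card := by
  have h1 : ∀ A ∈ S.powerset, labelled F A.card * labelled G (S \ A).card =
      labelled F A.card * labelled G (S.card - A.card) := fun A hA => by
    rw [Finset.card_sdiff_of_subset (Finset.mem_powerset.1 hA)]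
  rw [Finset.sum_congr rfl h1, Finset.sum_powerset_apply_card
    (f := fun m => labelled F m * labelled G (S.card - m)), labelled, coeff_mul,
    Finset.Nat.sum_antidiagonal_eq_sum_range_succ (fun i j => coeff i F * coeff j G),
    Finset.mul_sum]
  refine Finset.sum_congr rfl fun m hm => ?_
  have hm : m ≤ S.card := Nat.lt_succ_iff.1 (Finset.mem_range.1 hm)
  simp only [labelled, nsmul_eq_mul]
  rw [← Nat.choose_mul_factorial_mul_factorial hm]
  have h6 : (6 : ℝ) ^ S.card = 6 ^ m * 6 ^ (S.card - m) := by
    rw [← pow_add, Nat.add_sub_cancel' hm]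
  rw [h6]
  push_cast
  ring

variable {V : Type*} [DecidableEq V] [Fintype V] {S A B : Finset V}
  {L L₁ R D D₁ D₂ : Finset (V × Fin 3)} {σ : V × Fin 3 → V × Fin 3} {h a b c m : V × Fin 3}

theorem numNetworks_no_legs (S : Finset V) :
    (numNetworks S ∅ ∅ : ℝ) = labelled 1 S.card := by
  rcases S.eq_empty_or_nonempty with rfl | ⟨v, hv⟩
  · have : networks (∅ : Finset V) ∅ ∅ = {id} := by
      ext σ
      rw [mem_networks, Finset.mem_singleton]
      constructor
      · exact fun h => funext fun x => h.1.2 x (by simp [dom])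
      · rintro rfl
        refine ⟨⟨by simp [dom], by simp⟩, by simp [Rooted, dom], fun hm => ?_⟩
        obtain ⟨B, hB⟩ := SimpleGraph.hasMinor_iff_model.1 hm
        obtain ⟨x, hx, y, hy, hxy⟩ := hB.adj 0 1 (by simp)
        obtain ⟨hne, h, rfl, rfl⟩ := (closureGraph_adj (fun x => rfl)).1 hxy
        exact hne rfl
    simp [numNetworks, this, labelled]
  · have h0 : networks S ∅ ∅ = ∅ := by
      refine Finset.eq_empty_of_forall_notMem fun σ hσ => ?_
      obtain ⟨r, hr, -⟩ := (mem_networks.1 hσ).2.1 (v, 0) (mem_dom.2 (Or.inl hv))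
      simp at hr
    have h1 : S.card ≠ 0 := Finset.card_ne_zero_of_mem hv
    simp [numNetworks, h0, labelled, coeff_one, h1]

theorem reach_empty_iff (hσ : Function.Involutive σ) (hr : Reach ∅ σ a b) : b = a ∨ b = σ a := by
  refine (hr.mem_iff (X := {x | x = a ∨ x = σ a}) hσ ?_ ?_).1 (Or.inl rfl)
  · rintro x (rfl | rfl)
    · exact Or.inr rfl
    · exact Or.inl (hσ a)
  · simp

theorem SP_empty (hσ : Function.Involutive σ) : SP (∅ : Finset V) σ := fun hm => by
  obtain ⟨B, hB⟩ := SimpleGraph.hasMinor_iff_model.1 hm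
  obtain ⟨x, hx, y, hy, hxy⟩ := hB.adj 0 1 (by simp)
  obtain ⟨hne, h, rfl, rfl⟩ := (closureGraph_adj hσ).1 hxy
  exact hne (by simp [node])

theorem numNetworks_empty_one (a : V × Fin 3) : numNetworks ∅ {a} {a} = 0 := by
  rw [numNetworks, Finset.card_eq_zero]
  refine Finset.eq_empty_of_forall_notMem fun σ hσ => ?_
  have := (mem_networks.1 hσ).1.1 a (by simp [dom])
  simp only [dom, Finset.empty_product, Finset.empty_union, Finset.mem_singleton] at this
  exact this.2.2 this.1

theorem numNetworks_empty_two (hab : a ≠ b) : numNetworks ∅ {a, b} {a} = 1 := by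
  refine card_isMatching_pair hab _ fun σ => ?_
  have hd : dom ∅ {a, b} = {a, b} := by simp [dom]
  rw [mem_networks, hd]
  refine ⟨fun h => h.1, fun hm => ⟨hm, fun x hx => ⟨a, by simp, ?_⟩, SP_empty hm.involutive⟩⟩
  have ha := hm.1 a (by simp)
  simp only [Finset.mem_insert, Finset.mem_singleton] at ha
  rw [hd] at hx
  simp only [Finset.mem_insert, Finset.mem_singleton] at hx
  rcases hx with rfl | rfl
  · exact Reach.refl _
  · have h1 := ha.1.resolve_left ha.2.2
    have h2 := Reach.partner ∅ σ a
    rwa [h1] at h2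

theorem numNetworks_empty_three {P : Fin 3 → V × Fin 3} (hPi : Function.Injective P) :
    numNetworks ∅ (Finset.univ.image P) {P 0} = 0 := by
  rw [numNetworks, Finset.card_eq_zero]
  refine Finset.eq_empty_of_forall_notMem fun σ hσ => ?_
  obtain ⟨hm, hr, -⟩ := mem_networks.1 hσ
  have key : ∀ k, P k = P 0 ∨ P k = σ (P 0) := fun k => by
    obtain ⟨r, hr, h⟩ := hr (P k) (by simp [dom])
    rw [Finset.mem_singleton] at hr
    subst hr
    exact reach_empty_iff hm.involutive h
  have h1 := (key 1).resolve_left fun h => by simpa using hPi h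
  have h2 := (key 2).resolve_left fun h => by simpa using hPi h
  simpa using hPi (h1.trans h2.symm)

/-- The numbers of networks with at most `n` vertices and one, two or three legs are given by the
series `T`, `K` and `J`. -/
structure Counted (V : Type*) [DecidableEq V] [Fintype V] (T K J : PowerSeries ℝ) (n : ℕ) :
    Prop where
  one : ∀ (S : Finset V) (a : V × Fin 3), S.card ≤ n → a.1 ∉ S →
    (numNetworks S {a} {a} : ℝ) = labelled T S.card
  two : ∀ (S : Finset V) (a b : V × Fin 3), S.card ≤ n → a ≠ b → a.1 ∉ S → b.1 ∉ S →
    (numNetworks S {a, b} {a} : ℝ) = labelled K S.card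
  three : ∀ (S : Finset V) (P : Fin 3 → V × Fin 3), S.card ≤ n → Function.Injective P →
    (∀ k, (P k).1 ∉ S) → (numNetworks S (Finset.univ.image P) {P 0} : ℝ) = labelled J S.card

variable {T K J : PowerSeries ℝ} {n : ℕ}

theorem Counted.three' (H : Counted V T K J n) (hS : S.card ≤ n) (hab : a ≠ b) (hac : a ≠ c)
    (hbc : b ≠ c) (ha : a.1 ∉ S) (hb : b.1 ∉ S) (hc : c.1 ∉ S) :
    (numNetworks S {a, b, c} {a} : ℝ) = labelled J S.card := by
  have := H.three S ![a, b, c] hS (by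
    intro i j hij
    fin_cases i <;> fin_cases j <;> simp_all) (by intro k; fin_cases k <;> simpa)
  rw [← this]
  congr 2
  ext x
  simp [Fin.exists_fin_succ, eq_comm]

theorem sum_parts {f g : Finset V → ℕ} {F G : PowerSeries ℝ} (hf : ∀ A ⊆ S, (f A : ℝ) = labelled F A.card)
    (hg : ∀ A ⊆ S, (g A : ℝ) = labelled G A.card) :
    ((∑ A ∈ S.powerset, f A * g (S \ A) : ℕ) : ℝ) = labelled (F * G) S.card := by
  rw [← sum_powerset_labelled]
  push_cast
  refine Finset.sum_congr rfl fun A hA => ?_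
  rw [hf A (Finset.mem_powerset.1 hA), hg _ Finset.sdiff_subset]

theorem sum_networks {L₁ R₁ L₂ R₂ : Finset (V × Fin 3)} {F G : PowerSeries ℝ}
    (hf : ∀ A ⊆ S, (numNetworks A L₁ R₁ : ℝ) = labelled F A.card)
    (hg : ∀ A ⊆ S, (numNetworks A L₂ R₂ : ℝ) = labelled G A.card) :
    ((∑ A ∈ S.powerset, numNetworks A L₁ R₁ * numNetworks (S \ A) L₂ R₂ : ℕ) : ℝ) =
      labelled (F * G) S.card := by
  rw [← sum_powerset_labelled, Nat.cast_sum]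
  refine Finset.sum_congr rfl fun A hA => ?_
  rw [Nat.cast_mul, hf A (Finset.mem_powerset.1 hA), hg _ Finset.sdiff_subset]

/-- The component of `a` contains `b`, giving `K`, or it does not, giving `T ^ 2`. -/
theorem Counted.pair (H : Counted V T K J n) (hS : S.card ≤ n) (hab : a ≠ b) (ha : a.1 ∉ S)
    (hb : b.1 ∉ S) : (numNetworks S {a, b} {a, b} : ℝ) = labelled (K + T ^ 2) S.card := by
  have hA : ∀ A ⊆ S, A.card ≤ n := fun A h => (Finset.card_le_card h).trans hS
  have e : ({a, b} : Finset (V × Fin 3)).powerset.filter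
      (fun L₁ => a ∈ L₁ ∧ (L₁ ∩ {a, b}).Nonempty) = {{a}, {a, b}} := by
    ext L
    simp only [Finset.mem_filter, Finset.mem_powerset, Finset.mem_insert, Finset.mem_singleton]
    constructor
    · rintro ⟨h1, h2, -⟩
      by_cases hb : b ∈ L
      · right; ext x; have := @h1 x; grind
      · left; ext x; have := @h1 x; grind
    · rintro (rfl | rfl) <;> simp
  rw [numNetworks_split (l := a) (by simp [ha, hb]) (by simp) subset_rfl, e]
  have e1 : ({a, b} : Finset (V × Fin 3)) \ {a} = {b} := by grind
  have hne : ({a} : Finset (V × Fin 3)) ≠ {a, b} := fun h => by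
    have : b ∈ ({a} : Finset (V × Fin 3)) := h ▸ by simp
    simp [hab.symm] at this
  simp only [Finset.sum_pair hne, e1, Finset.sdiff_self, Finset.sum_add_distrib]
  rw [Nat.cast_add, sum_networks (F := T) (G := T), sum_networks (F := K) (G := 1), ← labelled_add]
  · congr 1; ring
  · exact fun A h => H.two A a b (hA A h) hab (fun h' => ha (h h')) (fun h' => hb (h h'))
  · exact fun A _ => numNetworks_no_legs A
  · exact fun A h => H.one A a (hA A h) (fun h' => ha (h h'))
  · exact fun A h => H.one A b (hA A h) (fun h' => hb (h h'))

theorem sdiff_triple (hab : a ≠ b) (hac : a ≠ c) (hbc : b ≠ c) :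
    ({a, b, c} : Finset (V × Fin 3)) \ {a} = {b, c} ∧
    ({a, b, c} : Finset (V × Fin 3)) \ {a, b} = {c} ∧
    ({a, b, c} : Finset (V × Fin 3)) \ {a, c} = {b} := by
  grind

/-- Since `a` is not a root, its component contains `b`, `c` or both. -/
theorem Counted.triple_two (H : Counted V T K J n) (hS : S.card ≤ n) (hab : a ≠ b) (hac : a ≠ c)
    (hbc : b ≠ c) (ha : a.1 ∉ S) (hb : b.1 ∉ S) (hc : c.1 ∉ S) :
    (numNetworks S {a, b, c} {b, c} : ℝ) = labelled (J + 2 * T * K) S.card := by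
  have hA : ∀ A ⊆ S, A.card ≤ n := fun A h => (Finset.card_le_card h).trans hS
  have e : ({a, b, c} : Finset (V × Fin 3)).powerset.filter
      (fun L₁ => a ∈ L₁ ∧ (L₁ ∩ {b, c}).Nonempty) = {{a, b}, {a, c}, {a, b, c}} := by
    ext L
    simp only [Finset.mem_filter, Finset.mem_powerset, Finset.mem_insert, Finset.mem_singleton]
    constructor
    · rintro ⟨h1, h2, x, hx⟩
      by_cases hb : b ∈ L <;> by_cases hc : c ∈ L
      · right; right; ext x; have := @h1 x; grind
      · left; ext x; have := @h1 x; grind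
      · right; left; ext x; have := @h1 x; grind
      · exfalso; grind
    · rintro (rfl | rfl | rfl)
      · exact ⟨by grind, by simp, b, by simp⟩
      · exact ⟨by grind, by simp, c, by simp⟩
      · exact ⟨by grind, by simp, b, by simp⟩
  rw [numNetworks_split (l := a) (by simp [ha, hb, hc]) (by simp) (by grind), e]
  obtain ⟨-, e1, e2⟩ := sdiff_triple hab hac hbc
  have e3 : ({b, c} : Finset (V × Fin 3)) \ {a, b} = {c} := by grind
  have e4 : ({b, c} : Finset (V × Fin 3)) \ {a, c} = {b} := by grind
  have e5 : ({b, c} : Finset (V × Fin 3)) \ {a, b, c} = ∅ := by grind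
  have n1 : ({a, b} : Finset (V × Fin 3)) ∉ ({{a, c}, {a, b, c}} : Finset (Finset (V × Fin 3))) := by
    intro h
    have : c ∈ ({a, b} : Finset (V × Fin 3)) := by
      rw [Finset.mem_insert, Finset.mem_singleton] at h
      rcases h with h | h <;> rw [h] <;> simp
    grind
  have n2 : ({a, c} : Finset (V × Fin 3)) ≠ {a, b, c} := fun h => by
    have : b ∈ ({a, c} : Finset (V × Fin 3)) := by rw [h]; simp
    grind
  simp only [Finset.sum_insert n1, Finset.sum_pair n2, e1, e2, e3, e4, e5, Finset.sdiff_self,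
    Finset.sum_add_distrib]
  rw [Nat.cast_add, Nat.cast_add, sum_networks (F := K) (G := T), sum_networks (F := K) (G := T),
    sum_networks (F := J) (G := 1), ← labelled_add, ← labelled_add]
  · congr 1; ring
  · exact fun A h => H.three' (hA A h) hab hac hbc (fun h' => ha (h h')) (fun h' => hb (h h'))
      (fun h' => hc (h h'))
  · exact fun A _ => numNetworks_no_legs A
  · exact fun A h => H.two A a c (hA A h) hac (fun h' => ha (h h')) (fun h' => hc (h h'))
  · exact fun A h => H.one A b (hA A h) (fun h' => hb (h h'))
  · exact fun A h => H.two A a b (hA A h) hab (fun h' => ha (h h')) (fun h' => hb (h h'))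
  · exact fun A h => H.one A c (hA A h) (fun h' => hc (h h'))

theorem Counted.triple_three (H : Counted V T K J n) (hS : S.card ≤ n) (hab : a ≠ b) (hac : a ≠ c)
    (hbc : b ≠ c) (ha : a.1 ∉ S) (hb : b.1 ∉ S) (hc : c.1 ∉ S) :
    (numNetworks S {a, b, c} {a, b, c} : ℝ) = labelled (J + 3 * T * K + T ^ 3) S.card := by
  have hA : ∀ A ⊆ S, A.card ≤ n := fun A h => (Finset.card_le_card h).trans hS
  have e : ({a, b, c} : Finset (V × Fin 3)).powerset.filter
      (fun L₁ => a ∈ L₁ ∧ (L₁ ∩ {a, b, c}).Nonempty) = {{a}, {a, b}, {a, c}, {a, b, c}} := by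
    ext L
    simp only [Finset.mem_filter, Finset.mem_powerset, Finset.mem_insert, Finset.mem_singleton]
    constructor
    · rintro ⟨h1, h2, -⟩
      by_cases hb : b ∈ L <;> by_cases hc : c ∈ L
      · right; right; right; ext x; have := @h1 x; grind
      · right; left; ext x; have := @h1 x; grind
      · right; right; left; ext x; have := @h1 x; grind
      · left; ext x; have := @h1 x; grind
    · rintro (rfl | rfl | rfl | rfl) <;> exact ⟨by grind, by simp, a, by simp⟩
  rw [numNetworks_split (l := a) (by simp [ha, hb, hc]) (by simp) subset_rfl, e]
  obtain ⟨e0, e1, e2⟩ := sdiff_triple hab hac hbc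
  have n0 : ({a} : Finset (V × Fin 3)) ∉
      ({{a, b}, {a, c}, {a, b, c}} : Finset (Finset (V × Fin 3))) := by
    intro h
    have : b ∈ ({a} : Finset (V × Fin 3)) ∨ c ∈ ({a} : Finset (V × Fin 3)) := by
      simp only [Finset.mem_insert, Finset.mem_singleton] at h
      rcases h with h | h | h <;> rw [h] <;> simp
    grind
  have n1 : ({a, b} : Finset (V × Fin 3)) ∉ ({{a, c}, {a, b, c}} : Finset (Finset (V × Fin 3))) := by
    intro h
    have : c ∈ ({a, b} : Finset (V × Fin 3)) := by
      rw [Finset.mem_insert, Finset.mem_singleton] at h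
      rcases h with h | h <;> rw [h] <;> simp
    grind
  have n2 : ({a, c} : Finset (V × Fin 3)) ≠ {a, b, c} := fun h => by
    have : b ∈ ({a, c} : Finset (V × Fin 3)) := by rw [h]; simp
    grind
  simp only [Finset.sum_insert n0, Finset.sum_insert n1, Finset.sum_pair n2, e0, e1, e2,
    Finset.sdiff_self, Finset.sum_add_distrib]
  rw [Nat.cast_add, Nat.cast_add, Nat.cast_add, sum_networks (F := T) (G := K + T ^ 2),
    sum_networks (F := K) (G := T), sum_networks (F := K) (G := T),
    sum_networks (F := J) (G := 1), ← labelled_add, ← labelled_add, ← labelled_add]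
  · congr 1; ring
  · exact fun A h => H.three' (hA A h) hab hac hbc (fun h' => ha (h h')) (fun h' => hb (h h'))
      (fun h' => hc (h h'))
  · exact fun A _ => numNetworks_no_legs A
  · exact fun A h => H.two A a c (hA A h) hac (fun h' => ha (h h')) (fun h' => hc (h h'))
  · exact fun A h => H.one A b (hA A h) (fun h' => hb (h h'))
  · exact fun A h => H.two A a b (hA A h) hab (fun h' => ha (h h')) (fun h' => hb (h h'))
  · exact fun A h => H.one A c (hA A h) (fun h' => hc (h h'))
  · exact fun A h => H.one A a (hA A h) (fun h' => ha (h h'))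
  · exact fun A h => H.pair (hA A h) hbc (fun h' => hb (h h')) (fun h' => hc (h h'))

theorem siblings_eq (h : V × Fin 3) : ∃ a b, a ≠ b ∧ a ≠ h ∧ b ≠ h ∧ a.1 = h.1 ∧ b.1 = h.1 ∧
    siblings h = {a, b} := by
  have key : ∀ i : Fin 3, ∃ j k : Fin 3, j ≠ k ∧ j ≠ i ∧ k ≠ i ∧ ∀ x, x = i ∨ x = j ∨ x = k := by
    decide
  obtain ⟨v, i⟩ := h
  obtain ⟨j, k, h1, h2, h3, h4⟩ := key i
  refine ⟨(v, j), (v, k), by simpa, by simpa, by simpa, rfl, rfl, ?_⟩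
  ext ⟨w, x⟩
  have := h4 x
  rw [mem_siblings]
  simp only [Finset.mem_insert, Finset.mem_singleton, Prod.mk.injEq, ne_eq]
  grind

/-- On `n + 1` vertices a leg has `3 (n + 1)` possible partners, while multiplication by `X`
accounts for `6 (n + 1)`; hence the factors `2` on the left of the first two equations. For three
legs there are `n + 1` centres and `6` permutations, which match `X` exactly. -/
theorem counted_succ (hT : 2 * T = X * (K + T ^ 2)) (hK : 2 * K = 2 + X * (2 * T * K + J))
    (hJ : J = X * K ^ 3) (H : Counted V T K J n) : Counted V T K J (n + 1) := by
  have key : ∀ (F G : PowerSeries ℝ), 2 * F = X * G → ∀ m, labelled F (m + 1) =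
      3 * (m + 1) * labelled G m := by
    intro F G h m
    have h1 := labelled_X_mul G m
    rw [← h, two_mul, labelled_add] at h1
    linarith
  have hpos : ∀ S : Finset V, S.card = n + 1 → S.Nonempty := fun S h =>
    Finset.card_pos.1 (by omega)
  refine ⟨fun S a hS ha => ?_, fun S a b hS hab ha hb => ?_, fun S P hS hPi hP => ?_⟩
  · rcases Nat.lt_or_ge n S.card with hlt | hle
    swap
    · exact H.one S a hle ha
    have hc : S.card = n + 1 := by omega
    rw [numNetworks_erase (m := a) (by simpa) (by simp) (by simp) (hpos S hc), hc, key T _ hT]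
    push_cast
    have : ∀ h ∈ S ×ˢ (Finset.univ : Finset (Fin 3)), (numNetworks (S.erase h.1)
        (({a} : Finset (V × Fin 3)).erase a ∪ siblings h) (siblings h) : ℝ) =
        labelled (K + T ^ 2) n := by
      intro h hh
      obtain ⟨x, y, hxy, -, -, hx, hy, e⟩ := siblings_eq h
      have hcard : (S.erase h.1).card = n := by
        rw [Finset.card_erase_of_mem (Finset.mem_product.1 hh).1, hc]; rfl
      rw [e, Finset.erase_singleton, Finset.empty_union, H.pair hcard.le hxy, hcard]
      · rw [hx]; simp
      · rw [hy]; simp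
    rw [Finset.sum_congr rfl this, Finset.sum_const, Finset.card_product, hc]
    simp only [nsmul_eq_mul, Finset.card_univ, Fintype.card_fin]
    push_cast
    ring
  · rcases Nat.lt_or_ge n S.card with hlt | hle
    swap
    · exact H.two S a b hle hab ha hb
    have hc : S.card = n + 1 := by omega
    have hK' : 2 * (K - 1) = X * (2 * T * K + J) := by linear_combination hK
    -- The constant term of `K` is the bare edge joining the two legs; it has no vertex to delete.
    have hK1 : labelled K (n + 1) = labelled (K - 1) (n + 1) := by
      simp [labelled, coeff_one]
    rw [numNetworks_erase (m := b) (by simp [ha, hb]) (by simp) (by simp) (hpos S hc), hc, hK1,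
      key _ _ hK']
    push_cast
    have : ∀ h ∈ S ×ˢ (Finset.univ : Finset (Fin 3)), (numNetworks (S.erase h.1)
        (({a, b} : Finset (V × Fin 3)).erase a ∪ siblings h) (siblings h) : ℝ) =
        labelled (2 * T * K + J) n := by
      intro h hh
      obtain ⟨x, y, hxy, -, -, hx, hy, e⟩ := siblings_eq h
      have hS' := (Finset.mem_product.1 hh).1
      have hcard : (S.erase h.1).card = n := by
        rw [Finset.card_erase_of_mem hS', hc]; rfl
      have e' : ({a, b} : Finset (V × Fin 3)).erase a ∪ {x, y} = {b, x, y} := by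
        ext z
        simp only [Finset.mem_union, Finset.mem_erase, Finset.mem_insert, Finset.mem_singleton]
        have : z = b → z ≠ a := fun h h' => hab (h'.symm.trans h)
        tauto
      have hb' : b.1 ≠ h.1 := fun h' => hb (h' ▸ hS')
      rw [e, e', H.triple_two hcard.le _ _ hxy, hcard, add_comm]
      · exact fun h => hb (Finset.mem_of_mem_erase h)
      · rw [hx]; simp
      · rw [hy]; simp
      · rintro rfl; exact hb' hx
      · rintro rfl; exact hb' hy
    rw [Finset.sum_congr rfl this, Finset.sum_const, Finset.card_product, hc]
    simp only [nsmul_eq_mul, Finset.card_univ, Fintype.card_fin]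
    push_cast
    ring
  · rcases Nat.lt_or_ge n S.card with hlt | hle
    swap
    · exact H.three S P hle hPi hP
    have hc : S.card = n + 1 := by omega
    rw [numNetworks_three hPi hP, hc, hJ, labelled_X_mul]
    rw [Nat.cast_sum]
    have : ∀ t ∈ S, ((∑ π : Equiv.Perm (Fin 3),
      ∑ A ∈ (S.erase t).powerset, ∑ B ∈ (S.erase t \ A).powerset,
        numNetworks A {P 0, (t, π 0)} {P 0} * (numNetworks B {P 1, (t, π 1)} {P 1} *
          numNetworks ((S.erase t \ A) \ B) {P 2, (t, π 2)} {P 2}) : ℕ) : ℝ) =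
        6 * labelled (K ^ 3) n := by
      intro t ht
      have hcard : (S.erase t).card = n := by
        rw [Finset.card_erase_of_mem ht, hc]; rfl
      have h2 : ∀ (k i : Fin 3), ∀ A ⊆ S.erase t,
          (numNetworks A {P k, (t, i)} {P k} : ℝ) = labelled K A.card := by
        intro k i A hA
        refine H.two A _ _ ((Finset.card_le_card hA).trans hcard.le) ?_ ?_ ?_
        · intro h
          have := hP k
          rw [h] at this
          exact this ht
        · exact fun h => hP k (Finset.mem_of_mem_erase (hA h))
        · exact fun h => by simpa using hA h
      have h3 : ∀ π : Equiv.Perm (Fin 3), ((∑ A ∈ (S.erase t).powerset,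
          ∑ B ∈ (S.erase t \ A).powerset, numNetworks A {P 0, (t, π 0)} {P 0} *
          (numNetworks B {P 1, (t, π 1)} {P 1} *
          numNetworks ((S.erase t \ A) \ B) {P 2, (t, π 2)} {P 2}) : ℕ) : ℝ) =
          labelled (K ^ 3) n := by
        intro π
        simp only [← Finset.mul_sum]
        rw [sum_parts (S := S.erase t) (F := K) (G := K * K)
          (f := fun A => numNetworks A {P 0, (t, π 0)} {P 0}) (g := fun C => ∑ B ∈ C.powerset, numNetworks B {P 1, (t, π 1)} {P 1} *
          numNetworks (C \ B) {P 2, (t, π 2)} {P 2}), hcard]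
        · congr 1; ring
        · exact h2 0 _
        · intro C hC
          exact sum_networks (fun A hA => h2 1 _ A (hA.trans hC)) (fun A hA => h2 2 _ A (hA.trans hC))
      rw [Nat.cast_sum, Finset.sum_congr rfl fun π _ => h3 π, Finset.sum_const, Finset.card_univ,
        Fintype.card_perm]
      simp [Nat.factorial]
    rw [Finset.sum_congr rfl this, Finset.sum_const, hc]
    rw [nsmul_eq_mul]
    push_cast
    ring

theorem counted (hT : 2 * T = X * (K + T ^ 2)) (hK : 2 * K = 2 + X * (2 * T * K + J))
    (hJ : J = X * K ^ 3) (n : ℕ) : Counted V T K J n := by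
  have hT0 : coeff 0 T = 0 := by
    have := congrArg (coeff 0) hT
    rw [two_mul, map_add, coeff_zero_X_mul] at this
    linarith
  have hK0 : coeff 0 K = 1 := by
    have := congrArg (coeff 0) hK
    rw [two_mul, map_add, map_add, coeff_zero_X_mul, ← one_add_one_eq_two, map_add,
      coeff_zero_one] at this
    linarith
  have hJ0 : coeff 0 J = 0 := by
    have := congrArg (coeff 0) hJ
    simpa using this
  induction n with
  | zero =>
    refine ⟨fun S a hS ha => ?_, fun S a b hS hab ha hb => ?_, fun S P hS hPi hP => ?_⟩ <;>
      obtain rfl := Finset.card_eq_zero.1 (Nat.le_zero.1 hS)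
    · rw [numNetworks_empty_one, labelled, Finset.card_empty, hT0]; simp
    · rw [numNetworks_empty_two hab, labelled, Finset.card_empty, hK0]; simp
    · rw [numNetworks_empty_three hPi, labelled, Finset.card_empty, hJ0]; simp
  | succ n ih => exact counted_succ hT hK hJ ih

end HalfEdge

/-! ### Closed graphs as networks around one vertex. -/

namespace HalfEdge

variable {V : Type*}

/-- The simple graph underlying the multigraph of a matching of all half-edges. -/
def matchGraph (σ : V × Fin 3 → V × Fin 3) : SimpleGraph V :=
  SimpleGraph.fromRel fun v w => ∃ h : V × Fin 3, h.1 = v ∧ (σ h).1 = w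

variable {σ : V × Fin 3 → V × Fin 3}

theorem matchGraph_adj (hσ : Function.Involutive σ) {v w : V} :
    (matchGraph σ).Adj v w ↔ v ≠ w ∧ ∃ h : V × Fin 3, h.1 = v ∧ (σ h).1 = w := by
  rw [matchGraph, SimpleGraph.fromRel_adj]
  refine and_congr_right fun _ => ⟨?_, Or.inl⟩
  rintro (h | ⟨h, h1, h2⟩)
  · exact h
  · exact ⟨σ h, h2, by rwa [hσ h]⟩

variable [DecidableEq V] [Fintype V]

/-- When only `v₀` lies outside, `none` simply stands for `v₀`; the left-over node `some v₀` is
isolated. -/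
theorem SP_erase_univ_iff (hσ : Function.Involutive σ) (v₀ : V) :
    SP (Finset.univ.erase v₀) σ ↔ ¬ (matchGraph σ).HasMinor (⊤ : SimpleGraph (Fin 4)) := by
  rw [SP, not_iff_not]
  constructor
  · intro h
    obtain ⟨B, hB⟩ := SimpleGraph.hasMinor_iff_model.1 h
    refine hB.push (fun x => x.getD v₀) ?_ ?_
    · intro a b hab
      obtain ⟨-, h, rfl, rfl⟩ := (closureGraph_adj hσ).1 hab
      have key : ∀ h : V × Fin 3, (node (Finset.univ.erase v₀) h).getD v₀ = h.1 := by
        intro h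
        unfold node
        split_ifs with h1
        · rfl
        · simpa [eq_comm] using h1
      rw [key, key, or_iff_not_imp_left]
      exact fun hne => (matchGraph_adj hσ).2 ⟨hne, h, rfl, rfl⟩
    · intro a b hab x hx y hy e
      have key : ∀ {a} {x : Option V}, x ∈ B a → ∀ v, x = some v → v ≠ v₀ := by
        rintro a _ hx v rfl
        simpa using mem_of_model hσ hB hx
      have hxy : x = y := by
        rcases x with _ | x <;> rcases y with _ | y
        · rfl
        · exact absurd e.symm (key hy y rfl)
        · exact absurd e (key hx x rfl)
        · exact congrArg some e
      subst hxy
      exact hab (hB.eq_of_mem hx hy)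
  · intro h
    obtain ⟨B, hB⟩ := SimpleGraph.hasMinor_iff_model.1 h
    refine hB.push (fun x => if x = v₀ then none else some x) ?_ ?_
    · intro a b hab
      obtain ⟨-, h, rfl, rfl⟩ := (matchGraph_adj hσ).1 hab
      have key : ∀ h : V × Fin 3, (if h.1 = v₀ then none else some h.1) =
          node (Finset.univ.erase v₀) h := by
        intro h
        unfold node
        simp only [Finset.mem_erase, Finset.mem_univ, and_true, ne_eq, ite_not]
      rw [key, key, or_iff_not_imp_left]
      exact fun hne => (closureGraph_adj hσ).2 ⟨hne, h, rfl, rfl⟩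
    · intro a b hab x hx y hy e
      have hxy : x = y := by grind
      subst hxy
      exact hab (hB.eq_of_mem hx hy)

/-- The half-edges at `v₀` are not linked to each other as siblings once `v₀` is removed. The graph
is connected exactly when every remaining component meets one of them, so all three are taken as
roots. -/
theorem rooted_erase_univ_iff (hσ : Function.Involutive σ) (v₀ : V) :
    Rooted (Finset.univ.erase v₀) ({v₀} ×ˢ Finset.univ) ({v₀} ×ˢ Finset.univ) σ ↔
      (matchGraph σ).Connected := by
  have hroot : ∀ r : V × Fin 3, r ∈ ({v₀} ×ˢ Finset.univ : Finset (V × Fin 3)) ↔ r.1 = v₀ := fun r => by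
    rw [Finset.mem_product, Finset.mem_singleton]
    simp
  constructor
  · intro hr
    have key : ∀ v, (matchGraph σ).Reachable v₀ v := by
      intro v
      obtain ⟨r, hr0, hr⟩ := hr (v, 0) (by
        rw [mem_dom, hroot, Finset.mem_erase]
        simp only [Finset.mem_univ, and_true]
        tauto)
      rw [hroot] at hr0
      refine (hr.mem_iff (X := {h | (matchGraph σ).Reachable v₀ h.1}) hσ ?_ ?_).1 ?_
      · intro h hh
        rw [Set.mem_ofPred_eq] at hh ⊢
        by_cases he : h.1 = (σ h).1
        · rwa [← he]
        · exact hh.trans ((matchGraph_adj hσ).2 ⟨he, h, rfl, rfl⟩).reachable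
      · intro h hh _ h' he
        rw [Set.mem_ofPred_eq] at hh ⊢
        rwa [he]
      · rw [Set.mem_ofPred_eq, hr0]
    have : Nonempty V := ⟨v₀⟩
    exact ⟨fun v w => (key v).symm.trans (key w)⟩
  · intro hc
    have key : ∀ v, (matchGraph σ).Reachable v₀ v → ∀ i, ∃ r : V × Fin 3, r.1 = v₀ ∧
        Reach (Finset.univ.erase v₀) σ r (v, i) := by
      rintro v ⟨p⟩
      induction p using SimpleGraph.Walk.concatRec with
      | Hnil => exact fun i => ⟨_, rfl, Reach.refl _⟩
      | @Hconcat u v w p hvw ih =>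
        intro i
        obtain ⟨-, h, rfl, rfl⟩ := (matchGraph_adj hσ).1 hvw
        obtain ⟨r, hr, hrh⟩ := ih hroot h.2
        by_cases hw : (σ h).1 = u
        · exact ⟨((σ h).1, i), hw, Reach.refl _⟩
        · exact ⟨r, hr, (hrh.trans (Reach.partner _ _ _)).trans
            (Reach.sibling (by simpa using hw) rfl)⟩
    rintro ⟨v, i⟩ -
    obtain ⟨r, hr, hrv⟩ := key v (hc.preconnected v₀ v) i
    exact ⟨r, (hroot r).2 hr, hrv⟩

theorem mem_networks_erase_univ (v₀ : V) :
    σ ∈ networks (Finset.univ.erase v₀) ({v₀} ×ˢ Finset.univ) ({v₀} ×ˢ Finset.univ) ↔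
      IsMatching Finset.univ σ ∧ (matchGraph σ).Connected ∧
        ¬ (matchGraph σ).HasMinor (⊤ : SimpleGraph (Fin 4)) := by
  have hd : dom (Finset.univ.erase v₀) ({v₀} ×ˢ Finset.univ) =
      (Finset.univ : Finset (V × Fin 3)) := by
    ext x
    simp only [mem_dom, Finset.mem_erase, Finset.mem_product, Finset.mem_singleton,
      Finset.mem_univ, and_true, iff_true]
    tauto
  rw [mem_networks, hd]
  refine and_congr_right fun hm => ?_
  rw [SP_erase_univ_iff hm.involutive, rooted_erase_univ_iff hm.involutive]

theorem Counted.card_closed {T K J : PowerSeries ℝ} {n : ℕ} (H : Counted V T K J n)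
    (hV : Fintype.card V = n + 1) (X : Finset (V × Fin 3 → V × Fin 3))
    (hX : ∀ σ, σ ∈ X ↔ IsMatching Finset.univ σ ∧ (matchGraph σ).Connected ∧
        ¬ (matchGraph σ).HasMinor (⊤ : SimpleGraph (Fin 4))) :
    (X.card : ℝ) = labelled (J + 3 * T * K + T ^ 3) n := by
  have : Nonempty V := Fintype.card_pos_iff.1 (by omega)
  obtain ⟨v₀⟩ := ‹Nonempty V›
  have hcard : (Finset.univ.erase v₀ : Finset V).card = n := by
    rw [Finset.card_erase_of_mem (Finset.mem_univ _), Finset.card_univ, hV]; rfl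
  have e : ({v₀} ×ˢ Finset.univ : Finset (V × Fin 3)) = {(v₀, 0), (v₀, 1), (v₀, 2)} := by
    ext ⟨v, i⟩
    rw [Finset.mem_product, Finset.mem_singleton]
    fin_cases i <;> simp
  have hXe : X = networks (Finset.univ.erase v₀) ({v₀} ×ˢ Finset.univ) ({v₀} ×ˢ Finset.univ) := by
    ext σ
    rw [hX, mem_networks_erase_univ]
  have := H.triple_three (a := (v₀, 0)) (b := (v₀, 1)) (c := (v₀, 2)) hcard.le (by simp) (by simp)
    (by simp) (by simp) (by simp) (by simp)
  rw [hXe, ← hcard, ← this, numNetworks, e]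

end HalfEdge

/-! ### The weight of a multigraph as a number of matchings. -/

namespace HalfEdge

variable {V : Type*} [LinearOrder V] [Fintype V] {a : V → V → ℕ} {σ : V × Fin 3 → V × Fin 3}

/-- The half-edges at `v`, sorted by the other end `w` of their edge, of a multigraph with adjacency
matrix `a` are numbered from `0` to `a v w - 1`. -/
abbrev Numbering (a : V → V → ℕ) : Type _ := ∀ v, Fin 3 ↪ Σ w, Fin (a v w)

namespace Numbering

def val (b : Numbering a) (h : V × Fin 3) : V × V × ℕ :=
  (h.1, (b h.1 h.2).1, (b h.1 h.2).2)

/-- The two halves of an edge between distinct vertices carry the same number; those of a loop carry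
`0` and `1`. -/
def flip (x : V × V × ℕ) : V × V × ℕ := (x.2.1, x.1, if x.1 = x.2.1 then 1 - x.2.2 else x.2.2)

/-- The edges of `σ` join half-edges with corresponding numbers. -/
def Compat (b : Numbering a) (σ : V × Fin 3 → V × Fin 3) : Prop := ∀ h, b.val (σ h) = flip (b.val h)

theorem sigma_fin_ext {v : V} {x y : Σ w, Fin (a v w)} (h1 : x.1 = y.1)
    (h2 : (x.2 : ℕ) = y.2) : x = y := by
  obtain ⟨x, i⟩ := x
  obtain ⟨y, j⟩ := y
  obtain rfl : x = y := h1
  exact congrArg _ (Fin.ext h2)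

theorem val_injective (b : Numbering a) : Function.Injective b.val := by
  rintro ⟨v, i⟩ ⟨v', i'⟩ h
  simp only [val, Prod.mk.injEq] at h
  obtain ⟨rfl, h1, h2⟩ := h
  exact congrArg _ ((b v).injective (sigma_fin_ext h1 h2))

theorem val_lt (b : Numbering a) (h : V × Fin 3) : (b.val h).2.2 < a (b.val h).1 (b.val h).2.1 :=
  (b h.1 h.2).2.isLt

theorem bijective (ha : ∀ v, ∑ w, a v w = 3) (b : Numbering a) (v : V) :
    Function.Bijective (b v) := by
  rw [Fintype.bijective_iff_injective_and_card]
  exact ⟨(b v).injective, by simp [Fintype.card_sigma, ha]⟩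

theorem exists_val (ha : ∀ v, ∑ w, a v w = 3) (b : Numbering a) {x : V × V × ℕ}
    (hx : x.2.2 < a x.1 x.2.1) : ∃ h, b.val h = x := by
  obtain ⟨v, w, j⟩ := x
  obtain ⟨i, hi⟩ := (bijective ha b v).2 ⟨w, j, hx⟩
  exact ⟨(v, i), Prod.ext rfl (Prod.ext (congrArg Sigma.fst hi)
    (congrArg (fun x : Σ w, Fin (a v w) => (x.2 : ℕ)) hi))⟩

theorem card (ha : ∀ v, ∑ w, a v w = 3) : Fintype.card (Numbering a) = 6 ^ Fintype.card V := by
  simp [Fintype.card_pi, Fintype.card_embedding_eq, Fintype.card_sigma, ha, Nat.descFactorial]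

theorem card_fiber (ha : ∀ v, ∑ w, a v w = 3) (b : Numbering a) (v w : V) :
    (Finset.univ.filter fun i => (b v i).1 = w).card = a v w := by
  have hb := bijective ha b v
  rw [← Fintype.card_fin (a v w), ← Finset.card_univ]
  symm
  refine Finset.card_bij (fun j _ => (Equiv.ofBijective _ hb).symm ⟨w, j⟩) ?_ ?_ ?_
  · intro j _
    rw [Finset.mem_filter]
    refine ⟨Finset.mem_univ _, ?_⟩
    have := (Equiv.ofBijective _ hb).apply_symm_apply ⟨w, j⟩
    rw [Equiv.ofBijective_apply] at this
    rw [this]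
  · intro j _ j' _ h
    simpa using h
  · intro i hi
    rw [Finset.mem_filter] at hi
    rcases hx : b v i with ⟨w', j⟩
    have : w' = w := by rw [← hi.2, hx]
    subst this
    refine ⟨j, Finset.mem_univ _, ?_⟩
    rw [Equiv.symm_apply_eq, Equiv.ofBijective_apply, hx]

end Numbering

/-- `σ` is a matching whose multigraph has adjacency matrix `a`, where loops count twice. -/
def IsMatchingOf (a : V → V → ℕ) (σ : V × Fin 3 → V × Fin 3) : Prop :=
  IsMatching Finset.univ σ ∧ ∀ v w, (Finset.univ.filter fun i => (σ (v, i)).1 = w).card = a v w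

namespace Numbering

theorem Compat.fst {b : Numbering a} (h : b.Compat σ) (x : V × Fin 3) :
    (b x.1 x.2).1 = (σ x).1 := (congrArg Prod.fst (h x)).symm

theorem existsUnique_compat (ha : ∀ v, ∑ w, a v w = 3) (hs : ∀ v w, a v w = a w v)
    (hl : ∀ v, a v v = 0 ∨ a v v = 2) (b : Numbering a) :
    ∃! σ, IsMatchingOf a σ ∧ b.Compat σ := by
  -- On the admissible triples `flip` is a fixed-point-free involution. For loops this needs `a v v
  -- = 2`, so that `j ↦ 1 - j` swaps `0` and `1`.
  have hf : ∀ x : V × V × ℕ, x.2.2 < a x.1 x.2.1 →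
      (flip x).2.2 < a (flip x).1 (flip x).2.1 ∧ flip (flip x) = x ∧ flip x ≠ x := by
    rintro ⟨v, w, j⟩ hj
    simp only [flip] at hj ⊢
    split_ifs with h1 h2 h2
    · subst h1
      have := hl v
      refine ⟨by omega, ?_, ?_⟩
      · simp only [Prod.mk.injEq, true_and]; omega
      · simp only [ne_eq, Prod.mk.injEq, true_and]; omega
    · exact absurd h1.symm h2
    · exact absurd h2.symm h1
    · refine ⟨hs v w ▸ hj, rfl, ?_⟩
      simp only [ne_eq, Prod.mk.injEq, not_and]
      exact fun h => absurd h.symm h1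
  choose σ hσ using fun h => exists_val ha b (hf _ (b.val_lt h)).1
  refine ⟨σ, ⟨⟨⟨fun h _ => ⟨Finset.mem_univ _, ?_, ?_⟩, fun h hh => absurd (Finset.mem_univ h) hh⟩,
    ?_⟩, hσ⟩, ?_⟩
  · apply b.val_injective
    rw [hσ, hσ, (hf _ (b.val_lt h)).2.1]
  · intro h'
    apply (hf _ (b.val_lt h)).2.2
    rw [← hσ, h']
  · intro v w
    rw [← card_fiber ha b v w]
    congr 1
    ext i
    have := Compat.fst hσ (v, i)
    simp only at this
    simp only [Finset.mem_filter, this]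
  · rintro σ' ⟨-, h⟩
    funext x
    apply b.val_injective
    rw [hσ, h]

variable (a) in
/-- A choice of numberings for all edge bundles of `σ`. -/
abbrev Bundles (σ : V × Fin 3 → V × Fin 3) : Type _ :=
  ∀ p : {p : V × V // p.1 ≤ p.2}, {i : Fin 3 // (σ (p.1.1, i)).1 = p.1.2} ↪ Fin (a p.1.1 p.1.2)

theorem card_bundles (hσ : IsMatchingOf a σ) :
    Fintype.card (Bundles a σ) = ∏ p : {p : V × V // p.1 ≤ p.2}, (a p.1.1 p.1.2).factorial := by
  rw [Fintype.card_pi]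
  refine Finset.prod_congr rfl fun p _ => ?_
  rw [Fintype.card_embedding_eq, Fintype.card_subtype, hσ.2, Fintype.card_fin,
    Nat.descFactorial_self]

def toBundles (b : {b : Numbering a // b.Compat σ}) : Bundles a σ := fun p =>
  ⟨fun i => ⟨(b.1 p.1.1 i).2, (b.1 p.1.1 i).2.isLt.trans_eq
    (congrArg _ ((b.2.fst (p.1.1, i.1)).trans i.2))⟩, fun i j h => Subtype.ext ((b.1 p.1.1).injective (sigma_fin_ext (by
      rw [b.2.fst (p.1.1, i.1), i.2, b.2.fst (p.1.1, j.1), j.2]) (congrArg Fin.val h)))⟩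

theorem toBundles_injective (hσ : IsMatchingOf a σ) :
    Function.Injective (toBundles (a := a) (σ := σ)) := by
  intro b b' h
  have h1 : ∀ x : V × Fin 3, x.1 ≤ (σ x).1 → b.1.val x = b'.1.val x := by
    intro x hx
    have := congrArg Fin.val (DFunLike.congr_fun (congrFun h ⟨(x.1, (σ x).1), hx⟩) ⟨x.2, rfl⟩)
    change ((b.1 x.1 x.2).2 : ℕ) = (b'.1 x.1 x.2).2 at this
    exact Prod.ext rfl (Prod.ext ((b.2.fst x).trans (b'.2.fst x).symm) this)
  have h2 : ∀ x : V × Fin 3, b.1.val x = b'.1.val x := by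
    intro x
    rcases le_total x.1 (σ x).1 with hx | hx
    · exact h1 x hx
    · have h3 := h1 (σ x) (by rwa [hσ.1.involutive])
      rw [b.2, b'.2] at h3
      have h4 := congrArg flip h3
      rw [← hσ.1.involutive x, b.2, b'.2, b.2, b'.2, h4]
  refine Subtype.ext (funext fun v => DFunLike.ext _ _ fun i => ?_)
  have := h2 (v, i)
  simp only [val, Prod.mk.injEq, true_and] at this
  exact sigma_fin_ext this.1 this.2

-- The value `0` off the relevant half-edges is a default; it avoids dependent types when bundles
-- are rewritten.
open Classical in
noncomputable def Bundles.eval (E : Bundles a σ) (v w : V) (i : Fin 3) : ℕ :=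
  if h : v ≤ w ∧ (σ (v, i)).1 = w then E ⟨(v, w), h.1⟩ ⟨i, h.2⟩ else 0

theorem Bundles.eval_eq (E : Bundles a σ) {v w : V} {i : Fin 3} (h1 : v ≤ w)
    (h2 : (σ (v, i)).1 = w) : E.eval v w i = E ⟨(v, w), h1⟩ ⟨i, h2⟩ := dif_pos ⟨h1, h2⟩

theorem Bundles.eval_lt (E : Bundles a σ) {v w : V} {i : Fin 3} (h1 : v ≤ w)
    (h2 : (σ (v, i)).1 = w) : E.eval v w i < a v w := by
  rw [E.eval_eq h1 h2]; exact Fin.isLt _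

theorem Bundles.eval_inj (E : Bundles a σ) {v w : V} {i j : Fin 3} (h1 : v ≤ w)
    (h2 : (σ (v, i)).1 = w) (h3 : (σ (v, j)).1 = w) (h : E.eval v w i = E.eval v w j) : i = j := by
  rw [E.eval_eq h1 h2, E.eval_eq h1 h3] at h
  exact congrArg Subtype.val ((E _).injective (Fin.ext h))

/-- The number of a half-edge in its bundle. -/
noncomputable def Bundles.label (E : Bundles a σ) (h : V × Fin 3) : ℕ :=
  if h.1 ≤ (σ h).1 then E.eval h.1 (σ h).1 h.2 else E.eval (σ h).1 h.1 (σ h).2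

/-- Numbers chosen for `v ≤ w` are copied to the other end of each edge. At a loop the two halves
get distinct numbers below `2`, so they are exchanged by `j ↦ 1 - j` automatically. -/
theorem toBundles_surjective (hs : ∀ v w, a v w = a w v) (hl : ∀ v, a v v = 0 ∨ a v v = 2)
    (hσ : IsMatchingOf a σ) : Function.Surjective (toBundles (a := a) (σ := σ)) := by
  intro E
  have hi := hσ.1.involutive
  have hlt : ∀ h, E.label h < a h.1 (σ h).1 := by
    intro h
    unfold Bundles.label
    split_ifs with h1
    · exact E.eval_lt h1 rfl
    · rw [hs]
      exact E.eval_lt (le_of_not_ge h1) (by rw [hi])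
  have hinj : ∀ v i j, (σ (v, i)).1 = (σ (v, j)).1 → E.label (v, i) = E.label (v, j) → i = j := by
    intro v i j hw hlab
    unfold Bundles.label at hlab
    simp only [← hw] at hlab
    split_ifs at hlab with h1
    · exact E.eval_inj h1 rfl hw.symm hlab
    · have h2 := E.eval_inj (le_of_not_ge h1) (by rw [hi])
        (by rw [hw, hi]) hlab
      have h3 := hi.injective (Prod.ext hw h2)
      exact congrArg Prod.snd h3
  let b : Numbering a := fun v => ⟨fun i => ⟨(σ (v, i)).1, E.label (v, i), hlt (v, i)⟩,
    fun i j h => hinj v i j (congrArg Sigma.fst h) (by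
      have := congrArg (fun x : Σ w, Fin (a v w) => (x.2 : ℕ)) h
      exact this)⟩
  have hb : b.Compat σ := by
    intro h
    have hval : ∀ h, b.val h = (h.1, (σ h).1, E.label h) := fun h => rfl
    rw [hval, hval, flip, hi]
    simp only [Prod.mk.injEq, true_and]
    by_cases he : h.1 = (σ h).1
    · rw [if_pos he]
      have h1 : E.label (σ h) ≠ E.label h := by
        intro h1
        have h2 := hinj h.1 (σ h).2 h.2
        have h3 : (h.1, (σ h).2) = σ h := Prod.ext he rfl
        rw [h3] at h2
        have h4 := h2 (by rw [hi]; exact he) h1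
        exact (hσ.1.1 h (Finset.mem_univ _)).2.2 (Prod.ext he.symm h4)
      have h2 := hlt h
      have h3 := hlt (σ h)
      rw [hi, ← he] at h3
      rw [← he] at h2
      have := hl h.1
      omega
    · rw [if_neg he]
      unfold Bundles.label
      rw [hi]
      rcases lt_or_gt_of_ne he with h1 | h1
      · rw [if_neg (not_le.2 h1), if_pos h1.le]
      · rw [if_pos h1.le, if_neg (not_le.2 h1)]
  refine ⟨⟨b, hb⟩, funext fun p => DFunLike.ext _ _ fun i => Fin.ext ?_⟩
  obtain ⟨⟨v, w⟩, hp⟩ := p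
  obtain ⟨i, hi⟩ := i
  obtain rfl : (σ (v, i)).1 = w := hi
  change E.label (v, i) = _
  unfold Bundles.label
  rw [if_pos hp, E.eval_eq hp rfl]

end Numbering

-- Double counting of compatible pairs: each of the `6 ^ |V|` numberings fits exactly one matching,
-- and each matching fits as many numberings as there are ways to number its edge bundles.
open scoped Classical in
theorem card_isMatchingOf (ha : ∀ v, ∑ w, a v w = 3) (hs : ∀ v w, a v w = a w v)
    (hl : ∀ v, a v v = 0 ∨ a v v = 2) (X : Finset (V × Fin 3 → V × Fin 3))
    (hX : ∀ σ, σ ∈ X ↔ IsMatchingOf a σ) :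
    X.card * ∏ p : {p : V × V // p.1 ≤ p.2}, (a p.1.1 p.1.2).factorial = 6 ^ Fintype.card V := by
  rw [← Numbering.card ha, ← Finset.card_univ, ← mul_one (Finset.univ.card)]
  refine Finset.card_mul_eq_card_mul (fun σ (b : Numbering a) => b.Compat σ) ?_ ?_
  · intro σ hσ
    rw [hX] at hσ
    rw [← Numbering.card_bundles hσ, Finset.bipartiteAbove, ← Fintype.card_subtype]
    exact Fintype.card_of_bijective
      ⟨Numbering.toBundles_injective hσ, Numbering.toBundles_surjective hs hl hσ⟩
  · intro b _
    obtain ⟨σ, hσ, hu⟩ := Numbering.existsUnique_compat ha hs hl b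
    rw [Finset.card_eq_one]
    refine ⟨σ, ?_⟩
    ext σ'
    rw [Finset.mem_bipartiteBelow, hX, Finset.mem_singleton]
    exact ⟨hu σ', by rintro rfl; exact hσ⟩

end HalfEdge

/-! ### From matchings back to weighted multigraphs. -/

namespace VMultigraph

open HalfEdge

variable {V : Type*} [LinearOrder V] [Fintype V] {G G' : VMultigraph V}
  {σ : V × Fin 3 → V × Fin 3}

/-- The adjacency matrix; loops count twice. -/
def adjacency (G : VMultigraph V) (v w : V) : ℕ := G s(v, w) + if v = w then G s(v, w) else 0

theorem adjacency_comm (G : VMultigraph V) (v w : V) : G.adjacency v w = G.adjacency w v := by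
  rw [adjacency, adjacency, Sym2.eq_swap]
  simp only [eq_comm]

theorem IsCubic.sum_adjacency (hG : G.IsCubic) (v : V) : ∑ w, G.adjacency v w = 3 := by
  rw [← hG v, degree]
  simp [adjacency, Finset.sum_add_distrib]

theorem IsCubic.adjacency_le (hG : G.IsCubic) (v w : V) : G.adjacency v w ≤ 3 := by
  rw [← hG.sum_adjacency v]
  exact Finset.single_le_sum (f := fun w => G.adjacency v w) (fun _ _ => Nat.zero_le _)
    (Finset.mem_univ w)

theorem IsCubic.adjacency_self (hG : G.IsCubic) (v : V) :
    G.adjacency v v = 0 ∨ G.adjacency v v = 2 := by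
  have := hG.adjacency_le v v
  simp only [adjacency, if_true] at this ⊢
  omega

theorem adjacency_injective : Function.Injective (adjacency : VMultigraph V → V → V → ℕ) := by
  intro G G' h
  funext e
  induction e using Sym2.ind with
  | _ v w =>
    have := congrFun (congrFun h v) w
    simp only [adjacency] at this
    split_ifs at this <;> omega

/-- The numbers of half-edges of adjacent ends determine a multigraph. -/
theorem exists_isMatchingOf (hσ : IsMatching Finset.univ σ) :
    ∃ G : VMultigraph V, IsMatchingOf G.adjacency σ := by
  let c : V → V → ℕ := fun v w => (Finset.univ.filter fun i => (σ (v, i)).1 = w).card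
  have hi := hσ.involutive
  have hc : ∀ v w, c v w ≤ c w v := by
    intro v w
    refine Finset.card_le_card_of_injOn (fun i => (σ (v, i)).2) ?_ ?_
    · intro i h
      simp only [Finset.coe_filter, Finset.mem_univ, true_and, Set.mem_ofPred_eq] at h ⊢
      rw [← h, hi]
    · intro i h j h' e
      simp only [Finset.coe_filter, Finset.mem_univ, true_and, Set.mem_ofPred_eq] at h h'
      have := hi.injective (Prod.ext (h.trans h'.symm) e)
      exact congrArg Prod.snd this
  have heven : ∀ v, 2 ∣ c v v := by
    intro v
    -- A set with a fixed-point-free involution has even cardinality; this makes halving the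
    -- diagonal entry legitimate.
    have key : ∀ (f : Fin 3 → Fin 3) (s : Finset (Fin 3)),
        (∀ i ∈ s, f i ∈ s ∧ f (f i) = i ∧ f i ≠ i) → 2 ∣ s.card := by decide
    refine key (fun i => (σ (v, i)).2) _ fun i h => ?_
    simp only [Finset.mem_filter, Finset.mem_univ, true_and] at h ⊢
    have e : (v, (σ (v, i)).2) = σ (v, i) := Prod.ext h.symm rfl
    rw [e, hi]
    refine ⟨rfl, rfl, fun h' => (hσ.1 (v, i) (Finset.mem_univ _)).2.2 (Prod.ext h h')⟩
  refine ⟨Sym2.lift ⟨fun v w => if v = w then c v w / 2 else c v w, fun v w => ?_⟩, hσ,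
    fun v w => ?_⟩
  · have h1 := hc v w
    have h2 := hc w v
    have h3 : c v w = c w v := le_antisymm h1 h2
    simp only [h3, eq_comm]
  · change c v w = _
    simp only [adjacency, Sym2.lift_mk]
    split_ifs with h
    · subst h
      have := heven v
      omega
    · rfl

theorem matchGraph_eq_toSimple (hσ : IsMatchingOf G.adjacency σ) : matchGraph σ = G.toSimple := by
  ext v w
  rw [matchGraph_adj hσ.1.involutive]
  refine and_congr_right fun hvw => ?_
  have h := hσ.2 v w
  rw [adjacency, if_neg hvw, add_zero] at h
  rw [← h, Finset.card_pos]
  constructor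
  · rintro ⟨⟨x, i⟩, rfl, h'⟩
    exact ⟨i, by simpa using h'⟩
  · rintro ⟨i, hi⟩
    exact ⟨(v, i), rfl, by simpa using hi⟩

theorem isCubic_of_isMatchingOf (hσ : IsMatchingOf G.adjacency σ) : G.IsCubic := by
  intro v
  have h1 : G.degree v = ∑ w, G.adjacency v w := by
    simp [adjacency, Finset.sum_add_distrib, degree]
  rw [h1, ← Finset.sum_congr rfl fun w _ => hσ.2 v w,
    ← Finset.card_eq_sum_card_fiberwise (t := Finset.univ) (f := fun i => (σ (v, i)).1)
    (fun _ _ => Finset.mem_univ _)]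
  simp

/-- Loops count twice in the adjacency matrix, so a loop contributes `2!`, as does a double edge,
and a triple edge contributes `3!`. -/
theorem IsCubic.prod_factorial (hG : G.IsCubic) :
    ((∏ p : {p : V × V // p.1 ≤ p.2}, (G.adjacency p.1.1 p.1.2).factorial : ℕ) : ℝ) =
      G.weight⁻¹ := by
  let f : Sym2 V → ℕ := fun e => (if e.IsDiag then 2 * G e else G e).factorial
  have h1 : ∏ p : {p : V × V // p.1 ≤ p.2}, (G.adjacency p.1.1 p.1.2).factorial = ∏ e, f e := by
    rw [← Equiv.prod_comp Sym2.sortEquiv.symm f]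
    refine Finset.prod_congr rfl fun p _ => ?_
    rw [Sym2.sortEquiv_symm_apply]
    simp only [f, adjacency, Sym2.mk_isDiag_iff]
    split_ifs
    · rw [two_mul]
    · rw [add_zero]
  have h2 : ∏ e ∈ Finset.univ.filter (fun e : Sym2 V => e.IsDiag), f e = 2 ^ G.numLoops := by
    rw [numLoops, ← Finset.prod_pow_eq_pow_sum]
    symm
    refine Finset.prod_bij (fun v _ => s(v, v)) ?_ ?_ ?_ ?_
    · simp
    · simp
    · intro e he
      induction e using Sym2.ind with
      | _ v w =>
        simp only [Finset.mem_filter, Sym2.mk_isDiag_iff, Finset.mem_univ, true_and] at he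
        exact ⟨v, Finset.mem_univ _, by rw [he]⟩
    · intro v _
      have := hG.adjacency_le v v
      simp only [adjacency, if_true] at this
      simp only [f, Sym2.mk_isDiag_iff, if_true]
      have h : G s(v, v) = 0 ∨ G s(v, v) = 1 := by omega
      rcases h with h | h <;> simp [h]
  have h3 : ∏ e ∈ Finset.univ.filter (fun e : Sym2 V => ¬ e.IsDiag), f e =
      2 ^ G.numMultiple 2 * 6 ^ G.numMultiple 3 := by
    have h4 : ∀ m x : ℕ, x ^ G.numMultiple m =
        ∏ e ∈ Finset.univ.filter (fun e : Sym2 V => ¬ e.IsDiag), if G e = m then x else 1 := by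
      intro m x
      rw [numMultiple, Finset.prod_ite, Finset.prod_const, Finset.prod_const_one, mul_one,
        Finset.filter_filter]
    rw [h4, h4, ← Finset.prod_mul_distrib]
    refine Finset.prod_congr rfl fun e he => ?_
    induction e using Sym2.ind with
    | _ v w =>
      simp only [Finset.mem_filter, Sym2.mk_isDiag_iff, Finset.mem_univ, true_and] at he
      have := hG.adjacency_le v w
      rw [adjacency, if_neg he, add_zero] at this
      simp only [f, Sym2.mk_isDiag_iff, if_neg he]
      have h : G s(v, w) = 0 ∨ G s(v, w) = 1 ∨ G s(v, w) = 2 ∨ G s(v, w) = 3 := by omega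
      rcases h with h | h | h | h <;> simp [h, Nat.factorial]
  rw [h1, ← Finset.prod_filter_mul_prod_filter_not Finset.univ (fun e : Sym2 V => e.IsDiag), h2, h3,
    weight, inv_inv]
  push_cast
  ring

open scoped Classical in
theorem IsCubic.card_isMatchingOf (hG : G.IsCubic) :
    ((Finset.univ.filter fun σ => IsMatchingOf G.adjacency σ).card : ℝ) =
      6 ^ Fintype.card V * G.weight := by
  have h := HalfEdge.card_isMatchingOf hG.sum_adjacency (adjacency_comm G) hG.adjacency_self
    (Finset.univ.filter fun σ => IsMatchingOf G.adjacency σ) (by simp)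
  have hw : G.weight ≠ 0 := by
    rw [weight]
    positivity
  have h' := congrArg (Nat.cast : ℕ → ℝ) h
  rw [Nat.cast_mul, hG.prod_factorial] at h'
  push_cast at h'
  field_simp at h'
  rw [h', mul_comm]

/-- The connected `K₄`-minor-free matchings are grouped by their multigraph, and each group has size
`6 ^ (2 * k) * weight`. The right side has index `n = 2 * k - 1` because one vertex is removed. -/
theorem g_eq_labelled {T K J : PowerSeries ℝ} {n k : ℕ} (H : Counted (Fin (2 * k)) T K J n)
    (hk : 2 * k = n + 1) :
    g k * ((2 * k).factorial * 6 ^ (2 * k)) = labelled (J + 3 * T * K + T ^ 3) n := by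
  classical
  rw [← H.card_closed (by simpa) (Finset.univ.filter fun σ => IsMatching Finset.univ σ ∧
    (matchGraph σ).Connected ∧ ¬ (matchGraph σ).HasMinor (⊤ : SimpleGraph (Fin 4))) (by simp),
    card_eq_sum_of_existsUnique _ (cubicSP_finite (2 * k) k).toFinset
      (fun (G : VMultigraph (Fin (2 * k))) σ => IsMatchingOf G.adjacency σ)]
  · have h0 : ((2 * k).factorial : ℝ) ≠ 0 := by positivity
    rw [g, ← mul_assoc, div_mul_cancel₀ _ h0, Finset.sum_mul, Nat.cast_sum]
    refine Finset.sum_congr rfl fun G hG => ?_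
    rw [Set.Finite.mem_toFinset] at hG
    have h1 := hG.2.1.card_isMatchingOf
    rw [Fintype.card_fin] at h1
    rw [mul_comm, ← h1]
    congr 2
    ext σ
    simp only [Finset.mem_filter, Finset.mem_univ, true_and]
    refine ⟨fun h => ⟨⟨h.1, ?_⟩, h⟩, fun h => h.2⟩
    rw [matchGraph_eq_toSimple h]
    exact ⟨hG.1, hG.2.2.1⟩
  · intro σ hσ
    simp only [Finset.mem_filter, Finset.mem_univ, true_and] at hσ
    obtain ⟨hm, h1, h2⟩ := hσ
    obtain ⟨G, hG⟩ := exists_isMatchingOf hm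
    refine ⟨G, ⟨?_, hG⟩, fun G' hG' => ?_⟩
    · rw [Set.Finite.mem_toFinset]
      rw [matchGraph_eq_toSimple hG] at h1 h2
      have hc := isCubic_of_isMatchingOf hG
      exact ⟨h1, hc, h2, (hc.excess_eq_iff k).2 (by simp)⟩
    · refine adjacency_injective ?_
      funext v w
      rw [← hG.2, ← hG'.2.2]

end VMultigraph

/-! ### Lagrange inversion. -/

namespace PowerSeries

variable {𝕜 : Type*} [Field 𝕜] [CharZero 𝕜] {φ ψ : 𝕜⟦X⟧}

/-- This is the residue of `ψ' / ψ ^ (n + 1)`, which is a derivative unless `n = 0`. Formally, `ψ' φ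
= 1 - ψ φ'` turns it into `φ ^ n - X φ' φ ^ (n - 1)`, whose coefficient of degree `n` vanishes by
the rule for `(φ ^ n)'`. -/
theorem coeff_derivative_mul_pow (h : ψ * φ = X) (n : ℕ) (hψ : constantCoeff ψ = 0) :
    coeff n (d⁄dX 𝕜 ψ * φ ^ (n + 1)) = if n = 0 then 1 else 0 := by
  have hd : d⁄dX 𝕜 ψ * φ + ψ * d⁄dX 𝕜 φ = 1 := by
    have := congrArg (d⁄dX 𝕜) h
    rw [Derivation.leibniz, derivative_X, smul_eq_mul, smul_eq_mul] at this
    rw [← this]; ring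
  rcases n with _ | n
  · have := congrArg (coeff 0) hd
    simpa [hψ] using this
  · have h1 : d⁄dX 𝕜 ψ * φ ^ (n + 1 + 1) = φ ^ (n + 1) - X * (d⁄dX 𝕜 φ * φ ^ n) := by
      linear_combination φ ^ (n + 1) * hd - d⁄dX 𝕜 φ * φ ^ n * h
    have h2 : d⁄dX 𝕜 (φ ^ (n + 1)) = C ((n : 𝕜) + 1) * (d⁄dX 𝕜 φ * φ ^ n) := by
      rw [derivative_pow]
      simp only [map_add, map_natCast, map_one, Nat.add_sub_cancel]
      push_cast
      ring
    have h3 := congrArg (coeff n) h2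
    rw [coeff_derivative, coeff_C_mul] at h3
    have h4 : ((n : 𝕜) + 1) ≠ 0 := by exact_mod_cast n.succ_ne_zero
    rw [h1, map_sub, coeff_succ_X_mul, if_neg n.succ_ne_zero]
    have h5 : ((n : 𝕜) + 1) * (coeff (n + 1) (φ ^ (n + 1)) - coeff n (d⁄dX 𝕜 φ * φ ^ n)) = 0 := by
      rw [mul_sub, ← h3]; ring
    exact (mul_eq_zero.1 h5).resolve_left h4

/-- Change of variables in a residue: after the constant term of `F` is split off, `ψ * φ = X`
lowers the degree by one. -/
theorem coeff_subst_mul_derivative (h : ψ * φ = X) (hψ : constantCoeff ψ = 0) (n : ℕ)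
    (F : 𝕜⟦X⟧) : coeff n (F.subst ψ * d⁄dX 𝕜 ψ * φ ^ (n + 1)) = coeff n F := by
  have hs : HasSubst ψ := HasSubst.of_constantCoeff_zero' hψ
  induction n generalizing F with
  | zero =>
    have h1 := coeff_derivative_mul_pow h 0 hψ
    obtain ⟨G, hG⟩ : ∃ G, F = C (coeff 0 F) + X * G := ⟨mk fun p => coeff (p + 1) F, by
      rw [add_comm, coeff_zero_eq_constantCoeff_apply]; exact eq_X_mul_shift_add_const F⟩
    have h2 : F.subst ψ = C (coeff 0 F) + ψ * G.subst ψ := by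
      conv_lhs => rw [hG]
      rw [subst_add hs, subst_mul hs, subst_X hs, subst_C]
      rfl
    rw [if_pos rfl] at h1
    have h3 : (C (coeff 0 F) + ψ * G.subst ψ) * d⁄dX 𝕜 ψ * φ ^ (0 + 1) =
        C (coeff 0 F) * (d⁄dX 𝕜 ψ * φ ^ (0 + 1)) + ψ * (G.subst ψ * d⁄dX 𝕜 ψ * φ) := by
      ring
    rw [h2, h3, map_add, coeff_C_mul, h1]
    simp [hψ]
  | succ n ih =>
    have h1 := coeff_derivative_mul_pow h (n + 1) hψ
    obtain ⟨G, hG⟩ : ∃ G, F = C (coeff 0 F) + X * G := ⟨mk fun p => coeff (p + 1) F, by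
      rw [add_comm, coeff_zero_eq_constantCoeff_apply]; exact eq_X_mul_shift_add_const F⟩
    have h2 : F.subst ψ = C (coeff 0 F) + ψ * G.subst ψ := by
      conv_lhs => rw [hG]
      rw [subst_add hs, subst_mul hs, subst_X hs, subst_C]
      rfl
    have h3 : (C (coeff 0 F) + ψ * G.subst ψ) * d⁄dX 𝕜 ψ * φ ^ (n + 1 + 1) =
        C (coeff 0 F) * (d⁄dX 𝕜 ψ * φ ^ (n + 1 + 1)) +
          X * (G.subst ψ * d⁄dX 𝕜 ψ * φ ^ (n + 1)) := by
      rw [← h]; ring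
    rw [h2, h3, map_add, coeff_C_mul, h1, coeff_succ_X_mul, ih]
    conv_rhs => rw [hG]
    simp

/-- Lagrange inversion. -/
theorem coeff_eq_of_subst_eq (h : ψ * φ = X) (hψ : constantCoeff ψ = 0) {F f : 𝕜⟦X⟧}
    (hF : F.subst ψ = f) (n : ℕ) :
    coeff n (d⁄dX 𝕜 f * φ ^ (n + 1)) = (n + 1) * coeff (n + 1) F := by
  rw [← hF, derivative_subst (HasSubst.of_constantCoeff_zero' hψ),
    coeff_subst_mul_derivative h hψ, coeff_derivative]
  ring

end PowerSeries

/-! ### Rational parametrisation of the counting series. -/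

namespace VMultigraph

open PowerSeries HalfEdge

/-- The series `3 - r ^ 2`. -/
noncomputable def serN : PowerSeries ℝ := 3 - X ^ 2

/-- The series `(1 - r) * (3 - r)`. -/
noncomputable def serD : PowerSeries ℝ := (1 - X) * (3 - X)

/-- The series `φ` such that the networks are parametrised by `u = r / φ(r)`. -/
noncomputable def serPhi : PowerSeries ℝ := C (1 / 4) * serN ^ 3 * serD⁻¹ ^ 2

/-- The series of the networks with two legs in terms of the parameter. -/
noncomputable def serA : PowerSeries ℝ := serN * serD⁻¹

/-- The series of the networks with one leg in terms of the parameter. -/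
noncomputable def serW : PowerSeries ℝ := 2 * X * (1 - X) * serN⁻¹

theorem constantCoeff_serN : constantCoeff serN = 3 := by
  rw [serN, map_sub, map_pow, constantCoeff_X, map_ofNat]; norm_num

theorem constantCoeff_serD : constantCoeff serD = 3 := by
  rw [serD, map_mul, map_sub, map_sub, constantCoeff_X, map_ofNat, map_one]; norm_num

theorem serN_mul_inv : serN * serN⁻¹ = 1 :=
  PowerSeries.mul_inv_cancel _ (by rw [constantCoeff_serN]; norm_num)

theorem serD_mul_inv : serD * serD⁻¹ = 1 :=
  PowerSeries.mul_inv_cancel _ (by rw [constantCoeff_serD]; norm_num)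

/-- The series `u = r / φ(r)`. With `s = 1 - W` the first equation reads `uK = 1 - s²`, and the
second becomes `(1 - s²) K² - 2sK + 2 = 0`, with discriminant `4 (3s² - 2)`. The conic `q² = 3s² -
2` through `(1, 1)` is parametrised by `s = (3 - 2r + r²) / (3 - r²)`, `q = (3 - 6r + r²) / (3 -
r²)`; then `K = (s - q) / (1 - s²)`. -/
noncomputable def serPsi : PowerSeries ℝ := 4 * X * serD ^ 2 * serN⁻¹ ^ 3

theorem C_quarter : (4 : PowerSeries ℝ) * C (1 / 4) = 1 := by
  rw [← map_ofNat (C (R := ℝ)) 4, ← map_mul]; norm_num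

theorem serPsi_mul_serPhi : serPsi * serPhi = X := by
  have h1 : serPsi * serPhi = X * (4 * C (1 / 4)) * (serN * serN⁻¹) ^ 3 * (serD * serD⁻¹) ^ 2 := by
    rw [serPsi, serPhi]; ring
  rw [h1, C_quarter, serN_mul_inv, serD_mul_inv]; ring

theorem constantCoeff_serPsi : constantCoeff serPsi = 0 := by
  simp [serPsi]

theorem coeff_one_serPsi : coeff 1 serPsi = 4 / 3 := by
  have h : serPsi = X * (4 * serD ^ 2 * serN⁻¹ ^ 3) := by rw [serPsi]; ring
  have h0 := coeff_succ_X_mul 0 (4 * serD ^ 2 * serN⁻¹ ^ 3)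
  rw [← h, zero_add] at h0
  rw [h0, coeff_zero_eq_constantCoeff, map_mul,
    map_mul, map_pow, map_pow, constantCoeff_serD, constantCoeff_inv, constantCoeff_serN, map_ofNat]
  norm_num

theorem serW_eq : 2 * serW = serW ^ 2 + serPsi * serA := by
  have hN := serN_mul_inv
  have hD := serD_mul_inv
  have h1 : serPsi * serA = 4 * X * serD * serN⁻¹ ^ 2 * (serN * serN⁻¹) * (serD * serD⁻¹) := by
    rw [serPsi, serA]; ring
  rw [h1, hN, hD, serW]
  have h2 : 2 * (2 * X * (1 - X) * serN⁻¹) = 4 * X * (1 - X) * serN * serN⁻¹ ^ 2 := by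
    linear_combination (- 4 * X * (1 - X) * serN⁻¹) * hN
  rw [h2, serN, serD]
  ring

theorem serA_eq : 2 * serA = 2 + 2 * serA * serW + serPsi * serA ^ 3 := by
  have hN := serN_mul_inv
  have hD := serD_mul_inv
  have h1 : serPsi * serA ^ 3 = 4 * X * serD⁻¹ * (serN * serN⁻¹) ^ 3 * (serD * serD⁻¹) ^ 2 := by
    rw [serPsi, serA]; ring
  have h2 : 2 * serA * serW = 4 * X * (1 - X) * serD⁻¹ * (serN * serN⁻¹) := by
    rw [serW, serA]; ring
  rw [h1, h2, hN, hD, serA]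
  have h3 : (2 : PowerSeries ℝ) = 2 * serD * serD⁻¹ := by linear_combination -2 * hD
  nth_rw 2 [h3]
  rw [serN, serD]
  ring

theorem derivative_serW : d⁄dX ℝ serW = 2 * (3 - 6 * X + X ^ 2) * serN⁻¹ ^ 2 := by
  have hN := serN_mul_inv
  have h1 : serW * serN = 2 * X * (1 - X) := by
    rw [serW]; linear_combination 2 * X * (1 - X) * hN
  have h2 := congrArg (d⁄dX ℝ) h1
  have h3 : d⁄dX ℝ serN = - 2 * X := by
    rw [serN, map_sub, derivative_pow, derivative_X, ← map_ofNat (C (R := ℝ)) 3, derivative_C]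
    push_cast; ring
  have h4 : d⁄dX ℝ (2 * X * (1 - X) : PowerSeries ℝ) = 2 - 4 * X := by
    rw [show (2 * X * (1 - X) : PowerSeries ℝ) = C 2 * X - C 2 * X ^ 2 by
      rw [map_ofNat]; ring, map_sub, Derivation.leibniz, Derivation.leibniz, derivative_pow,
      derivative_X, derivative_C, map_ofNat]
    simp only [smul_eq_mul]
    push_cast; ring
  rw [Derivation.leibniz, h3, h4, smul_eq_mul, smul_eq_mul] at h2
  have h5 : d⁄dX ℝ serW * serN ^ 2 = 2 * (3 - 6 * X + X ^ 2) := by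
    have h6 : d⁄dX ℝ serW * serN ^ 2 = (2 - 4 * X) * serN + 2 * X * (serW * serN) := by
      linear_combination serN * h2
    rw [h6, h1, serN]; ring
  linear_combination serN⁻¹ ^ 2 * h5 - d⁄dX ℝ serW * (1 + serN * serN⁻¹) * hN

/-- The counting series of the networks, by the number of pairs of vertices. -/
theorem exists_network_series : ∃ K W : PowerSeries ℝ, 2 * W = W ^ 2 + X * K ∧
    2 * K = 2 + 2 * K * W + X * K ^ 3 ∧ coeff 0 W = 0 ∧
    ∀ n : ℕ, ((n : ℝ) + 1) * coeff (n + 1) W = coeff n (d⁄dX ℝ serW * serPhi ^ (n + 1)) := by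
  have hu : IsUnit (coeff 1 serPsi) := by rw [coeff_one_serPsi]; norm_num
  have hs : HasSubst serPsi := HasSubst.of_constantCoeff_zero' constantCoeff_serPsi
  set ρ := serPsi.substInvOfIsUnit hu with hρdef
  have hρ : HasSubst ρ := HasSubst.substInvOfIsUnit _ hu
  have h1 : serPsi.subst ρ = X := subst_substInvOfIsUnit_right _ constantCoeff_serPsi hu
  have h2 : ρ.subst serPsi = X := subst_substInvOfIsUnit_left _ constantCoeff_serPsi hu
  -- Substituting the compositional inverse `ρ` for the parameter turns `serPsi` into `X`, and the
  -- identities in `r` into the system for `K` and `W`.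
  have hW := congrArg (substAlgHom (R := ℝ) hρ) serW_eq
  have hA := congrArg (substAlgHom (R := ℝ) hρ) serA_eq
  simp only [map_mul, map_add, map_pow, map_ofNat, coe_substAlgHom, h1] at hW hA
  refine ⟨serA.subst ρ, serW.subst ρ, hW, hA, ?_, fun n => ?_⟩
  · rw [coeff_zero_eq_constantCoeff]
    have h0 : constantCoeff ρ = 0 := by simp [hρdef]
    exact constantCoeff_subst_eq_zero h0 _ (by simp [serW])
  · refine (coeff_eq_of_subst_eq serPsi_mul_serPhi constantCoeff_serPsi ?_ n).symm
    rw [subst_comp_subst_apply hρ hs, h2, X_subst]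

theorem g_eq_coeff {k : ℕ} (hk : k ≠ 0) :
    g k = (3 * (k : ℝ) * (k + 1))⁻¹ * coeff k (d⁄dX ℝ serW * serPhi ^ (k + 1)) := by
  obtain ⟨K, W, hW, hK, hW0, hc⟩ := exists_network_series
  obtain ⟨W', hW'⟩ : ∃ W', W = X * W' := ⟨mk fun p => coeff (p + 1) W, by
    conv_lhs => rw [eq_X_mul_shift_add_const W, ← coeff_zero_eq_constantCoeff_apply, hW0]
    simp⟩
  -- The system is in `u = X ^ 2`; networks with one leg have an odd number of vertices, whence `T =
  -- X * E W'` with `X * T = E W`.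
  let E := expand (R := ℝ) 2 two_ne_zero
  set T := X * E W' with hT
  have hTW : X * T = E W := by
    rw [hT, hW', map_mul, expand_X]; ring
  have hT1 : 2 * T = X * (E K + T ^ 2) := by
    have h := congrArg E hW
    simp only [map_mul, map_add, map_pow, map_ofNat, ← hTW] at h
    rw [show E X = X ^ 2 from expand_X _ _] at h
    refine mul_left_cancel₀ (X_ne_zero (R := ℝ)) ?_
    linear_combination h
  have hK1 : 2 * E K = 2 + X * (2 * T * E K + X * E K ^ 3) := by
    have h := congrArg E hK
    simp only [map_mul, map_add, map_pow, map_ofNat, ← hTW] at h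
    rw [show E X = X ^ 2 from expand_X _ _] at h
    linear_combination h
  obtain ⟨m, rfl⟩ := Nat.exists_eq_succ_of_ne_zero hk
  have key := g_eq_labelled (counted (V := Fin (2 * (m + 1))) hT1 hK1 rfl (2 * m + 1)) (k := m + 1)
    (by ring)
  -- The two equations combine to `X (J + 3TK + T³) = 2 (K + T²) - 2`, and `X² (K + T²) = 2XT`. So
  -- the closed count is, up to factors and shifts, a coefficient of `W` alone.
  have h1 : coeff (2 * m + 1) (X * E K ^ 3 + 3 * T * E K + T ^ 3) = 4 * coeff (m + 2) W := by
    have h2 : X * (X * E K ^ 3 + 3 * T * E K + T ^ 3) = C 2 * (E K + T ^ 2) - C 2 := by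
      rw [map_ofNat]
      linear_combination - hK1 - T * hT1
    have h3 : X ^ 2 * (E K + T ^ 2) = C 2 * E W := by
      rw [map_ofNat, ← hTW]
      linear_combination - X * hT1
    have h4 := congrArg (coeff (2 * m + 2)) h2
    rw [coeff_succ_X_mul, map_sub, coeff_C_mul, coeff_C, if_neg (by omega), sub_zero] at h4
    have h5 := congrArg (coeff (2 * m + 2 + 2)) h3
    rw [coeff_X_pow_mul, coeff_C_mul, show 2 * m + 2 + 2 = 2 * (m + 2) by ring,
      coeff_expand_mul] at h5
    rw [h4, h5]; ring
  rw [labelled, h1, show 2 * (m + 1) = 2 * m + 1 + 1 by ring, Nat.factorial_succ, pow_succ] at key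
  have h6 := hc (m + 1)
  rw [Nat.succ_eq_add_one, ← h6]
  have h7 : ((2 * m + 1).factorial : ℝ) * 6 ^ (2 * m + 1) ≠ 0 := by positivity
  have h8 : g (m + 1) * (12 * (m + 1)) = 4 * coeff (m + 2) W := by
    refine mul_left_cancel₀ h7 ?_
    rw [← key]
    push_cast
    ring
  push_cast
  rw [show m + 1 + 1 = m + 2 from rfl]
  field_simp
  linarith

end VMultigraph

/-! ### Coefficients as Fourier integrals, and Laplace's method. -/

namespace PowerSeries

open Finset

/-- The power series `f` converges absolutely to `F` in the open unit disc. -/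
def Represents (f : PowerSeries ℝ) (F : ℂ → ℂ) : Prop :=
  ∀ z : ℂ, ‖z‖ < 1 → (Summable fun n => ‖((coeff n f : ℝ) : ℂ) * z ^ n‖) ∧
    ∑' n, ((coeff n f : ℝ) : ℂ) * z ^ n = F z

variable {f g : PowerSeries ℝ} {F G : ℂ → ℂ}

theorem Represents.mul (hf : f.Represents F) (hg : g.Represents G) :
    (f * g).Represents fun z => F z * G z := by
  intro z hz
  obtain ⟨hf1, hf2⟩ := hf z hz
  obtain ⟨hg1, hg2⟩ := hg z hz
  set a : ℕ → ℂ := fun n => ((coeff n f : ℝ) : ℂ) * z ^ n with ha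
  set b : ℕ → ℂ := fun n => ((coeff n g : ℝ) : ℂ) * z ^ n with hb
  have h : (fun n => ((coeff n (f * g) : ℝ) : ℂ) * z ^ n) =
      fun n => ∑ kl ∈ antidiagonal n, a kl.1 * b kl.2 := by
    funext n
    rw [coeff_mul, Complex.ofReal_sum, Finset.sum_mul]
    refine Finset.sum_congr rfl fun kl hkl => ?_
    rw [← mem_antidiagonal.1 hkl, pow_add]
    simp only [ha, hb]
    push_cast
    ring
  have h1 := summable_norm_sum_mul_antidiagonal_of_summable_norm (f := a) (g := b) hf1 hg1
  have h2 := tsum_mul_tsum_eq_tsum_sum_antidiagonal_of_summable_norm (f := a) (g := b) hf1 hg1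
  rw [hf2, hg2] at h2
  refine ⟨?_, ?_⟩
  · rw [show (fun n => ‖((coeff n (f * g) : ℝ) : ℂ) * z ^ n‖) =
      fun n => ‖∑ kl ∈ antidiagonal n, a kl.1 * b kl.2‖ from funext fun n => by rw [congrFun h n]]
    exact h1
  · rw [h]
    exact h2.symm

theorem Represents.add (hf : f.Represents F) (hg : g.Represents G) :
    (f + g).Represents fun z => F z + G z := by
  intro z hz
  obtain ⟨hf1, hf2⟩ := hf z hz
  obtain ⟨hg1, hg2⟩ := hg z hz
  simp only [map_add, Complex.ofReal_add, add_mul]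
  exact ⟨Summable.of_nonneg_of_le (fun _ => norm_nonneg _) (fun _ => norm_add_le _ _)
    (hf1.add hg1), by rw [hf1.of_norm.tsum_add hg1.of_norm, hf2, hg2]⟩

theorem represents_C_mul_X_pow (a : ℝ) (m : ℕ) :
    (C a * X ^ m : PowerSeries ℝ).Represents fun z => a * z ^ m := by
  intro z _
  have h : ∀ n, n ≠ m → ((coeff n (C a * X ^ m : PowerSeries ℝ) : ℝ) : ℂ) * z ^ n = 0 := by
    intro n hn
    simp [coeff_X_pow, hn]
  refine ⟨summable_of_ne_finset_zero (s := {m}) fun n hn => ?_, ?_⟩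
  · rw [h n (by simpa using hn), norm_zero]
  · rw [tsum_eq_single m h]
    simp [coeff_X_pow]

theorem represents_C (a : ℝ) : (C a : PowerSeries ℝ).Represents fun _ => a := by
  simpa using represents_C_mul_X_pow a 0

theorem Represents.C_mul (hf : f.Represents F) (a : ℝ) :
    (C a * f).Represents fun z => a * F z := (represents_C a).mul hf

theorem Represents.pow (hf : f.Represents F) (n : ℕ) :
    (f ^ n).Represents fun z => F z ^ n := by
  induction n with
  | zero => simpa using represents_C 1
  | succ n ih =>
    simp only [pow_succ]
    exact ih.mul hf

theorem represents_mk_pow {a : ℝ} (ha : |a| ≤ 1) :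
    (mk fun n => a ^ n).Represents fun z => (1 - a * z)⁻¹ := by
  intro z hz
  have h : ‖(a : ℂ) * z‖ < 1 := by
    rw [norm_mul, Complex.norm_real, Real.norm_eq_abs]
    exact (mul_le_of_le_one_left (norm_nonneg _) ha).trans_lt hz
  simp only [coeff_mk, Complex.ofReal_pow, ← mul_pow]
  exact ⟨summable_norm_geometric_of_norm_lt_one h, tsum_geometric_of_norm_lt_one h⟩

theorem inv_one_sub_C_mul_X (a : ℝ) : (1 - C a * X : PowerSeries ℝ)⁻¹ = mk fun n => a ^ n := by
  have h : (mk fun n => a ^ n) * (1 - C a * X : PowerSeries ℝ) = 1 := by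
    rw [mul_sub, mul_one]
    ext n
    rcases n with _ | n
    · simp
    · rw [map_sub, coeff_mk, ← mul_assoc, coeff_succ_mul_X, mul_comm, coeff_C_mul, coeff_mk,
        coeff_one, if_neg n.succ_ne_zero]
      ring
  rw [inv_eq_iff_mul_eq_one (by simp)]
  exact h

theorem integral_exp_int (m : ℤ) :
    ∫ θ in (-Real.pi)..Real.pi, Complex.exp ((m * Complex.I : ℂ) * (θ : ℂ)) =
      if m = 0 then 2 * (Real.pi : ℂ) else 0 := by
  split_ifs with h
  · subst h
    simp
    ring
  · have hc : (m * Complex.I : ℂ) ≠ 0 := mul_ne_zero (by exact_mod_cast h) Complex.I_ne_zero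
    have h2 : Complex.exp ((m * Complex.I : ℂ) * (Real.pi : ℝ)) =
        Complex.exp ((m * Complex.I : ℂ) * (-Real.pi : ℝ)) := by
      rw [Complex.exp_eq_exp_iff_exists_int]
      exact ⟨m, by push_cast; ring⟩
    rw [integral_exp_mul_complex hc, h2, sub_self, zero_div]

/-- The coefficients as Fourier integrals. -/
theorem Represents.coeff_eq (hf : f.Represents F) {r : ℝ} (h0 : 0 ≤ r) (h1 : r < 1) (k : ℕ) :
    2 * (Real.pi : ℂ) * (((coeff k f : ℝ) : ℂ) * r ^ k) = ∫ θ in (-Real.pi)..Real.pi,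
      F (r * Complex.exp (Complex.I * θ)) * Complex.exp (-(k * Complex.I * θ)) := by
  have hnorm : ∀ θ : ℝ, ‖(r : ℂ) * Complex.exp (Complex.I * θ)‖ = r := by
    intro θ
    rw [norm_mul, mul_comm Complex.I, Complex.norm_exp_ofReal_mul_I, mul_one, Complex.norm_real,
      Real.norm_of_nonneg h0]
  have hsum := (hf (r : ℂ) (by rwa [Complex.norm_real, Real.norm_of_nonneg h0])).1
  let T : ℕ → ℝ → ℂ := fun n θ => ((coeff n f : ℝ) : ℂ) * (r * Complex.exp (Complex.I * θ)) ^ n *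
    Complex.exp (-(k * Complex.I * θ))
  have hT : ∀ n θ, T n θ = (((coeff n f : ℝ) : ℂ) * r ^ n) *
      Complex.exp ((((n : ℤ) - k : ℤ) * Complex.I : ℂ) * θ) := by
    intro n θ
    simp only [T]
    have h3 : ((((n : ℤ) - k : ℤ) * Complex.I : ℂ) * θ) =
        n * (Complex.I * θ) + -(k * Complex.I * θ) := by
      push_cast; ring
    rw [h3, Complex.exp_add, Complex.exp_nat_mul]
    ring
  have hnT : ∀ n θ, ‖T n θ‖ = ‖((coeff n f : ℝ) : ℂ) * r ^ n‖ := by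
    intro n θ
    rw [hT, norm_mul]
    have : (((((n : ℤ) - k : ℤ) : ℂ) * Complex.I) * (θ : ℂ)) =
        (((((n : ℤ) - k : ℤ) : ℝ) * θ : ℝ) : ℂ) * Complex.I := by
      push_cast; ring
    rw [this, Complex.norm_exp_ofReal_mul_I, mul_one]
  -- Integration term by term; absolute convergence on the circle of radius `r` gives the majorant.
  have key := intervalIntegral.hasSum_integral_of_dominated_convergence
    (μ := MeasureTheory.volume) (a := -Real.pi) (b := Real.pi) (F := T)
    (f := fun θ => F (r * Complex.exp (Complex.I * θ)) * Complex.exp (-(k * Complex.I * θ)))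
    (fun n _ => ‖((coeff n f : ℝ) : ℂ) * r ^ n‖)
    (fun n => by
      refine Continuous.aestronglyMeasurable ?_
      simp only [T]
      fun_prop)
    (fun n => Filter.Eventually.of_forall fun θ _ => (hnT n θ).le)
    (Filter.Eventually.of_forall fun θ _ => hsum) (by simp)
    (Filter.Eventually.of_forall fun θ _ => by
      have h2 := hf (r * Complex.exp (Complex.I * θ)) (by rwa [hnorm])
      have h3 := h2.1.of_norm.hasSum
      rw [h2.2] at h3
      exact h3.mul_right _)
  have hint : ∀ n, ∫ θ in (-Real.pi)..Real.pi, T n θ =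
      if n = k then (((coeff n f : ℝ) : ℂ) * r ^ n) * (2 * (Real.pi : ℂ)) else 0 := by
    intro n
    simp only [hT]
    rw [intervalIntegral.integral_const_mul, integral_exp_int]
    have : ((n : ℤ) - k = 0) ↔ n = k := by omega
    simp only [this]
    split_ifs <;> simp
  rw [← key.tsum_eq, tsum_congr hint, tsum_ite_eq]
  ring

end PowerSeries

open MeasureTheory in
/-- Laplace's method for a complex integrand. -/
theorem tendsto_sqrt_mul_integral_pow {v χ : ℝ → ℂ} (hv : Continuous v) (hχ : Continuous χ)
    {κ a M : ℝ} (hκ : 0 < κ) (hM : ∀ θ, ‖v θ‖ ≤ M)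
    (hb : ∀ θ, |θ| ≤ Real.pi → ‖χ θ‖ ≤ Real.exp (-κ * θ ^ 2))
    (hlim : ∀ t : ℝ, Tendsto (fun n : ℕ => (n : ℂ) * (χ (t / √n) - 1)) atTop
      (nhds (-(a : ℂ) * t ^ 2))) :
    Tendsto (fun n : ℕ => (√n : ℂ) * ∫ θ in (-Real.pi)..Real.pi, v θ * χ θ ^ n) atTop
      (nhds (v 0 * (√(Real.pi / a) : ℝ))) := by
  let G : ℕ → ℝ → ℂ := fun n => (Set.Ioc (-Real.pi) Real.pi).indicator fun θ => v θ * χ θ ^ n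
  have hG : ∀ n : ℕ, n ≠ 0 → (√n : ℂ) * ∫ θ in (-Real.pi)..Real.pi, v θ * χ θ ^ n =
      ∫ t, G n ((√n)⁻¹ * t) := by
    intro n hn
    rw [Measure.integral_comp_inv_mul_left, abs_of_nonneg (Real.sqrt_nonneg _),
      intervalIntegral.integral_of_le (by linarith [Real.pi_pos]),
      integral_indicator measurableSet_Ioc, Complex.real_smul]
  -- After `θ = t / √n` the integrand converges pointwise to `v 0 * exp (-a t²)`, and `hb` raised to
  -- the power `n` gives a Gaussian majorant independent of `n`.
  have hmain : Tendsto (fun n : ℕ => ∫ t, G n ((√n)⁻¹ * t)) atTop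
      (nhds (∫ t : ℝ, v 0 * Complex.exp (-(a : ℂ) * t ^ 2))) := by
    refine tendsto_integral_filter_of_dominated_convergence
      (fun t => M * Real.exp (-κ * t ^ 2)) ?_ ?_ ?_ ?_
    · refine Filter.Eventually.of_forall fun n => ?_
      have : Measurable (G n) := Measurable.indicator (by fun_prop) measurableSet_Ioc
      exact (this.comp (measurable_const_mul _)).aestronglyMeasurable
    · filter_upwards [eventually_ne_atTop 0] with n hn
      refine Filter.Eventually.of_forall fun t => ?_
      have hM0 : 0 ≤ M := (norm_nonneg _).trans (hM 0)
      by_cases ht : (√n)⁻¹ * t ∈ Set.Ioc (-Real.pi) Real.pi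
      · rw [show G n ((√n)⁻¹ * t) = _ from Set.indicator_of_mem ht _, norm_mul, norm_pow]
        refine mul_le_mul (hM _) ?_ (by positivity) hM0
        have h1 := hb _ (abs_le.2 ⟨ht.1.le, ht.2⟩)
        refine (pow_le_pow_left₀ (norm_nonneg _) h1 n).trans_eq ?_
        rw [← Real.exp_nat_mul]
        congr 1
        have hn' : (n : ℝ) ≠ 0 := by exact_mod_cast hn
        rw [mul_pow, inv_pow, Real.sq_sqrt (Nat.cast_nonneg n)]
        field_simp
      · rw [show G n ((√n)⁻¹ * t) = _ from Set.indicator_of_notMem ht _, norm_zero]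
        positivity
    · exact (integrable_exp_neg_mul_sq hκ).const_mul M
    · refine Filter.Eventually.of_forall fun t => ?_
      have h0 : Tendsto (fun n : ℕ => (√n)⁻¹ * t) atTop (nhds 0) := by
        have h1 : Tendsto (fun n : ℕ => (√(n : ℝ))⁻¹) atTop (nhds 0) :=
          tendsto_inv_atTop_zero.comp (Real.tendsto_sqrt_atTop.comp tendsto_natCast_atTop_atTop)
        simpa using h1.mul_const t
      have h2 : ∀ᶠ n : ℕ in atTop, (√n)⁻¹ * t ∈ Set.Ioc (-Real.pi) Real.pi :=
        h0.eventually (Ioc_mem_nhds (by linarith [Real.pi_pos]) Real.pi_pos)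
      have h3 : Tendsto (fun n : ℕ => v ((√n)⁻¹ * t) * χ ((√n)⁻¹ * t) ^ n) atTop
          (nhds (v 0 * Complex.exp (-(a : ℂ) * t ^ 2))) := by
        refine Tendsto.mul ((hv.tendsto 0).comp h0) ?_
        have h4 := Complex.tendsto_one_add_pow_exp_of_tendsto (hlim t)
        refine h4.congr fun n => ?_
        rw [add_sub_cancel, div_eq_inv_mul]
      refine h3.congr' ?_
      filter_upwards [h2] with n hn
      rw [show G n ((√n)⁻¹ * t) = _ from Set.indicator_of_mem hn _]
  have hgauss : ∫ t : ℝ, v 0 * Complex.exp (-(a : ℂ) * t ^ 2) =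
      v 0 * (√(Real.pi / a) : ℝ) := by
    rw [integral_const_mul, ← integral_gaussian, ← integral_complex_ofReal]
    push_cast
    rfl
  rw [hgauss] at hmain
  refine hmain.congr' ?_
  filter_upwards [eventually_ne_atTop 0] with n hn
  exact (hG n hn).symm

/-! ### The integrand on a circle in the parameter plane. -/

namespace VMultigraph

open PowerSeries

noncomputable def funN (z : ℂ) : ℂ := 3 - z ^ 2

noncomputable def funD (z : ℂ) : ℂ := (1 - z) * (3 - z)

noncomputable def funPhi (z : ℂ) : ℂ := 1 / 4 * funN z ^ 3 * (funD z)⁻¹ ^ 2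

noncomputable def funW' (z : ℂ) : ℂ := 2 * (3 - 6 * z + z ^ 2) * (funN z)⁻¹ ^ 2

theorem mul_mk_pow (a : ℝ) : (1 - C a * X : PowerSeries ℝ) * (mk fun n => a ^ n) = 1 := by
  rw [← inv_one_sub_C_mul_X]
  exact PowerSeries.mul_inv_cancel _ (by simp)

theorem represents_serN : serN.Represents funN := by
  have h := (represents_C 3).add (represents_C_mul_X_pow (-1) 2)
  have e : serN = C 3 + C (-1) * X ^ 2 := by
    rw [serN, map_neg, map_one, map_ofNat]; ring
  rw [e]
  convert h using 2 with z
  simp [funN, sub_eq_add_neg]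

/-- A product of two geometric series. The factor `1 - z` limits the domain to the unit disc. -/
theorem represents_serD_inv : serD⁻¹.Represents fun z => (funD z)⁻¹ := by
  have e : serD⁻¹ = C (1 / 3) * ((mk fun n => (1 : ℝ) ^ n) * mk fun n => (1 / 3 : ℝ) ^ n) := by
    symm
    rw [eq_inv_iff_mul_eq_one (by rw [constantCoeff_serD]; norm_num)]
    have h1 := mul_mk_pow 1
    have h2 := mul_mk_pow (1 / 3)
    have h3 : serD = C 3 * ((1 - C 1 * X) * (1 - C (1 / 3) * X)) := by
      have : (C 3 * C (1 / 3) : PowerSeries ℝ) = 1 := by rw [← map_mul]; norm_num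
      rw [serD, map_one, map_ofNat] at *
      linear_combination (X - X ^ 2) * this
    have h4 : (C (1 / 3) * C 3 : PowerSeries ℝ) = 1 := by rw [← map_mul]; norm_num
    rw [h3]
    linear_combination (((1 - C 1 * X) * mk fun n => (1 : ℝ) ^ n) *
      ((1 - C (1 / 3) * X) * mk fun n => (1 / 3 : ℝ) ^ n)) * h4 +
      ((1 - C (1 / 3) * X) * mk fun n => (1 / 3 : ℝ) ^ n) * h1 + h2
  rw [e]
  convert ((represents_mk_pow (a := 1) (by simp)).mul
    (represents_mk_pow (a := 1 / 3) (by rw [abs_of_pos] <;> norm_num))).C_mul (1 / 3) using 2 with z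
  have : funD z = 3 * ((1 - z) * (1 - z / 3)) := by rw [funD]; ring
  rw [this, mul_inv, mul_inv]
  have h3 : (1 : ℂ) - z / 3 = 1 - 3⁻¹ * z := by ring
  rw [h3]
  push_cast
  rw [one_mul, one_div]

theorem represents_serN_inv : serN⁻¹.Represents fun z => (funN z)⁻¹ := by
  have hs : (√3 : ℝ) * √3 = 3 := Real.mul_self_sqrt (by norm_num)
  set a : ℝ := √3 / 3 with ha
  have haa : a * a = 1 / 3 := by rw [ha]; linear_combination hs / 9
  have ha1 : |a| ≤ 1 := abs_le_one_iff_mul_self_le_one.2 (by rw [haa]; norm_num)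
  have e : serN⁻¹ = C (1 / 3) * ((mk fun n => a ^ n) * mk fun n => (-a) ^ n) := by
    symm
    rw [eq_inv_iff_mul_eq_one (by rw [constantCoeff_serN]; norm_num)]
    have h1 := mul_mk_pow a
    have h2 := mul_mk_pow (-a)
    have h3 : serN = C 3 * ((1 - C a * X) * (1 - C (-a) * X)) := by
      have : (C 3 * (C a * C a) : PowerSeries ℝ) = 1 := by
        rw [← map_mul, ← map_mul, haa]; norm_num
      rw [serN, map_neg]
      rw [map_ofNat] at *
      linear_combination X ^ 2 * this
    have h4 : (C (1 / 3) * C 3 : PowerSeries ℝ) = 1 := by rw [← map_mul]; norm_num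
    rw [h3]
    linear_combination (((1 - C a * X) * mk fun n => a ^ n) *
      ((1 - C (-a) * X) * mk fun n => (-a) ^ n)) * h4 +
      ((1 - C (-a) * X) * mk fun n => (-a) ^ n) * h1 + h2
  rw [e]
  convert ((represents_mk_pow ha1).mul
    (represents_mk_pow (a := -a) (by rwa [abs_neg]))).C_mul (1 / 3) using 2 with z
  have haa' : (a : ℂ) * a = 1 / 3 := by rw [← Complex.ofReal_mul, haa]; norm_num
  have : funN z = 3 * ((1 - a * z) * (1 - (-a : ℝ) * z)) := by
    rw [funN]; push_cast; linear_combination (3 * z ^ 2) * haa'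
  rw [this, mul_inv, mul_inv]
  push_cast
  rw [one_div]

theorem represents_product (k : ℕ) : (d⁄dX ℝ serW * serPhi ^ k).Represents
    fun z => funW' z * funPhi z ^ k := by
  refine Represents.mul ?_ (Represents.pow ?_ k)
  · rw [derivative_serW]
    have h := (((represents_C 3).add (represents_C_mul_X_pow (-6) 1)).add
      (represents_C_mul_X_pow 1 2)).C_mul 2
    have e : (2 * (3 - 6 * X + X ^ 2) : PowerSeries ℝ) =
        C 2 * (C 3 + C (-6) * X ^ 1 + C 1 * X ^ 2) := by
      rw [map_neg, map_one, map_ofNat, map_ofNat, map_ofNat]; ring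
    rw [e]
    convert h.mul (represents_serN_inv.pow 2) using 2 with z
    rw [funW']
    push_cast
    ring
  · rw [serPhi]
    convert ((represents_serN.pow 3).C_mul (1 / 4)).mul (represents_serD_inv.pow 2) using 1
    funext z
    simp only [funPhi]
    push_cast
    ring

/-- The normalised integrand on the circle of radius `τ`. -/
noncomputable def chi (τ θ : ℝ) : ℂ :=
  funPhi (τ * Complex.exp (Complex.I * θ)) / funPhi τ * Complex.exp (-(Complex.I * θ))

noncomputable def amp (τ θ : ℝ) : ℂ :=
  funW' (τ * Complex.exp (Complex.I * θ)) * Complex.exp (Complex.I * θ)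

/-- The power of `φ` exceeds the degree of the coefficient by one; the extra factor `exp (iθ)` in
`amp` compensates for this, leaving the pure power `chi ^ (k + 1)`. -/
theorem coeff_eq_integral {τ : ℝ} (h0 : 0 < τ) (h1 : τ < 1) (hφ : funPhi τ ≠ 0) (k : ℕ) :
    2 * (Real.pi : ℂ) * ((coeff k (d⁄dX ℝ serW * serPhi ^ (k + 1)) : ℝ) * τ ^ k) =
      funPhi τ ^ (k + 1) * ∫ θ in (-Real.pi)..Real.pi, amp τ θ * chi τ θ ^ (k + 1) := by
  rw [(represents_product (k + 1)).coeff_eq h0.le h1 k, ← intervalIntegral.integral_const_mul]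
  refine intervalIntegral.integral_congr fun θ _ => ?_
  simp only [amp, chi]
  have h2 : Complex.exp (-(k * Complex.I * θ)) =
      Complex.exp (Complex.I * θ) * Complex.exp (-(Complex.I * θ)) ^ (k + 1) := by
    rw [← Complex.exp_nat_mul, ← Complex.exp_add]
    congr 1
    push_cast
    ring
  rw [h2, mul_pow, div_pow]
  field_simp

theorem norm_mul_exp {τ : ℝ} (h0 : 0 < τ) (θ : ℝ) : ‖(τ : ℂ) * Complex.exp (Complex.I * θ)‖ = τ := by
  rw [norm_mul, mul_comm Complex.I, Complex.norm_exp_ofReal_mul_I, mul_one, Complex.norm_real,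
    Real.norm_of_nonneg h0.le]

theorem ne_of_norm_lt_one {z : ℂ} (hz : ‖z‖ < 1) : 1 - z ≠ 0 ∧ 3 - z ≠ 0 ∧ funN z ≠ 0 := by
  refine ⟨fun h => ?_, fun h => ?_, fun h => ?_⟩
  · rw [← sub_eq_zero.1 h] at hz; simp at hz
  · rw [← sub_eq_zero.1 h] at hz; norm_num at hz
  · have h2 : ‖z ^ 2‖ = 3 := by rw [← sub_eq_zero.1 h]; norm_num
    rw [norm_pow] at h2
    nlinarith [norm_nonneg z]

theorem continuous_chi_amp {τ : ℝ} (h0 : 0 < τ) (h1 : τ < 1) :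
    Continuous (chi τ) ∧ Continuous (amp τ) := by
  have hz : ∀ θ : ℝ, ‖(τ : ℂ) * Complex.exp (Complex.I * θ)‖ < 1 := fun θ => by
    rwa [norm_mul_exp h0]
  have hc : Continuous fun θ : ℝ => (τ : ℂ) * Complex.exp (Complex.I * θ) := by fun_prop
  have hN : Continuous fun θ : ℝ => funN (τ * Complex.exp (Complex.I * θ)) := by
    unfold funN; fun_prop
  have hD : Continuous fun θ : ℝ => funD (τ * Complex.exp (Complex.I * θ)) := by
    unfold funD; fun_prop
  have hN' := hN.inv₀ fun θ => (ne_of_norm_lt_one (hz θ)).2.2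
  have hD' := hD.inv₀ fun θ => mul_ne_zero (ne_of_norm_lt_one (hz θ)).1 (ne_of_norm_lt_one (hz θ)).2.1
  refine ⟨?_, ?_⟩
  · exact (((continuous_const.mul (hN.pow 3)).mul (hD'.pow 2)).div_const _).mul (by fun_prop)
  · exact ((continuous_const.mul (by fun_prop)).mul (hN'.pow 2)).mul (by fun_prop)

end VMultigraph

/-! ### Local expansion and Gaussian bound for the normalised integrand. -/

namespace VMultigraph

/-- At the point `τ (1 + y)` the polynomials `3 - z²` and `(1 - z)(3 - z)`, divided by their values
at `τ`, are quadratics in `y` whose coefficients are `P`, `B`, `E`. -/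
theorem chi_eq {τ : ℝ} (h0 : 0 < τ) (h1 : τ < 1) {P B E : ℝ}
    (hP : P * (3 - τ ^ 2) = 2 * τ ^ 2) (hB : B * ((1 - τ) * (3 - τ)) = τ * (4 - 2 * τ))
    (hE : E * ((1 - τ) * (3 - τ)) = τ ^ 2) (θ : ℝ) {y : ℂ}
    (hy : y = Complex.exp (Complex.I * θ) - 1) :
    (1 - B * y + E * y ^ 2) ^ 2 * (1 + y) ≠ 0 ∧
    chi τ θ = (1 - P * y - P / 2 * y ^ 2) ^ 3 / ((1 - B * y + E * y ^ 2) ^ 2 * (1 + y)) := by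
  have hy' : Complex.exp (Complex.I * θ) = 1 + y := by rw [hy]; ring
  have hexp : (1 + y) ≠ 0 := by rw [← hy']; exact Complex.exp_ne_zero _
  obtain ⟨ha, hb, -⟩ := ne_of_norm_lt_one (z := τ * Complex.exp (Complex.I * θ))
    (by rwa [norm_mul_exp h0])
  obtain ⟨ha0, hb0, hc0⟩ := ne_of_norm_lt_one (z := (τ : ℂ))
    (by rwa [Complex.norm_real, Real.norm_of_nonneg h0.le])
  have hPc : (P : ℂ) * (3 - τ ^ 2) = 2 * τ ^ 2 := by exact_mod_cast hP
  have hBc : (B : ℂ) * ((1 - τ) * (3 - τ)) = τ * (4 - 2 * τ) := by exact_mod_cast hB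
  have hEc : (E : ℂ) * ((1 - τ) * (3 - τ)) = τ ^ 2 := by exact_mod_cast hE
  rw [hy'] at ha hb
  have hN : funN (τ * (1 + y)) = funN τ * (1 - P * y - P / 2 * y ^ 2) := by
    unfold funN
    linear_combination (y + y ^ 2 / 2) * hPc
  have hD : funD (τ * (1 + y)) = funD τ * (1 - B * y + E * y ^ 2) := by
    unfold funD
    linear_combination y * hBc - y ^ 2 * hEc
  have hD0 : funD τ ≠ 0 := mul_ne_zero ha0 hb0
  have hD1 : (1 - B * y + E * y ^ 2 : ℂ) ≠ 0 := by
    have : funD (τ * (1 + y)) ≠ 0 := mul_ne_zero ha hb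
    rw [hD] at this
    exact right_ne_zero_of_mul this
  refine ⟨mul_ne_zero (pow_ne_zero 2 hD1) hexp, ?_⟩
  rw [chi, Complex.exp_neg, hy', funPhi, funPhi, hN, hD]
  field_simp

theorem tendsto_chi {τ : ℝ} (h0 : 0 < τ) (h1 : τ < 1) {P B E : ℝ}
    (hP : P * (3 - τ ^ 2) = 2 * τ ^ 2) (hB : B * ((1 - τ) * (3 - τ)) = τ * (4 - 2 * τ))
    (hE : E * ((1 - τ) * (3 - τ)) = τ ^ 2) (hsad : 3 * P + 1 = 2 * B) {a : ℝ}
    (ha : a = 3 * P ^ 2 - 3 / 2 * P + 2 * B - B ^ 2 - 2 * E) (t : ℝ) :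
    Tendsto (fun n : ℕ => (n : ℂ) * (chi τ (t / √n) - 1)) atTop (nhds (-(a : ℂ) * t ^ 2)) := by
  let y : ℕ → ℂ := fun n => Complex.exp (Complex.I * ((t / √n : ℝ) : ℂ)) - 1
  -- Numerator minus denominator of `chi`, divided by `y ^ 2`. The linear term vanishes by `hsad`,
  -- which is the saddle point equation `τ φ'(τ) = φ(τ)`. As `y ~ iθ`, the Gaussian coefficient is
  -- `q 0 = a`.
  let q : ℂ → ℂ := fun y => -3 / 2 * P + 3 * (P * (1 + y / 2)) ^ 2 - y * (P * (1 + y / 2)) ^ 3 +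
    2 * B - (1 + y) * (B ^ 2 + 2 * E - 2 * B * E * y + E ^ 2 * y ^ 2)
  let den : ℂ → ℂ := fun y => (1 - B * y + E * y ^ 2) ^ 2 * (1 + y)
  have hR : ∀ n : ℕ, (n : ℂ) * (chi τ (t / √n) - 1) =
      ((√(n : ℝ) : ℝ) * y n) ^ 2 * (q (y n) / den (y n)) := by
    intro n
    obtain ⟨hd, h⟩ := chi_eq h0 h1 hP hB hE (t / √n) (y := y n) rfl
    have hn : ((√(n : ℝ) : ℝ) : ℂ) ^ 2 = n := by
      rw [← Complex.ofReal_pow, Real.sq_sqrt (Nat.cast_nonneg n)]; simp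
    have hs : (3 * P + 1 : ℂ) = 2 * B := by exact_mod_cast hsad
    have key : ∀ z : ℂ, (1 - P * z - P / 2 * z ^ 2) ^ 3 - (1 - B * z + E * z ^ 2) ^ 2 * (1 + z) =
        z ^ 2 * q z := by
      intro z
      simp only [q]
      linear_combination (-z) * hs
    rw [h, div_sub_one hd, key, mul_pow, hn, mul_assoc, mul_div_assoc]
  have hlim : Tendsto (fun n : ℕ => ((√(n : ℝ) : ℝ) : ℂ) * y n) atTop
      (nhds (Complex.I * t)) := by
    have hder : HasDerivAt (fun x : ℝ => Complex.exp (Complex.I * ((t * x : ℝ) : ℂ)))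
        (Complex.I * t) 0 := by
      have h2 : HasDerivAt (fun x : ℝ => Complex.I * ((t * x : ℝ) : ℂ)) (Complex.I * t) 0 := by
        have h3 := ((hasDerivAt_id (0 : ℝ)).const_mul t).ofReal_comp.const_mul Complex.I
        simpa using h3
      have h4 := h2.cexp
      simpa using h4
    have h5 := hder.tendsto_slope_zero_right
    have h6 : Tendsto (fun n : ℕ => (√(n : ℝ))⁻¹) atTop (nhdsWithin 0 (Set.Ioi 0)) := by
      refine tendsto_nhdsWithin_iff.2 ⟨tendsto_inv_atTop_zero.comp
        (Real.tendsto_sqrt_atTop.comp tendsto_natCast_atTop_atTop), ?_⟩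
      filter_upwards [eventually_gt_atTop 0] with n hn
      have : (0 : ℝ) < n := by exact_mod_cast hn
      exact inv_pos.2 (Real.sqrt_pos.2 this)
    refine (h5.comp h6).congr fun n => ?_
    simp [y, div_eq_mul_inv]
  have hy0 : Tendsto y atTop (nhds 0) := by
    have h1 : Tendsto (fun n : ℕ => t / √(n : ℝ)) atTop (nhds 0) :=
      tendsto_const_nhds.div_atTop (Real.tendsto_sqrt_atTop.comp tendsto_natCast_atTop_atTop)
    have h2 : Continuous fun x : ℝ => Complex.exp (Complex.I * (x : ℂ)) - 1 := by fun_prop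
    have h3 := (h2.tendsto 0).comp h1
    simp only [Complex.ofReal_zero, mul_zero, Complex.exp_zero, sub_self] at h3
    exact h3
  have hq : Tendsto (fun y => q y / den y) (nhds 0) (nhds (q 0 / den 0)) := by
    refine Tendsto.div (Continuous.tendsto ?_ 0) (Continuous.tendsto ?_ 0) ?_
    · simp only [q]; fun_prop
    · simp only [den]; fun_prop
    · simp [den]
  have h := (hlim.pow 2).mul (hq.comp hy0)
  have hval : (Complex.I * t) ^ 2 * (q 0 / den 0) = -(a : ℂ) * t ^ 2 := by
    simp only [q, den, ha]
    push_cast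
    rw [mul_pow, Complex.I_sq]
    norm_num
    ring
  rw [hval] at h
  exact h.congr fun n => (hR n).symm

/-- With `r` discarded, this is the polynomial inequality `(1 + 0.31x)³ (1 + x) ≤ (1 + 1.45x)²` on
`[0, 2]`. -/
theorem cube_div_sq_le {u p r x : ℝ} (hx0 : 0 ≤ x) (hx2 : x ≤ 2) (hu0 : 0 ≤ u)
    (hu1 : u ≤ 1 + 0.31 * x) (hp1 : 1 + 1.45 * x ≤ p) (hr1 : 1 ≤ r) :
    u ^ 3 / (p * r) ^ 2 ≤ (1 + x)⁻¹ := by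
  have hp : 0 < p := by linarith
  have hr : 0 < r := by linarith
  have hpr : 1 + 1.45 * x ≤ p * r := hp1.trans (le_mul_of_one_le_right hp.le hr1)
  rw [div_le_iff₀ (by positivity), inv_mul_eq_div, le_div_iff₀ (by positivity)]
  have h1 : u ^ 3 * (1 + x) ≤ (1 + 0.31 * x) ^ 3 * (1 + x) := by gcongr
  have h2 : (1 + 1.45 * x) ^ 2 ≤ (p * r) ^ 2 := by gcongr
  have h3 : 0 ≤ x ^ 2 * (2 - x) := mul_nonneg (sq_nonneg x) (by linarith)
  have h4 : 0 ≤ x ^ 3 * (2 - x) := mul_nonneg (pow_nonneg hx0 3) (by linarith)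
  have h5 : (1 + 0.31 * x) ^ 3 * (1 + x) ≤ (1 + 1.45 * x) ^ 2 := by
    nlinarith [sq_nonneg x]
  linarith

/-- The quotients are the squared moduli of `3 - z²`, `1 - z` and `3 - z` at `z = τ exp (iθ)`, `c =
cos θ`, relative to their values at `τ`. The constants are roundings of `24τ² / (3 - τ²)² ≈ 0.309`
and `2τ / (1 - τ)² ≈ 1.456`. -/
theorem factor_bounds {τ c : ℝ} (h0 : 0.328 < τ) (h1 : τ < 0.3285) (hc1 : c ≤ 1) (hc2 : -1 ≤ c) :
    0 ≤ ((3 - τ ^ 2) ^ 2 + 12 * τ ^ 2 * (1 - c ^ 2)) / (3 - τ ^ 2) ^ 2 ∧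
    ((3 - τ ^ 2) ^ 2 + 12 * τ ^ 2 * (1 - c ^ 2)) / (3 - τ ^ 2) ^ 2 ≤ 1 + 0.31 * (1 - c) ∧
    1 + 1.45 * (1 - c) ≤ ((1 - τ) ^ 2 + 2 * τ * (1 - c)) / (1 - τ) ^ 2 ∧
    1 ≤ ((3 - τ) ^ 2 + 6 * τ * (1 - c)) / (3 - τ) ^ 2 := by
  have hx0 : 0 ≤ 1 - c := by linarith
  have h2 : 1 - c ^ 2 ≤ 2 * (1 - c) := by nlinarith [sq_nonneg (1 - c)]
  have h2' : 0 ≤ 1 - c ^ 2 := by nlinarith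
  have hτ : τ ^ 2 ≤ 0.10792 := by nlinarith
  have t1 : 0 < 3 - τ ^ 2 := by linarith
  have t2 : 0 < 1 - τ := by linarith
  have t3 : 0 < 3 - τ := by linarith
  refine ⟨by positivity, ?_, ?_, ?_⟩
  · rw [div_le_iff₀ (by positivity)]
    have h3 : 24 * τ ^ 2 ≤ 0.31 * (3 - τ ^ 2) ^ 2 := by nlinarith
    have h4 := mul_le_mul_of_nonneg_right h3 hx0
    have h5 := mul_le_mul_of_nonneg_left h2 (show 0 ≤ 12 * τ ^ 2 by positivity)
    linarith
  · rw [le_div_iff₀ (by positivity)]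
    have h3 : 1.45 * (1 - τ) ^ 2 ≤ 2 * τ := by nlinarith
    have h4 := mul_le_mul_of_nonneg_right h3 hx0
    linarith
  · rw [le_div_iff₀ (by positivity)]
    have h4 := mul_nonneg (show 0 ≤ τ by linarith) hx0
    linarith

/-- With `x = 1 - cos θ` the squared modulus is at most `1 / (1 + x) ≤ exp (-x / 3)`, because `x ≤
2`, and `x ≥ θ² / 5`, because `π² ≤ 10`. The square root turns `1 / 15` into `1 / 30`. -/
theorem norm_chi_le {τ : ℝ} (h0 : 0.328 < τ) (h1 : τ < 0.3285) {θ : ℝ} (hθ : |θ| ≤ Real.pi) :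
    ‖chi τ θ‖ ≤ Real.exp (-(1 / 30) * θ ^ 2) := by
  set c := Real.cos θ with hc
  set S := Real.sin θ with hS
  have hcs : S ^ 2 + c ^ 2 = 1 := Real.sin_sq_add_cos_sq θ
  have hc1 : c ≤ 1 := Real.cos_le_one θ
  have hc2 : -1 ≤ c := Real.neg_one_le_cos θ
  have hz : (τ : ℂ) * Complex.exp (Complex.I * θ) = ⟨τ * c, τ * S⟩ := by
    rw [mul_comm Complex.I, Complex.exp_mul_I]
    apply Complex.ext
    · simp [hc, Complex.cos_ofReal_re θ]
    · simp [hS, Complex.sin_ofReal_re θ]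
  have hN : Complex.normSq (funN (τ * Complex.exp (Complex.I * θ))) =
      (3 - τ ^ 2) ^ 2 + 12 * τ ^ 2 * (1 - c ^ 2) := by
    rw [hz, funN, Complex.normSq_apply]
    simp [pow_two]
    linear_combination (τ ^ 4 * (c ^ 2 + S ^ 2 + 1) + 6 * τ ^ 2) * hcs
  have hA : Complex.normSq (1 - τ * Complex.exp (Complex.I * θ)) =
      (1 - τ) ^ 2 + 2 * τ * (1 - c) := by
    rw [hz, Complex.normSq_apply]
    simp
    linear_combination τ ^ 2 * hcs
  have hB : Complex.normSq (3 - τ * Complex.exp (Complex.I * θ)) =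
      (3 - τ) ^ 2 + 6 * τ * (1 - c) := by
    rw [hz, Complex.normSq_apply]
    simp
    linear_combination τ ^ 2 * hcs
  have hN0 : Complex.normSq (funN τ) = (3 - τ ^ 2) ^ 2 := by
    rw [funN, Complex.normSq_apply]; simp [pow_two]
  have hA0 : Complex.normSq (1 - τ) = (1 - τ) ^ 2 := by
    rw [Complex.normSq_apply]; simp [pow_two]
  have hB0 : Complex.normSq (3 - τ) = (3 - τ) ^ 2 := by
    rw [Complex.normSq_apply]; simp [pow_two]
  have hexp : Complex.normSq (Complex.exp (-(Complex.I * θ))) = 1 := by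
    rw [Complex.normSq_eq_norm_sq, show -(Complex.I * θ) = ((-θ : ℝ) : ℂ) * Complex.I by
      push_cast; ring, Complex.norm_exp_ofReal_mul_I]
    norm_num
  set u := ((3 - τ ^ 2) ^ 2 + 12 * τ ^ 2 * (1 - c ^ 2)) / (3 - τ ^ 2) ^ 2 with hu
  set p := ((1 - τ) ^ 2 + 2 * τ * (1 - c)) / (1 - τ) ^ 2 with hp
  set r := ((3 - τ) ^ 2 + 6 * τ * (1 - c)) / (3 - τ) ^ 2 with hr
  have t1 : 0 < 3 - τ ^ 2 := by nlinarith
  have t2 : 0 < 1 - τ := by linarith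
  have t3 : 0 < 3 - τ := by linarith
  set x := 1 - c with hx
  have hx0 : 0 ≤ x := by linarith
  have hx2 : x ≤ 2 := by linarith
  have hchi : Complex.normSq (chi τ θ) = u ^ 3 / (p * r) ^ 2 := by
    rw [chi, funPhi, funPhi, funD, funD]
    simp only [map_mul, map_div₀, map_pow, map_inv₀, hN, hA, hB, hN0, hA0, hB0, hexp, hu, hp, hr]
    have t4 : 0 < (1 - τ) ^ 2 + 2 * τ * x := by positivity
    have t5 : 0 < (3 - τ) ^ 2 + 6 * τ * x := by positivity
    norm_num
    field_simp
  obtain ⟨hu0, hu1, hp1, hr1⟩ := factor_bounds h0 h1 hc1 hc2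
  have hmain : Complex.normSq (chi τ θ) ≤ (1 + x)⁻¹ := by
    rw [hchi]
    exact cube_div_sq_le hx0 hx2 hu0 hu1 hp1 hr1
  have hxθ : θ ^ 2 / 5 ≤ x := by
    have h2 := Real.cos_le_one_sub_mul_cos_sq hθ
    have h3 : Real.pi ^ 2 ≤ 10 := by nlinarith [Real.pi_lt_d2, Real.pi_pos]
    have h4 : (1 : ℝ) / 5 ≤ 2 / Real.pi ^ 2 := by
      rw [div_le_div_iff₀ (by norm_num) (by positivity)]; linarith
    nlinarith [mul_le_mul_of_nonneg_right h4 (sq_nonneg θ)]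
  have hexp2 : (1 + x)⁻¹ ≤ Real.exp (-(x / 3)) := by
    have h2 := Real.add_one_le_exp (-(x / (1 + x)))
    have h3 : -(x / (1 + x)) + 1 = (1 + x)⁻¹ := by field_simp; ring
    rw [h3] at h2
    refine h2.trans (Real.exp_le_exp.2 (neg_le_neg ?_))
    rw [div_le_div_iff₀ (by norm_num) (by positivity)]
    nlinarith
  have hsq : ‖chi τ θ‖ ^ 2 ≤ Real.exp (-(1 / 30) * θ ^ 2) ^ 2 := by
    rw [← Complex.normSq_eq_norm_sq, ← Real.exp_nat_mul]
    refine hmain.trans (hexp2.trans (Real.exp_le_exp.2 ?_))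
    push_cast
    linarith
  exact (pow_le_pow_iff_left₀ (norm_nonneg _) (Real.exp_nonneg _) two_ne_zero).1 hsq

end VMultigraph

/-! ### The saddle point and the asymptotics of the coefficients. -/

namespace VMultigraph

/-- The saddle point and its relation to `s = √3` and `m = √(9 + 6 √3)`. -/
structure IsSaddle (s m τ : ℝ) : Prop where
  sq_s : s ^ 2 = 3
  sq_m : m ^ 2 = 9 + 6 * s
  τ_eq : τ = 3 + s - m
  s_gt : 1.7320508 < s
  s_lt : s < 1.7320509
  m_gt : 4.403669 < m
  m_lt : m < 4.40367

theorem exists_isSaddle : IsSaddle √3 √(9 + 6 * √3) (3 + √3 - √(9 + 6 * √3)) := by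
  have h1 : 1.7320508 < √3 := Real.lt_sqrt_of_sq_lt (by norm_num)
  have h2 : √3 < 1.7320509 := (Real.sqrt_lt' (by norm_num)).2 (by norm_num)
  refine ⟨Real.sq_sqrt (by norm_num), Real.sq_sqrt (by positivity), rfl, h1, h2, ?_, ?_⟩
  · exact Real.lt_sqrt_of_sq_lt (by norm_num; linarith)
  · exact (Real.sqrt_lt' (by norm_num)).2 (by norm_num; linarith)

namespace IsSaddle

variable {s m τ : ℝ} (h : IsSaddle s m τ)
include h

theorem τ_gt : 0.328 < τ := by linarith [h.τ_eq, h.s_gt, h.m_lt]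

theorem τ_lt : τ < 0.3285 := by linarith [h.τ_eq, h.s_lt, h.m_gt]

theorem τ_pos : 0 < τ := by linarith [h.τ_gt]

theorem m_pos : 0 < m := by linarith [h.m_gt]

theorem s_pos : 0 < s := by linarith [h.s_gt]

/-- `τ` is a root of `x² - 2(3 + s)x + 3`, so `τ + 3 / τ = 6 + 2s` and `3 / τ - τ = 2m`. Hence `3 -
τ²`, `(1 - τ)(3 - τ)` and `3 - 6τ + τ²` are all multiples of `τ` by elements of `ℤ[s, m]`, and the
later evaluations become monomial. -/
theorem three_sub_sq : 3 - τ ^ 2 = 2 * m * τ := by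
  rw [h.τ_eq]
  linear_combination - h.sq_s + h.sq_m

theorem mul_conj : τ * (3 + s + m) = 3 := by
  rw [h.τ_eq]
  linear_combination h.sq_s - h.sq_m

theorem one_sub_mul : (1 - τ) * (3 - τ) = 2 * (1 + s) * τ := by
  linear_combination - h.three_sub_sq - 2 * h.mul_conj

theorem numerator : 3 - 6 * τ + τ ^ 2 = 2 * s * τ := by
  linear_combination - h.three_sub_sq - 2 * h.mul_conj

theorem tendsto_chi (t : ℝ) : Tendsto (fun n : ℕ => (n : ℂ) * (chi τ (t / √n) - 1)) atTop
    (nhds (-(((3 - s) / 2 : ℝ) : ℂ) * t ^ 2)) := by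
  have h1 := h.τ_lt
  -- The quotients defining `P`, `B`, `E`, written as polynomials in `s` and `m`. In this form `3P +
  -- 1 = 2B` is an identity, which confirms that `τ` is the saddle point.
  refine VMultigraph.tendsto_chi h.τ_pos (by linarith) (P := (s - 1) * m / 3 - 1)
    (B := ((s - 1) * m - 2) / 2) (E := (2 * s - (s - 1) * m) / 4) ?_ ?_ ?_ (by ring) ?_ t
  · rw [h.three_sub_sq, h.τ_eq]
    linear_combination (2 * (3 + s - m)) * ((s - 1) / 3 * h.sq_m + 2 * h.sq_s)
  · rw [h.one_sub_mul, h.τ_eq]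
    linear_combination (3 + s - m) * (m * h.sq_s)
  · rw [h.one_sub_mul, h.τ_eq]
    linear_combination (3 + s - m) * ((2 - m) / 2 * h.sq_s)
  · linear_combination (-(s - 1) ^ 2 / 12) * h.sq_m - (s / 2 - 1 / 4) * h.sq_s

theorem funPhi_eq : funPhi τ = ((m ^ 3 * τ / (2 * (1 + s) ^ 2) : ℝ) : ℂ) := by
  have h1 : funN τ = ((2 * m * τ : ℝ) : ℂ) := by
    rw [← h.three_sub_sq, funN]; push_cast; ring
  have h2 : funD τ = ((2 * (1 + s) * τ : ℝ) : ℂ) := by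
    rw [← h.one_sub_mul, funD]; push_cast; ring
  have h3 : m ^ 3 * τ / (2 * (1 + s) ^ 2) = 1 / 4 * (2 * m * τ) ^ 3 * (2 * (1 + s) * τ)⁻¹ ^ 2 := by
    have := h.τ_pos
    have := h.s_pos
    field_simp
    ring
  rw [funPhi, h1, h2, h3]
  push_cast
  ring

theorem amp_zero : amp τ 0 = ((s / (m ^ 2 * τ) : ℝ) : ℂ) := by
  have h1 : funN τ = ((2 * m * τ : ℝ) : ℂ) := by
    rw [← h.three_sub_sq, funN]; push_cast; ring
  have h2 : (3 - 6 * τ + τ ^ 2 : ℂ) = ((2 * s * τ : ℝ) : ℂ) := by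
    rw [← h.numerator]; push_cast; ring
  have h3 : s / (m ^ 2 * τ) = 2 * (2 * s * τ) * (2 * m * τ)⁻¹ ^ 2 := by
    have := h.τ_pos
    have := h.m_pos
    field_simp
  have h4 : amp τ 0 = funW' τ := by simp [amp]
  rw [h4, funW', h1, h2, h3]
  push_cast
  ring

theorem norm_amp_le : ∃ M, ∀ θ, ‖amp τ θ‖ ≤ M := by
  have hc := (continuous_chi_amp h.τ_pos (by linarith [h.τ_lt])).2
  have hper : Function.Periodic (amp τ) (2 * Real.pi) := by
    intro θ
    have : Complex.exp (Complex.I * ((θ + 2 * Real.pi : ℝ) : ℂ)) = Complex.exp (Complex.I * θ) := by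
      push_cast
      rw [mul_add, Complex.exp_add, show Complex.I * (2 * (Real.pi : ℂ)) = 2 * Real.pi * Complex.I by
        ring, Complex.exp_two_pi_mul_I, mul_one]
    rw [amp, amp, this]
  obtain ⟨M, hM⟩ := (hper.isBounded_of_continuous (by positivity) hc).exists_norm_le
  exact ⟨M, fun θ => hM _ ⟨θ, rfl⟩⟩

theorem tendsto_coeff : Tendsto (fun k : ℕ => √((k : ℝ) + 1) * (2 * Real.pi *
    (PowerSeries.coeff k (PowerSeries.derivative ℝ serW * serPhi ^ (k + 1)) * τ ^ k) /
      (m ^ 3 * τ / (2 * (1 + s) ^ 2)) ^ (k + 1))) atTop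
    (nhds (s / (m ^ 2 * τ) * √(Real.pi / ((3 - s) / 2)))) := by
  obtain ⟨M, hM⟩ := h.norm_amp_le
  have h1 : τ < 1 := by linarith [h.τ_lt]
  obtain ⟨hc1, hc2⟩ := continuous_chi_amp h.τ_pos h1
  have key := tendsto_sqrt_mul_integral_pow hc2 hc1 (κ := 1 / 30) (by norm_num) hM
    (fun θ hθ => norm_chi_le h.τ_gt h.τ_lt hθ) h.tendsto_chi
  -- The exponent is `k + 1`, so Laplace's limit is used with `n = k + 1`.
  have key' := (Complex.continuous_re.tendsto _).comp ((tendsto_add_atTop_iff_nat 1).2 key)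
  rw [h.amp_zero, ← Complex.ofReal_mul, Complex.ofReal_re] at key'
  refine key'.congr fun k => ?_
  have hpos : m ^ 3 * τ / (2 * (1 + s) ^ 2) ≠ 0 := by
    have := h.τ_pos
    have := h.s_pos
    have := h.m_pos
    positivity
  have hφ : funPhi τ ≠ 0 := by
    rw [h.funPhi_eq]
    exact_mod_cast hpos
  have h2 := coeff_eq_integral h.τ_pos h1 hφ k
  rw [h.funPhi_eq] at h2
  have h3 : ∫ θ in (-Real.pi)..Real.pi, amp τ θ * chi τ θ ^ (k + 1) = ((2 * Real.pi *
    (PowerSeries.coeff k (PowerSeries.derivative ℝ serW * serPhi ^ (k + 1)) * τ ^ k) /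
      (m ^ 3 * τ / (2 * (1 + s) ^ 2)) ^ (k + 1) : ℝ) : ℂ) := by
    rw [Complex.ofReal_div, eq_div_iff (by exact_mod_cast pow_ne_zero _ hpos), mul_comm]
    push_cast at h2 ⊢
    exact h2.symm
  simp only [Function.comp_apply]
  rw [h3, ← Complex.ofReal_mul, Complex.ofReal_re]
  push_cast
  rfl

end IsSaddle

end VMultigraph

/-! ### Evaluation of the constants and conclusion. -/

namespace VMultigraph

open PowerSeries

theorem IsSaddle.gammaSP_eq {s m τ : ℝ} (h : IsSaddle s m τ) (hs : s = √3) :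
    gammaSP = τ / (m ^ 3 * τ / (2 * (1 + s) ^ 2)) := by
  have h1 := h.τ_pos
  have h2 := h.m_pos
  have h3 := h.s_pos
  -- Since `τ / φ(τ) = 2 (1 + s)² / m³`, this is the claim about `γ`; squares are compared and
  -- reduced by `s² = 3`, `m² = 9 + 6s`.
  have h4 : √(6 * s - 9) = 27 * (1 + s) ^ 2 / (2 * m ^ 3) := by
    have h6 : m ^ 6 = 27 * (135 + 78 * s) := by
      have : m ^ 6 = (m ^ 2) ^ 3 := by ring
      rw [this, h.sq_m]
      linear_combination (972 + 216 * s) * h.sq_s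
    have h7 : (1 + s) ^ 4 = 28 + 16 * s := by
      linear_combination (s ^ 2 + 4 * s + 9) * h.sq_s
    rw [Real.sqrt_eq_iff_mul_self_eq (by linarith [h.s_gt]) (by positivity)]
    rw [div_mul_div_comm, eq_div_iff (by positivity)]
    linear_combination 4 * (6 * s - 9) * h6 - 729 * h7 + 50544 * h.sq_s
  rw [gammaSP, ← hs, h4]
  field_simp
  ring

theorem IsSaddle.const_bounds {s m τ : ℝ} (h : IsSaddle s m τ) :
    |m * s * √(Real.pi / ((3 - s) / 2)) / (12 * Real.pi * (1 + s) ^ 2) - 0.06034| < 0.000005 := by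
  have hπ1 := Real.pi_gt_d6
  have hπ2 := Real.pi_lt_d6
  have hs1 := h.s_gt
  have hs2 := h.s_lt
  have ha : 0 < (3 - s) / 2 := by linarith
  have hR1 : 2.22606 < √(Real.pi / ((3 - s) / 2)) := by
    refine Real.lt_sqrt_of_sq_lt ?_
    rw [lt_div_iff₀ ha]
    linarith
  have hR2 : √(Real.pi / ((3 - s) / 2)) < 2.22608 := by
    rw [Real.sqrt_lt' (by norm_num), div_lt_iff₀ ha]
    linarith
  set R := √(Real.pi / ((3 - s) / 2))
  have hms1 : 7.62737 < m * s := by nlinarith [h.m_gt]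
  have hms2 : m * s < 7.62739 := by nlinarith [h.m_lt, h.m_gt]
  have hn1 : 16.97898 < m * s * R := by nlinarith
  have hn2 : m * s * R < 16.97919 := by nlinarith
  have hs3 : (1 + s) ^ 2 = 4 + 2 * s := by linear_combination h.sq_s
  have hd1 : 281.389 < 12 * Real.pi * (1 + s) ^ 2 := by rw [hs3]; nlinarith
  have hd2 : 12 * Real.pi * (1 + s) ^ 2 < 281.391 := by rw [hs3]; nlinarith
  have hd0 : 0 < 12 * Real.pi * (1 + s) ^ 2 := by linarith
  rw [abs_lt]
  constructor
  · rw [lt_sub_iff_add_lt, lt_div_iff₀ hd0]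
    linarith
  · rw [sub_lt_iff_lt_add, div_lt_iff₀ hd0]
    linarith

theorem abs_gammaSP_sub_lt : |gammaSP - 0.17481| < 0.000005 := by
  have h1 : 1.7320508 < √3 := Real.lt_sqrt_of_sq_lt (by norm_num)
  have h2 : √3 < 1.7320509 := (Real.sqrt_lt' (by norm_num)).2 (by norm_num)
  have h3 : 1.179935 < √(6 * √3 - 9) := Real.lt_sqrt_of_sq_lt (by norm_num; linarith)
  have h4 : √(6 * √3 - 9) < 1.18 := (Real.sqrt_lt' (by norm_num)).2 (by norm_num; linarith)
  rw [gammaSP, abs_lt]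
  constructor <;> linarith

/-- The factors `k (k + 1)` come from `g_eq_coeff` and `√(k + 1)` from Laplace's method; together
they produce the exponent `-5/2`. -/
theorem tendsto_rpow_ratio : Tendsto (fun k : ℕ => ((k : ℝ) * (k + 1) * √((k : ℝ) + 1))⁻¹ /
    (k : ℝ) ^ (-(5 / 2) : ℝ)) atTop (nhds 1) := by
  have h1 : Tendsto (fun k : ℕ => (k : ℝ) / (k + 1)) atTop (nhds 1) :=
    tendsto_natCast_div_add_atTop 1
  have h2 := h1.mul ((Real.continuous_sqrt.tendsto _).comp h1)
  rw [Real.sqrt_one, mul_one] at h2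
  refine h2.congr' ?_
  filter_upwards [eventually_gt_atTop 0] with k hk
  have hk' : (0 : ℝ) < k := by exact_mod_cast hk
  have h3 : (k : ℝ) ^ (5 / 2 : ℝ) = k ^ 2 * √k := by
    rw [Real.sqrt_eq_rpow, ← Real.rpow_natCast, ← Real.rpow_add hk']
    norm_num
  rw [Real.rpow_neg hk'.le, h3, Function.comp_apply, Real.sqrt_div hk'.le]
  have h4 : 0 < √(k : ℝ) := Real.sqrt_pos.2 hk'
  have h5 : 0 < √((k : ℝ) + 1) := Real.sqrt_pos.2 (by positivity)
  field_simp

theorem g_isEquivalent {s m τ : ℝ} (h : IsSaddle s m τ) (hs : s = √3) :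
    (fun k : ℕ => g k) ~[atTop] (fun k : ℕ =>
      m * s * √(Real.pi / ((3 - s) / 2)) / (12 * Real.pi * (1 + s) ^ 2) *
        (k : ℝ) ^ (-(5 / 2) : ℝ) * gammaSP ^ (-(k : ℤ))) := by
  have hτ := h.τ_pos
  have hm := h.m_pos
  have hs0 := h.s_pos
  have ha : 0 < (3 - s) / 2 := by linarith [h.s_lt]
  set R := √(Real.pi / ((3 - s) / 2)) with hRdef
  have hR : 0 < R := Real.sqrt_pos.2 (by positivity)
  set φ := m ^ 3 * τ / (2 * (1 + s) ^ 2) with hφdef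
  have hφ : 0 < φ := by positivity
  set c := m * s * R / (12 * Real.pi * (1 + s) ^ 2) with hcdef
  have hc : 0 < c := by positivity
  -- The factor `6π` collects the `2π` of the Fourier integral and the `3` of `g_eq_coeff`; the `1 /
  -- φ` reflects the power `φ ^ (k + 1)` against `γ ^ (-k) = (φ / τ) ^ k`.
  have hcL : s / (m ^ 2 * τ) * R = 6 * Real.pi * c / φ := by
    rw [hcdef, hφdef]
    field_simp
    norm_num
  have hγ : gammaSP = τ / φ := h.gammaSP_eq hs
  have hlim := h.tendsto_coeff
  rw [hcL, ← hφdef] at hlim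
  have hmain := ((hlim.mul_const (φ / (6 * Real.pi * c))).mul tendsto_rpow_ratio)
  have h1 : 6 * Real.pi * c / φ * (φ / (6 * Real.pi * c)) * 1 = 1 := by
    field_simp
  rw [h1] at hmain
  have hγ0 : 0 < gammaSP := by rw [hγ]; positivity
  clear_value φ c
  rw [isEquivalent_iff_tendsto_one]
  · refine hmain.congr' ?_
    filter_upwards [eventually_gt_atTop 0] with k hk
    have hk' : (0 : ℝ) < k := by exact_mod_cast hk
    have h5 : 0 < √((k : ℝ) + 1) := Real.sqrt_pos.2 (by positivity)
    have h6 : 0 < (k : ℝ) ^ (-(5 / 2) : ℝ) := Real.rpow_pos_of_pos hk' _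
    rw [Pi.div_apply, g_eq_coeff hk.ne', hγ, zpow_neg, zpow_natCast, div_pow τ φ k, pow_succ φ k]
    field_simp
    ring
  · filter_upwards [eventually_gt_atTop 0] with k hk
    have hk' : (0 : ℝ) < k := by exact_mod_cast hk
    have h6 : 0 < (k : ℝ) ^ (-(5 / 2) : ℝ) := Real.rpow_pos_of_pos hk' _
    positivity

end VMultigraph

theorem mainTheorem5 :
    |gammaSP - 0.17481| < 0.000005 ∧
    ∃ c : ℝ, |c - 0.06034| < 0.000005 ∧
      (fun k : ℕ => VMultigraph.g k) ~[atTop]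
        (fun k : ℕ => c * (k : ℝ) ^ (-(5 / 2) : ℝ) * gammaSP ^ (-(k : ℤ))) :=
  ⟨VMultigraph.abs_gammaSP_sub_lt, _, VMultigraph.exists_isSaddle.const_bounds,
    VMultigraph.g_isEquivalent VMultigraph.exists_isSaddle rfl⟩
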